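/- Let $G$ be a locally compact (Hausdorff) group that is maximally almost periodic, i.e. the finite-dimensional (continuous) unitary representations of $G$ separate the points of $G$. Let $B(G)=\{\langle\sigma(\cdot)\xi,\eta\rangle\}$ be the Fourier–Stieltjes algebra, consisting of all coefficients of strongly continuous unitary representations $\sigma$ of $G$, with norm $\|u\|=\inf\{\|\xi\|\|\eta\| : u=\langle\sigma(\cdot)\xi,\eta\rangle\}$, and with the operator space structure and weak* topology of the dual of the full group $C^*$-algebra $C^*(G)$ under the pairing $\langle a,\langle\sigma(\cdot)\xi,\eta\rangle\rangle=\langle\sigma(a)\xi,\eta\rangle$. Let $A(G)$ be the Fourier algebra, the norm-closed linear span in $B(G)$ of the coefficients of the left regular representation. Let $\pi$ be the direct sum of all finite-dimensional irreducible unitary representations of $G$ (one from each equivalence class), and let $B_\pi$ be the weak*-closed linear span in $B(G)$ of the coefficients of $\pi$. Then $B=B_\pi$ is a weak*-closed (unital) subalgebra of $B(G)$ that contains $A(G)$ and is operator Connes-amenable. The latter means the following. Let $E=X^*$ be the dual operator space of any complete operator space $X$, made into a $B$-bimodule by (jointly) completely bounded actions such that $x\mapsto b\cdot x$ and $x\mapsto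 x\cdot b$ are weak*-continuous on $E$ for each $b\in B$, and $b\mapsto b\cdot x$ and $b\mapsto x\cdot b$ are weak*-continuous from $B$ to $E$ for each $x\in E$. Then for every weak*-continuous, completely bounded derivation $D\colon B\to E$ there is $x\in E$ with $D(b)=b\cdot x-x\cdot b$ for all $b\in B$. In particular, $B(G)$ admits a weak*-closed subalgebra containing $A(G)$ that is operator Connes-amenable. -/

import Mathlib

open MeasureTheory Topology
open scoped ENNReal InnerProductSpace

universe u v w

/-- A unitary representation of a topological group on a complex Hilbert space, continuous for the
strong operator topology. -/
structure UnitaryRep (G : Type u) [Group G] [TopologicalSpace G] where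
  H : Type v
  [normed : NormedAddCommGroup H]
  [innerSpace : InnerProductSpace ℂ H]
  [complete : CompleteSpace H]
  toHom : G →* (H ≃ₗᵢ[ℂ] H)
  continuous_toHom : ∀ ξ : H, Continuous fun s => toHom s ξ

attribute [instance] UnitaryRep.normed UnitaryRep.innerSpace UnitaryRep.complete

namespace UnitaryRep

variable {G : Type u} [Group G] [TopologicalSpace G]

/-- The matrix coefficient `s ↦ ⟨π(s)ξ, η⟩` (Mathlib's inner product is conjugate-linear in its
first argument). -/
noncomputable def coeff (π : UnitaryRep.{u, v} G) (ξ η : π.H) : G → ℂ := fun s => ⟪η, π.toHom s ξ⟫_ℂ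

/-- Unitary equivalence. -/
def Equivalent (π : UnitaryRep.{u, v} G) (σ : UnitaryRep.{u, w} G) : Prop :=
  ∃ U : π.H ≃ₗᵢ[ℂ] σ.H, ∀ s ξ, U (π.toHom s ξ) = σ.toHom s (U ξ)

/-- Irreducibility: the space is nonzero and has no proper nonzero closed invariant subspace. -/
def IsIrreducible (π : UnitaryRep.{u, v} G) : Prop :=
  Nontrivial π.H ∧ ∀ K : Submodule ℂ π.H, IsClosed (K : Set π.H) →
    (∀ s, ∀ ξ ∈ K, π.toHom s ξ ∈ K) → K = ⊥ ∨ K = ⊤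

section directSum

variable {ι : Type w} (σ : ι → UnitaryRep.{u, v} G)

theorem memℓp_map (s : G) (f : lp (fun i => (σ i).H) 2) :
    Memℓp (fun i => (σ i).toHom s (f i)) 2 := by
  have h := lp.memℓp f
  rw [memℓp_gen_iff (by norm_num)] at h ⊢
  simpa using h

/-- One operator of a Hilbert space direct sum: it acts coordinatewise. -/
noncomputable def directSumOp (s : G) :
    lp (fun i => (σ i).H) 2 ≃ₗᵢ[ℂ] lp (fun i => (σ i).H) 2 where
  toFun f := ⟨fun i => (σ i).toHom s (f i), memℓp_map σ s f⟩
  invFun f := ⟨fun i => (σ i).toHom s⁻¹ (f i), memℓp_map σ s⁻¹ f⟩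
  map_add' f g := by
    ext i
    exact map_add ((σ i).toHom s) (f i) (g i)
  map_smul' c f := by ext i; simp
  left_inv f := by
    ext i
    change (σ i).toHom s⁻¹ ((σ i).toHom s (f i)) = f i
    rw [map_inv]
    exact ((σ i).toHom s).symm_apply_apply _
  right_inv f := by
    ext i
    change (σ i).toHom s ((σ i).toHom s⁻¹ (f i)) = f i
    rw [map_inv]
    exact ((σ i).toHom s).apply_symm_apply _
  norm_map' f := by
    rw [lp.norm_eq_tsum_rpow (by norm_num), lp.norm_eq_tsum_rpow (by norm_num)]
    simp

theorem directSumOp_apply (s : G) (f : lp (fun i => (σ i).H) 2) (i : ι) :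
    directSumOp σ s f i = (σ i).toHom s (f i) := rfl

/-- The Hilbert space direct sum of a family of unitary representations. -/
noncomputable def directSum : UnitaryRep.{u, max v w} G where
  H := lp (fun i => (σ i).H) 2
  toHom :=
    { toFun := directSumOp σ
      map_one' := by
        ext f i
        simp [directSumOp_apply]
      map_mul' s t := by
        ext f i
        simp [directSumOp_apply] }
  continuous_toHom := by
    classical
    intro f
    have key : ∀ F : Finset ι, Continuous fun s => directSumOp σ s (∑ i ∈ F, lp.single 2 i (f i)) := by
      intro F
      have : ∀ s, directSumOp σ s (∑ i ∈ F, lp.single 2 i (f i)) =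
          ∑ i ∈ F, lp.single 2 i ((σ i).toHom s (f i)) := by
        intro s
        rw [map_sum]
        refine Finset.sum_congr rfl fun i _ => ?_
        ext j
        rw [directSumOp_apply]
        by_cases h : j = i
        · subst h; simp
        · simp [lp.single_apply, h]
      simp only [this]
      refine continuous_finsetSum _ fun i _ => ?_
      exact (lp.isometry_single i).continuous.comp ((σ i).continuous_toHom (f i))
    have hs := lp.hasSum_single (E := fun i => (σ i).H) (p := 2) (by norm_num) f
    have hu : TendstoUniformly (fun (F : Finset ι) s => directSumOp σ s (∑ i ∈ F, lp.single 2 i (f i)))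
        (fun s => directSumOp σ s f) Filter.atTop := by
      rw [Metric.tendstoUniformly_iff]
      intro ε hε
      filter_upwards [(Metric.tendsto_nhds.1 hs) ε hε] with F hF s
      rw [(directSumOp σ s).dist_map, dist_comm]
      exact hF
    exact hu.continuous (Filter.Frequently.of_forall key)

end directSum

end UnitaryRep

section regular
variable (G : Type u) [Group G] [TopologicalSpace G] [IsTopologicalGroup G]
  [LocallyCompactSpace G] [MeasurableSpace G] [BorelSpace G]

/-- The left regular representation on `L²(G)`: `(λ(s)ξ)(t) = ξ(s⁻¹t)`. -/
noncomputable def leftRegular : UnitaryRep.{u, u} G where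
  H := Lp ℂ 2 (Measure.haar : Measure G)
  toHom :=
    { toFun := fun s =>
        { toFun := fun ξ => DomMulAct.mk s⁻¹ • ξ
          invFun := fun ξ => DomMulAct.mk s • ξ
          map_add' := fun ξ η => smul_add _ _ _
          map_smul' := fun c ξ => smul_comm _ _ _
          left_inv := fun ξ => by
            change DomMulAct.mk s • DomMulAct.mk s⁻¹ • ξ = ξ
            rw [← mul_smul, ← DomMulAct.mk_mul]; simp
          right_inv := fun ξ => by
            change DomMulAct.mk s⁻¹ • DomMulAct.mk s • ξ = ξ
            rw [← mul_smul, ← DomMulAct.mk_mul]; simp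
          norm_map' := fun ξ => DomMulAct.norm_smul_Lp _ _ }
      map_one' := by
        ext1 ξ
        change DomMulAct.mk (1 : G)⁻¹ • ξ = ξ
        simp
      map_mul' := fun s t => by
        ext1 ξ
        change DomMulAct.mk (s * t)⁻¹ • ξ = DomMulAct.mk s⁻¹ • DomMulAct.mk t⁻¹ • ξ
        rw [← mul_smul, ← DomMulAct.mk_mul, mul_inv_rev] }
  continuous_toHom := fun ξ => by
    change Continuous fun s : G => DomMulAct.mk s⁻¹ • ξ
    have h : Continuous fun s : G => DomMulAct.mk s⁻¹ :=
      DomMulAct.continuous_mk.comp continuous_inv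
    have : Fact ((2 : ℝ≥0∞) ≠ ∞) := ⟨by norm_num⟩
    exact h.smul continuous_const

end regular

/-! ### Operator spaces -/

section OperatorSpaces

open scoped Matrix.Norms.L2Operator

/-- A complete abstract operator space: a Banach space with norms on all the matrix spaces
`M_n(V)` that satisfy Ruan's axioms. -/
class OperatorSpace (V : Type w) [NormedAddCommGroup V] [NormedSpace ℂ V] [CompleteSpace V] where
  mnorm : ∀ {n : ℕ}, Matrix (Fin n) (Fin n) V → ℝ
  mnorm_one : ∀ x : Matrix (Fin 1) (Fin 1) V, mnorm x = ‖x 0 0‖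
  mnorm_add : ∀ {n : ℕ} (x y : Matrix (Fin n) (Fin n) V), mnorm (x + y) ≤ mnorm x + mnorm y
  mnorm_smul : ∀ {n : ℕ} (c : ℂ) (x : Matrix (Fin n) (Fin n) V), mnorm (c • x) = ‖c‖ * mnorm x
  mnorm_mul : ∀ {m n : ℕ} (α : Matrix (Fin m) (Fin n) ℂ) (x : Matrix (Fin n) (Fin n) V)
    (β : Matrix (Fin n) (Fin m) ℂ),
    mnorm (Matrix.of fun i j => ∑ k, ∑ l, (α i k * β l j) • x k l) ≤ ‖α‖ * mnorm x * ‖β‖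
  mnorm_directSum : ∀ {m n : ℕ} (x : Matrix (Fin m) (Fin m) V) (y : Matrix (Fin n) (Fin n) V),
    mnorm (Matrix.reindex finSumFinEquiv finSumFinEquiv (Matrix.fromBlocks x 0 0 y)) =
      max (mnorm x) (mnorm y)

/-- The matrix norms of the dual operator space: `M_n(V^*)` is normed as `CB(V, M_n)`, that is, a
matrix of functionals has the least `C` with `‖[φ_{ij}(x_{kl})]‖ ≤ C ‖x‖` for every matrix `x`. -/
noncomputable def dualMNorm {V : Type w} [NormedAddCommGroup V] [NormedSpace ℂ V] [CompleteSpace V]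
    [OperatorSpace V] {ι : Type} [Fintype ι] [DecidableEq ι] (φ : Matrix ι ι (StrongDual ℂ V)) :
    ℝ :=
  sInf {C : ℝ | 0 ≤ C ∧ ∀ (m : ℕ) (x : Matrix (Fin m) (Fin m) V),
    ‖(Matrix.of fun p q : ι × Fin m => φ p.1 q.1 (x p.2 q.2))‖ ≤ C * OperatorSpace.mnorm x}

section concrete

variable {H : Type w} [NormedAddCommGroup H] [InnerProductSpace ℂ H]

/-- The norm of a matrix of operators on `H`, as an operator on the Hilbert space `H^n`: the least
`C` with `‖xξ‖ ≤ C ‖ξ‖` for every `ξ` in `H^n`. -/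
noncomputable def opMNorm {n : ℕ} (x : Matrix (Fin n) (Fin n) (H →L[ℂ] H)) : ℝ :=
  sInf {C : ℝ | 0 ≤ C ∧ ∀ ξ : PiLp 2 (fun _ : Fin n => H),
    ‖(WithLp.toLp 2 fun i => ∑ j, x i j (ξ j) : PiLp 2 (fun _ : Fin n => H))‖ ≤ C * ‖ξ‖}

theorem opMNorm_nonneg {n : ℕ} (x : Matrix (Fin n) (Fin n) (H →L[ℂ] H)) : 0 ≤ opMNorm x :=
  Real.sInf_nonneg fun _ h => h.1

theorem opMNorm_le_of_bound {n : ℕ} (x : Matrix (Fin n) (Fin n) (H →L[ℂ] H)) {C : ℝ} (hC : 0 ≤ C)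
    (h : ∀ ξ : PiLp 2 (fun _ : Fin n => H),
      ‖(WithLp.toLp 2 fun i => ∑ j, x i j (ξ j) : PiLp 2 (fun _ : Fin n => H))‖ ≤ C * ‖ξ‖) :
    opMNorm x ≤ C :=
  csInf_le ⟨0, fun _ h => h.1⟩ ⟨hC, h⟩

theorem opMNorm_bound {n : ℕ} (x : Matrix (Fin n) (Fin n) (H →L[ℂ] H))
    (ξ : PiLp 2 (fun _ : Fin n => H)) :
    ‖(WithLp.toLp 2 fun i => ∑ j, x i j (ξ j) : PiLp 2 (fun _ : Fin n => H))‖ ≤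
      opMNorm x * ‖ξ‖ := by
  have hne : {C : ℝ | 0 ≤ C ∧ ∀ ξ : PiLp 2 (fun _ : Fin n => H),
      ‖(WithLp.toLp 2 fun i => ∑ j, x i j (ξ j) : PiLp 2 (fun _ : Fin n => H))‖ ≤
        C * ‖ξ‖}.Nonempty := by
    refine ⟨√(∑ i, ∑ j, ‖x i j‖ ^ 2), Real.sqrt_nonneg _, fun ξ => ?_⟩
    refine (sq_le_sq₀ (norm_nonneg _) (by positivity)).1 ?_
    rw [mul_pow, Real.sq_sqrt (by positivity), PiLp.norm_sq_eq_of_L2, PiLp.norm_sq_eq_of_L2,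
      Finset.sum_mul]
    refine Finset.sum_le_sum fun i _ => ?_
    refine le_trans (pow_le_pow_left₀ (norm_nonneg _) ?_ 2)
      (Finset.sum_mul_sq_le_sq_mul_sq Finset.univ (fun j => ‖x i j‖) (fun j => ‖ξ j‖))
    change ‖∑ j, x i j (ξ j)‖ ≤ _
    exact (norm_sum_le _ _).trans (Finset.sum_le_sum fun j _ => (x i j).le_opNorm _)
  rcases (norm_nonneg ξ).eq_or_lt with h0 | h0
  · obtain ⟨C, hC⟩ := hne
    have := hC.2 ξ
    rw [← h0, mul_zero] at this ⊢
    exact this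
  · rw [← div_le_iff₀ h0]
    refine le_csInf hne fun C hC => ?_
    rw [div_le_iff₀ h0]
    exact hC.2 ξ

theorem opMNorm_bound_sq {n : ℕ} (x : Matrix (Fin n) (Fin n) (H →L[ℂ] H)) (ξ : Fin n → H) :
    ∑ i, ‖∑ j, x i j (ξ j)‖ ^ 2 ≤ opMNorm x ^ 2 * ∑ j, ‖ξ j‖ ^ 2 := by
  have h2 := pow_le_pow_left₀ (norm_nonneg _) (opMNorm_bound x (WithLp.toLp 2 ξ)) 2
  rw [mul_pow, PiLp.norm_sq_eq_of_L2, PiLp.norm_sq_eq_of_L2] at h2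
  exact h2

theorem opMNorm_le_of_sq {n : ℕ} (x : Matrix (Fin n) (Fin n) (H →L[ℂ] H)) {C : ℝ} (hC : 0 ≤ C)
    (h : ∀ ξ : Fin n → H, ∑ i, ‖∑ j, x i j (ξ j)‖ ^ 2 ≤ C ^ 2 * ∑ j, ‖ξ j‖ ^ 2) :
    opMNorm x ≤ C := by
  refine opMNorm_le_of_bound _ hC fun ξ => ?_
  refine (sq_le_sq₀ (norm_nonneg _) (by positivity)).1 ?_
  rw [mul_pow, PiLp.norm_sq_eq_of_L2, PiLp.norm_sq_eq_of_L2]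
  exact h _

theorem opMNorm_add_le {n : ℕ} (x y : Matrix (Fin n) (Fin n) (H →L[ℂ] H)) :
    opMNorm (x + y) ≤ opMNorm x + opMNorm y := by
  refine opMNorm_le_of_bound _ (add_nonneg (opMNorm_nonneg x) (opMNorm_nonneg y)) fun ξ => ?_
  have h : (WithLp.toLp 2 fun i => ∑ j, (x + y) i j (ξ j) : PiLp 2 (fun _ : Fin n => H)) =
      WithLp.toLp 2 (fun i => ∑ j, x i j (ξ j)) + WithLp.toLp 2 (fun i => ∑ j, y i j (ξ j)) := by
    ext i
    simp [Finset.sum_add_distrib]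
  rw [h, add_mul]
  exact (norm_add_le _ _).trans (add_le_add (opMNorm_bound x ξ) (opMNorm_bound y ξ))

theorem opMNorm_smul_le {n : ℕ} (c : ℂ) (x : Matrix (Fin n) (Fin n) (H →L[ℂ] H)) :
    opMNorm (c • x) ≤ ‖c‖ * opMNorm x := by
  refine opMNorm_le_of_sq _ (mul_nonneg (norm_nonneg c) (opMNorm_nonneg x)) fun ξ => ?_
  have h : ∀ i, ‖∑ j, (c • x) i j (ξ j)‖ ^ 2 = ‖c‖ ^ 2 * ‖∑ j, x i j (ξ j)‖ ^ 2 := by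
    intro i
    rw [← mul_pow, ← norm_smul, Finset.smul_sum]
    rfl
  simp only [h]
  rw [← Finset.mul_sum, mul_pow, mul_assoc]
  exact mul_le_mul_of_nonneg_left (opMNorm_bound_sq x ξ) (by positivity)

theorem scalar_bound {m n : ℕ} (α : Matrix (Fin m) (Fin n) ℂ) (ξ : Fin n → H) :
    ∑ i, ‖∑ k, α i k • ξ k‖ ^ 2 ≤ ‖α‖ ^ 2 * ∑ k, ‖ξ k‖ ^ 2 := by
  let S : Submodule ℂ H := Submodule.span ℂ (Set.range ξ)
  let ζ : Fin n → S := fun k => ⟨ξ k, Submodule.subset_span ⟨k, rfl⟩⟩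
  have : FiniteDimensional ℂ S := FiniteDimensional.span_of_finite ℂ (Set.finite_range ξ)
  let b := stdOrthonormalBasis ℂ S
  have h1 : ∀ z : S, ‖(z : H)‖ ^ 2 = ∑ t, ‖⟪b t, z⟫_ℂ‖ ^ 2 := fun z =>
    (b.sum_sq_norm_inner_right z).symm
  have h2 : ∀ i, ‖∑ k, α i k • ξ k‖ ^ 2 = ∑ t, ‖∑ k, α i k * ⟪b t, ζ k⟫_ℂ‖ ^ 2 := by
    intro i
    have : ∑ k, α i k • ξ k = ((∑ k, α i k • ζ k : S) : H) := by simp [ζ]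
    rw [this, h1]
    simp only [inner_sum, inner_smul_right]
  have h3 : ∀ k, ‖ξ k‖ ^ 2 = ∑ t, ‖⟪b t, ζ k⟫_ℂ‖ ^ 2 := fun k => h1 (ζ k)
  simp only [h2, h3]
  rw [Finset.sum_comm, Finset.sum_comm (s := Finset.univ (α := Fin n)), Finset.mul_sum]
  refine Finset.sum_le_sum fun t _ => ?_
  have h := pow_le_pow_left₀ (norm_nonneg _)
    (Matrix.l2_opNorm_mulVec α (WithLp.toLp 2 fun k => ⟪b t, ζ k⟫_ℂ)) 2
  rw [mul_pow, EuclideanSpace.norm_sq_eq, EuclideanSpace.norm_sq_eq] at h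
  simpa [Matrix.mulVec, dotProduct] using h

/-- A closed subspace of `B(H)` is an operator space: `M_n` acts on `H^n`. -/
noncomputable instance Submodule.operatorSpace (V : Submodule ℂ (H →L[ℂ] H)) [CompleteSpace V] :
    OperatorSpace V where
  mnorm x := opMNorm (fun i j => (x i j : H →L[ℂ] H))
  mnorm_one x := by
    refine le_antisymm ?_ ?_
    · refine opMNorm_le_of_sq _ (norm_nonneg _) fun ξ => ?_
      simp only [Finset.univ_unique, Fin.default_eq_zero, Fin.isValue, Finset.sum_singleton]
      rw [← mul_pow]
      exact pow_le_pow_left₀ (norm_nonneg _) ((x 0 0 : H →L[ℂ] H).le_opNorm _) 2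
    · refine ContinuousLinearMap.opNorm_le_bound _ (opMNorm_nonneg _) fun ξ => ?_
      refine (sq_le_sq₀ (norm_nonneg _) (mul_nonneg (opMNorm_nonneg _) (norm_nonneg _))).1 ?_
      have h := opMNorm_bound_sq (fun i j => (x i j : H →L[ℂ] H)) (fun _ => ξ)
      simpa [mul_pow] using h
  mnorm_add x y := opMNorm_add_le (fun i j => (x i j : H →L[ℂ] H)) (fun i j => (y i j : H →L[ℂ] H))
  mnorm_smul c x := by
    refine le_antisymm (opMNorm_smul_le c (fun i j => (x i j : H →L[ℂ] H))) ?_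
    rcases eq_or_ne c 0 with rfl | hc
    · rw [norm_zero, zero_mul]
      exact opMNorm_nonneg _
    · have h := opMNorm_smul_le c⁻¹ (fun i j => ((c • x) i j : H →L[ℂ] H))
      have h' : opMNorm (c⁻¹ • (fun i j => ((c • x) i j : H →L[ℂ] H) : Matrix _ _ (H →L[ℂ] H))) =
          opMNorm (fun i j => (x i j : H →L[ℂ] H)) := by
        congr 1
        ext i j : 2
        exact inv_smul_smul₀ hc _
      rw [norm_inv] at h
      replace h := h'.symm.le.trans h
      have hc' : 0 < ‖c‖ := norm_pos_iff.2 hc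
      rwa [le_inv_mul_iff₀ hc'] at h
  mnorm_mul α x β := by
    refine opMNorm_le_of_sq _ (mul_nonneg (mul_nonneg (norm_nonneg _) (opMNorm_nonneg _))
      (norm_nonneg _)) fun ξ => ?_
    have h1 : ∀ i, ∑ j, ((Matrix.of fun i j => ∑ k, ∑ l, (α i k * β l j) • x k l) i j :
        H →L[ℂ] H) (ξ j) = ∑ k, α i k • ∑ l, (x k l : H →L[ℂ] H) (∑ j, β l j • ξ j) := by
      intro i
      simp only [Matrix.of_apply, AddSubmonoidClass.coe_finsetSum, Submodule.coe_smul,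
        sum_apply, smul_apply, map_sum, map_smul,
        Finset.smul_sum, smul_smul]
      rw [Finset.sum_comm]
      refine Finset.sum_congr rfl fun k _ => ?_
      rw [Finset.sum_comm]
    simp only [h1]
    refine (scalar_bound α _).trans ?_
    rw [mul_pow, mul_pow, mul_assoc, mul_assoc]
    refine mul_le_mul_of_nonneg_left ?_ (by positivity)
    refine (opMNorm_bound_sq (fun k l => (x k l : H →L[ℂ] H)) _).trans ?_
    refine mul_le_mul_of_nonneg_left ?_ (by positivity)
    exact scalar_bound β ξ
  mnorm_directSum {m n} x y := by
    have hsum : ∀ ξ : Fin (m + n) → H,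
        ∑ i, ‖∑ j, ((Matrix.reindex finSumFinEquiv finSumFinEquiv
          (Matrix.fromBlocks x 0 0 y) i j : V) : H →L[ℂ] H) (ξ j)‖ ^ 2 =
        ∑ i, ‖∑ j, (x i j : H →L[ℂ] H) (ξ (Fin.castAdd n j))‖ ^ 2 +
        ∑ i, ‖∑ j, (y i j : H →L[ℂ] H) (ξ (Fin.natAdd m j))‖ ^ 2 := by
      intro ξ
      simp [Fin.sum_univ_add]
    refine le_antisymm ?_ (max_le ?_ ?_)
    · refine opMNorm_le_of_sq _ (le_max_of_le_left (opMNorm_nonneg _)) fun ξ => ?_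
      rw [hsum, Fin.sum_univ_add (fun j => ‖ξ j‖ ^ 2), mul_add]
      refine add_le_add ?_ ?_
      · refine (opMNorm_bound_sq (fun k l => (x k l : H →L[ℂ] H)) _).trans ?_
        exact mul_le_mul_of_nonneg_right (pow_le_pow_left₀ (opMNorm_nonneg _) (le_max_left _ _) 2)
          (by positivity)
      · refine (opMNorm_bound_sq (fun k l => (y k l : H →L[ℂ] H)) _).trans ?_
        exact mul_le_mul_of_nonneg_right (pow_le_pow_left₀ (opMNorm_nonneg _) (le_max_right _ _) 2)
          (by positivity)
    · refine opMNorm_le_of_sq _ (opMNorm_nonneg _) fun ξ => ?_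
      have h := opMNorm_bound_sq (fun i j => ((Matrix.reindex finSumFinEquiv finSumFinEquiv
          (Matrix.fromBlocks x 0 0 y) i j : V) : H →L[ℂ] H)) (Fin.append ξ 0)
      rw [hsum] at h
      simpa [Fin.sum_univ_add] using h
    · refine opMNorm_le_of_sq _ (opMNorm_nonneg _) fun ξ => ?_
      have h := opMNorm_bound_sq (fun i j => ((Matrix.reindex finSumFinEquiv finSumFinEquiv
          (Matrix.fromBlocks x 0 0 y) i j : V) : H →L[ℂ] H)) (Fin.append 0 ξ)
      rw [hsum] at h
      simpa [Fin.sum_univ_add] using h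

end concrete

end OperatorSpaces

/-! ### Dual algebras, normal dual bimodules and operator Connes-amenability -/

section ConnesAmenability

/-- The weak* topology that a space `A` gets from a linear map into the dual of `P`. -/
noncomputable abbrev weakStar {A : Type u} [AddCommGroup A] [Module ℂ A] {P : Type v}
    [NormedAddCommGroup P] [NormedSpace ℂ P] (ι : A →ₗ[ℂ] StrongDual ℂ P) : TopologicalSpace A :=
  TopologicalSpace.induced (fun a => StrongDual.toWeakDual (ι a)) inferInstance

variable {A : Type u} [NonUnitalRing A] [Module ℂ A] {P : Type v} [NormedAddCommGroup P]
  [NormedSpace ℂ P] [CompleteSpace P] [OperatorSpace P]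

/-- A normal, dual operator bimodule over an algebra `A` that carries the matrix norms and the
weak* topology of the dual of `P` through `ι`. The module is the dual operator space of `X`. The
module actions are (jointly) completely bounded, weak*-continuous in the module variable (so that
the module is a dual one), and weak*-continuous in the algebra variable (so that it is normal). -/
structure NormalDualBimodule (ι : A →ₗ[ℂ] StrongDual ℂ P) (X : Type w) [NormedAddCommGroup X]
    [NormedSpace ℂ X] [CompleteSpace X] [OperatorSpace X] where
  /-- `left a x = a · x` -/
  left : A →ₗ[ℂ] StrongDual ℂ X →ₗ[ℂ] StrongDual ℂ X
  /-- `right a x = x · a` -/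
  right : A →ₗ[ℂ] StrongDual ℂ X →ₗ[ℂ] StrongDual ℂ X
  left_mul : ∀ a b x, left (a * b) x = left a (left b x)
  right_mul : ∀ a b x, right (a * b) x = right b (right a x)
  left_right : ∀ a b x, left a (right b x) = right b (left a x)
  left_cb : ∃ C : ℝ, ∀ (m n : ℕ) (a : Matrix (Fin m) (Fin m) A)
    (x : Matrix (Fin n) (Fin n) (StrongDual ℂ X)),
    dualMNorm (Matrix.of fun p q : Fin m × Fin n => left (a p.1 q.1) (x p.2 q.2)) ≤
      C * dualMNorm (a.map ι) * dualMNorm x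
  right_cb : ∃ C : ℝ, ∀ (m n : ℕ) (a : Matrix (Fin m) (Fin m) A)
    (x : Matrix (Fin n) (Fin n) (StrongDual ℂ X)),
    dualMNorm (Matrix.of fun p q : Fin m × Fin n => right (a p.1 q.1) (x p.2 q.2)) ≤
      C * dualMNorm (a.map ι) * dualMNorm x
  left_dual : ∀ a, Continuous fun x : WeakDual ℂ X =>
    StrongDual.toWeakDual (left a (WeakDual.toStrongDual x))
  right_dual : ∀ a, Continuous fun x : WeakDual ℂ X =>
    StrongDual.toWeakDual (right a (WeakDual.toStrongDual x))
  left_normal : ∀ x, Continuous[weakStar ι, inferInstance] fun a =>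
    StrongDual.toWeakDual (left a x)
  right_normal : ∀ x, Continuous[weakStar ι, inferInstance] fun a =>
    StrongDual.toWeakDual (right a x)

/-- Operator Connes-amenability of an algebra `A` that carries, through `ι`, the matrix norms and
the weak* topology of (a weak*-closed subspace of) the dual operator space of `P`: every
weak*-continuous, completely bounded derivation into a normal, dual operator bimodule is inner. -/
def OperatorConnesAmenable (ι : A →ₗ[ℂ] StrongDual ℂ P) : Prop :=
  ∀ (X : Type w) [NormedAddCommGroup X] [NormedSpace ℂ X] [CompleteSpace X] [OperatorSpace X]
    (E : NormalDualBimodule ι X) (D : A →ₗ[ℂ] StrongDual ℂ X),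
    (Continuous[weakStar ι, inferInstance] fun a => StrongDual.toWeakDual (D a)) →
    (∃ C : ℝ, ∀ (n : ℕ) (a : Matrix (Fin n) (Fin n) A),
      dualMNorm (a.map D) ≤ C * dualMNorm (a.map ι)) →
    (∀ a b, D (a * b) = E.left a (D b) + E.right b (D a)) →
    ∃ x : StrongDual ℂ X, ∀ a, D a = E.left a x - E.right a x

end ConnesAmenability

/-! ### The Fourier-Stieltjes algebra -/

section FourierStieltjes

variable (G : Type u) [Group G] [TopologicalSpace G]

open UnitaryRep

theorem directSum_coeff_bool (σ : Bool → UnitaryRep.{u, u} G) (ξ η : ∀ i, (σ i).H) :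
    ∃ x y : (directSum σ).H, (directSum σ).coeff x y =
      (σ true).coeff (ξ true) (η true) + (σ false).coeff (ξ false) (η false) := by
  refine ⟨⟨ξ, memℓp_gen (Summable.of_finite)⟩, ⟨η, memℓp_gen (Summable.of_finite)⟩, ?_⟩
  funext s
  refine (lp.inner_eq_tsum _ _).trans ?_
  rw [tsum_bool, add_comm]
  rfl

/-- The space `B(G)` of all matrix coefficients of unitary representations of `G`. -/
def FourierStieltjes : Submodule ℂ (G → ℂ) where
  carrier := {u | ∃ (π : UnitaryRep.{u, u} G) (ξ η : π.H), u = π.coeff ξ η}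
  zero_mem' := by
    refine ⟨directSum (fun i : PEmpty.{u + 1} => i.elim), 0, 0, ?_⟩
    funext s
    simp [coeff]
  add_mem' := by
    rintro _ _ ⟨π, ξ, η, rfl⟩ ⟨σ, ξ', η', rfl⟩
    obtain ⟨x, y, h⟩ := directSum_coeff_bool G (fun b => Bool.rec σ π b)
      (fun b => Bool.rec ξ' ξ b) (fun b => Bool.rec η' η b)
    exact ⟨_, x, y, h.symm⟩
  smul_mem' := by
    rintro c _ ⟨π, ξ, η, rfl⟩
    refine ⟨π, c • ξ, η, ?_⟩
    funext s
    simp [coeff]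

/-- The universal representation: the direct sum of all unitary representations of `G` (on Hilbert
spaces in the universe of `G`; up to equivalence, every cyclic one is among them). -/
noncomputable def universalRep : UnitaryRep.{u, u + 1} G :=
  directSum (fun σ : UnitaryRep.{u, u} G => σ)

variable {G} in
/-- The norm of `B(G)`. -/
noncomputable def fsNorm (u : FourierStieltjes G) : ℝ :=
  sInf {r : ℝ | ∃ (π : UnitaryRep.{u, u} G) (ξ η : π.H), (u : G → ℂ) = π.coeff ξ η ∧
    r = ‖ξ‖ * ‖η‖}

variable {G} in
/-- `A_π`: the norm-closed subspace of `B(G)` generated by the coefficients of `π`. -/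
def fourierSpace (π : UnitaryRep.{u, v} G) : Set (FourierStieltjes G) :=
  {u | ∀ ε : ℝ, 0 < ε → ∃ v : FourierStieltjes G,
    (v : G → ℂ) ∈ Submodule.span ℂ {c | ∃ ξ η, c = π.coeff ξ η} ∧ fsNorm (u - v) < ε}

variable [IsTopologicalGroup G] [LocallyCompactSpace G] [MeasurableSpace G] [BorelSpace G]

/-- The Fourier algebra `A(G) = A_λ`. -/
noncomputable def fourierAlgebra : Set (FourierStieltjes G) := fourierSpace (leftRegular G)

variable {G} in
/-- `T = π(f)`, the integrated form `∫ f(s) π(s) ds` of `π` (a weak integral, for left Haar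
measure). -/
def IsIntegratedForm (π : UnitaryRep.{u, v} G) (f : G → ℂ) (T : π.H →L[ℂ] π.H) : Prop :=
  ∀ ξ η : π.H, ⟪η, T ξ⟫_ℂ = ∫ s, f s * π.coeff ξ η s ∂Measure.haar

variable {G} in
/-- `C*_π`: the norm closure in `B(H_π)` of all `π(f)` with `f` in `L¹(G)`. -/
noncomputable def cstarOf (π : UnitaryRep.{u, v} G) : Submodule ℂ (π.H →L[ℂ] π.H) :=
  (Submodule.span ℂ {T | ∃ f : G → ℂ, Integrable f Measure.haar ∧
    IsIntegratedForm π f T}).topologicalClosure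

instance (π : UnitaryRep.{u, v} G) : CompleteSpace (cstarOf π) :=
  (Submodule.isClosed_topologicalClosure _).completeSpace_coe

/-- The full group C*-algebra `C*(G)`, an operator space as a closed subspace of `B(H)`. -/
noncomputable abbrev groupCStar : Submodule ℂ ((universalRep G).H →L[ℂ] (universalRep G).H) :=
  cstarOf (universalRep G)

variable {G} in
/-- The functional `a ↦ ⟨σ(a)ξ, η⟩` on `C*(G)`: the summand `σ` of the universal representation
contains copies of `ξ` and `η`. -/
noncomputable def vectorFunctional (σ : UnitaryRep.{u, u} G) (ξ η : σ.H) :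
    StrongDual ℂ (groupCStar G) :=
  open Classical in
  let x : (universalRep G).H := lp.single (E := fun σ : UnitaryRep.{u, u} G => σ.H) 2 σ ξ
  let y : (universalRep G).H := lp.single (E := fun σ : UnitaryRep.{u, u} G => σ.H) 2 σ η
  (innerSL ℂ y) ∘L (ContinuousLinearMap.apply ℂ (universalRep G).H x) ∘L (groupCStar G).subtypeL

variable {G}

theorem vectorFunctional_integratedForm (σ : UnitaryRep.{u, u} G) (ξ η : σ.H) (f : G → ℂ)
    (T : groupCStar G) (hT : IsIntegratedForm (universalRep G) f T) :
    vectorFunctional σ ξ η T = ∫ s, f s * σ.coeff ξ η s ∂Measure.haar := by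
  classical
  let x : (universalRep G).H := lp.single (E := fun σ : UnitaryRep.{u, u} G => σ.H) 2 σ ξ
  let y : (universalRep G).H := lp.single (E := fun σ : UnitaryRep.{u, u} G => σ.H) 2 σ η
  have h1 : vectorFunctional σ ξ η T =
      ⟪y, (T : (universalRep G).H →L[ℂ] (universalRep G).H) x⟫_ℂ := by
    simp only [vectorFunctional, x, y]
    congr!
  rw [h1, hT x y]
  congr 1
  funext s
  congr 1
  refine (lp.inner_single_left σ η _).trans ?_
  change ⟪η, σ.toHom s (lp.single (E := fun σ : UnitaryRep.{u, u} G => σ.H) 2 σ ξ σ)⟫_ℂ = _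
  rw [lp.single_apply_self]
  rfl

/-- Two functionals on `C*(G)` that agree on all `ϖ(f)` are equal. -/
theorem groupCStar_dual_ext (φ ψ : StrongDual ℂ (groupCStar G))
    (h : ∀ (f : G → ℂ) (T : groupCStar G), Integrable f Measure.haar →
      IsIntegratedForm (universalRep G) f T → φ T = ψ T) : φ = ψ := by
  let S : Submodule ℂ ((universalRep G).H →L[ℂ] (universalRep G).H) :=
    Submodule.span ℂ {T | ∃ f : G → ℂ, Integrable f Measure.haar ∧
      IsIntegratedForm (universalRep G) f T}
  have hS : ∀ T (hT : T ∈ S), φ ⟨T, S.le_topologicalClosure hT⟩ =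
      ψ ⟨T, S.le_topologicalClosure hT⟩ := by
    intro T hT
    induction hT using Submodule.span_induction with
    | mem T hT => obtain ⟨f, hf, hfT⟩ := hT; exact h f _ hf hfT
    | zero => exact (map_zero φ).trans (map_zero ψ).symm
    | add T T' hT hT' h1 h2 =>
      have := congrArg₂ (· + ·) h1 h2
      simp only [← map_add] at this
      exact this
    | smul c T hT h1 =>
      have := congrArg (c • ·) h1
      simp only [← map_smul] at this
      exact this
  ext ⟨T, hT⟩
  have hcl : IsClosed {T : groupCStar G | φ T = ψ T} := isClosed_eq φ.continuous ψ.continuous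
  have hsub : (S : Set ((universalRep G).H →L[ℂ] (universalRep G).H)) ⊆ groupCStar G :=
    fun T hT => S.le_topologicalClosure hT
  have hd : DenseRange (Set.inclusion hsub) := by
    rw [denseRange_inclusion_iff]
    exact subset_rfl
  exact hd.induction_on (p := fun T : groupCStar G => φ T = ψ T) ⟨T, hT⟩ hcl fun T => hS T.1 T.2

theorem integrable_mul_coeff (σ : UnitaryRep.{u, u} G) (ξ η : σ.H) (f : G → ℂ)
    (hf : Integrable f Measure.haar) :
    Integrable (fun s => f s * σ.coeff ξ η s) Measure.haar := by
  have hc : Continuous (σ.coeff ξ η) := by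
    unfold UnitaryRep.coeff
    exact continuous_const.inner (σ.continuous_toHom ξ)
  refine hf.mul_bdd (c := ‖η‖ * ‖ξ‖) hc.aestronglyMeasurable (Filter.Eventually.of_forall fun s => ?_)
  refine (norm_inner_le_norm _ _).trans ?_
  rw [LinearIsometryEquiv.norm_map]

variable (G)

/-- The duality of `B(G)` and `C*(G)`: `⟨a, σ_{ξ,η}⟩ = ⟨σ(a)ξ, η⟩`. -/
noncomputable def fsToDual : FourierStieltjes G →ₗ[ℂ] StrongDual ℂ (groupCStar G) where
  toFun u := vectorFunctional u.2.choose u.2.choose_spec.choose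
    u.2.choose_spec.choose_spec.choose
  map_add' u v := by
    refine groupCStar_dual_ext _ _ fun f T hf hT => ?_
    have hu := u.2.choose_spec.choose_spec.choose_spec
    have hv := v.2.choose_spec.choose_spec.choose_spec
    have huv := (u + v).2.choose_spec.choose_spec.choose_spec
    rw [add_apply, vectorFunctional_integratedForm _ _ _ f T hT,
      vectorFunctional_integratedForm _ _ _ f T hT, vectorFunctional_integratedForm _ _ _ f T hT,
      ← integral_add (integrable_mul_coeff _ _ _ f hf) (integrable_mul_coeff _ _ _ f hf),
      ← hu, ← hv, ← huv]
    simp [mul_add]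
  map_smul' c u := by
    refine groupCStar_dual_ext _ _ fun f T hf hT => ?_
    have hu := u.2.choose_spec.choose_spec.choose_spec
    have hcu := (c • u).2.choose_spec.choose_spec.choose_spec
    rw [RingHom.id_apply, smul_apply,
      vectorFunctional_integratedForm _ _ _ f T hT, vectorFunctional_integratedForm _ _ _ f T hT,
      ← hu, ← hcu, smul_eq_mul, ← integral_const_mul]
    congr 1
    funext s
    simp [mul_left_comm]

variable {G}

/-- The pairing does not depend on the way in which a function is written as a coefficient. -/
theorem fsToDual_apply (u : FourierStieltjes G) (σ : UnitaryRep.{u, u} G) (ξ η : σ.H)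
    (h : (u : G → ℂ) = σ.coeff ξ η) : fsToDual G u = vectorFunctional σ ξ η := by
  refine groupCStar_dual_ext _ _ fun f T hf hT => ?_
  have hu := u.2.choose_spec.choose_spec.choose_spec
  change vectorFunctional _ _ _ T = _
  rw [vectorFunctional_integratedForm _ _ _ f T hT, vectorFunctional_integratedForm _ _ _ f T hT,
    ← hu, ← h]

/-- `B_π`: the weak*-closed subspace of `B(G)` generated by the coefficients of `π`. -/
noncomputable def fourierStieltjesSpace (π : UnitaryRep.{u, v} G) : Set (FourierStieltjes G) :=
  @closure _ (weakStar (fsToDual G))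
    {u | (u : G → ℂ) ∈ Submodule.span ℂ {c | ∃ ξ η, c = π.coeff ξ η}}

/-- For an algebra `B` of functions inside `B(G)`, the inclusion into `B(G)` followed by the
identification of `B(G)` with the dual of `C*(G)`. -/
noncomputable def subalgebraToDual (B : Subalgebra ℂ (G → ℂ))
    (hB : ∀ u ∈ B, u ∈ FourierStieltjes G) :
    B →ₗ[ℂ] StrongDual ℂ (groupCStar G) :=
  fsToDual G ∘ₗ LinearMap.codRestrict (FourierStieltjes G) B.val.toLinearMap fun u => hB u u.2

end FourierStieltjes

/-! ### Finite-dimensional representations -/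

section FiniteDimensional

variable (G : Type u) [Group G] [TopologicalSpace G]

/-- `G` is maximally almost periodic: its finite-dimensional unitary representations separate
points. -/
def IsMaximallyAlmostPeriodic : Prop :=
  ∀ s t : G, s ≠ t → ∃ σ : UnitaryRep.{u, u} G, FiniteDimensional ℂ σ.H ∧
    σ.toHom s ≠ σ.toHom t

/-- Unitary equivalence of irreducible representations. -/
def irrepSetoid : Setoid {σ : UnitaryRep.{u, u} G // σ.IsIrreducible} where
  r σ τ := σ.1.Equivalent τ.1
  iseqv :=
    { refl := fun σ => ⟨LinearIsometryEquiv.refl ℂ σ.1.H, fun _ _ => rfl⟩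
      symm := fun {σ τ} ⟨U, hU⟩ => ⟨U.symm, fun s ξ => by
        rw [LinearIsometryEquiv.symm_apply_eq, hU, LinearIsometryEquiv.apply_symm_apply]⟩
      trans := fun {σ τ ρ} ⟨U, hU⟩ ⟨V, hV⟩ => ⟨U.trans V, fun s ξ => by
        simp [hU, hV]⟩ }

/-- The set of equivalence classes of irreducible unitary representations of `G`. -/
def UnitaryDual : Type (u + 1) := Quotient (irrepSetoid G)

variable {G} in
/-- A representative of an equivalence class. -/
noncomputable def UnitaryDual.rep (q : UnitaryDual G) : UnitaryRep.{u, u} G :=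
  (Quotient.out (s := irrepSetoid G) q).1

/-- The direct sum of the finite-dimensional irreducible representations of `G`. -/
noncomputable def finDimSum : UnitaryRep.{u, u + 1} G :=
  UnitaryRep.directSum
    (fun q : {q : UnitaryDual G // FiniteDimensional ℂ q.rep.H} => q.1.rep)

end FiniteDimensional

/-! Call a coefficient of a continuous representation by unitary matrices a trigonometric polynomial
(`IsTrig`). Complete reducibility puts these in the span of the coefficients of `finDimSum`, and
truncation of direct sums shows that they are weak*-dense in that span. So B is the double
annihilator, in the duality with C*(G), of the trigonometric polynomials
(`mem_fourierStieltjesSpace_finDimSum`). Multiplication by a fixed element of B(G) has a preadjoint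
on C*(G), because a tensor product σ ⊗ ρ is again a summand of the universal representation
(`exists_module_action`); hence B inherits its products from the trigonometric polynomials.

A(G) lies in B. As finite-dimensional representations separate points, products of normalised real
parts of characters give positive definite trigonometric polynomials φ with 0 ≤ φ ≤ 1 and φ(1) = 1
that stay away from 1 on a prescribed compact set missing the identity (`exists_peak_function`). A
high power φ^k = ⟨ρ(·)ξ, ξ⟩, normalised over a compact set, is an approximate identity there. For g,
h continuous with compact support, the coefficient of ρ at ρ(g)ξ, ρ(h)ξ, divided by the normalising
constant, is therefore close to ⟨λ(·)g, h⟩ uniformly on compact sets; the diagonal cases, read at s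
= 1, bound the norms. Bounded convergence that is uniform on compact sets implies weak* convergence
(`fsToDual_eq_zero_of_approx`), and density of such g, h in L² together with norm limits gives all
of A(G).

Amenability. Given τ : G → U(N) and trigonometric polynomials f, h on U(N), the function (s, t) ↦ ∫
f(τ(s)⁻¹xτ(t)) conj h(x) dx is a coefficient of some conj κ ⊗ κ, hence an element of B ⊗ B, and b ⊗
c ↦ b · D(c) sends it to a functional of norm at most C₁C₂‖f‖₂‖h‖₂ (`exists_tensor_of_trig`). Let f
= h be a class function of L²-norm 1 concentrated at the identity. The resulting z equals 1 on the
diagonal, and multiplying z by τ_ij(s) - τ_ij(t) makes it small, since only x and τ(s)⁻¹xτ(t) near 1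
count. So the image x of z satisfies ‖x‖ ≤ C₁C₂ and solves a·x - x·a = 1·D(a) approximately for
every entry a of τ (`exists_approx_inner`). The bound depends neither on τ nor on the error, so
weak* compactness of a ball yields one exact solution for all trigonometric polynomials
(`exists_inner_on_trig`). A correction by D(1)·1 allows for bimodules on which 1 does not act as the
identity; normality and density then extend the formula to B. -/

set_option linter.unusedSectionVars false

/-! ### Matrix coefficients of finite-dimensional unitary representations -/

section Trig

variable {Γ : Type*} [Group Γ] [TopologicalSpace Γ]

/-- The coefficient `s ↦ w* κ(s) v` of a representation by unitary matrices. -/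
noncomputable def matCoeff {ι : Type*} [Fintype ι] [DecidableEq ι]
    (κ : Γ →* Matrix.unitaryGroup ι ℂ) (v w : ι → ℂ) : Γ → ℂ :=
  fun s => ∑ i, ∑ j, star (w i) * (κ s : Matrix ι ι ℂ) i j * v j

/-- Coefficients of continuous representations by unitary matrices. -/
def IsTrig (u : Γ → ℂ) : Prop :=
  ∃ (n : ℕ) (κ : Γ →* Matrix.unitaryGroup (Fin n) ℂ) (v w : Fin n → ℂ),
    Continuous κ ∧ u = matCoeff κ v w

/-- Diagonal coefficients of continuous representations by unitary matrices. -/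
def IsPosTrig (u : Γ → ℂ) : Prop :=
  ∃ (n : ℕ) (κ : Γ →* Matrix.unitaryGroup (Fin n) ℂ) (v : Fin n → ℂ),
    Continuous κ ∧ u = matCoeff κ v v

theorem continuous_unitary_entry {ι : Type*} [Fintype ι] [DecidableEq ι]
    {κ : Γ →* Matrix.unitaryGroup ι ℂ} (hκ : Continuous κ) (i j : ι) :
    Continuous fun s => (κ s : Matrix ι ι ℂ) i j :=
  (continuous_subtype_val.comp hκ).matrix_elem i j

theorem continuous_matCoeff {ι : Type*} [Fintype ι] [DecidableEq ι]
    {κ : Γ →* Matrix.unitaryGroup ι ℂ} (hκ : Continuous κ) (v w : ι → ℂ) :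
    Continuous (matCoeff κ v w) :=
  continuous_finsetSum _ fun i _ => continuous_finsetSum _ fun j _ =>
    (continuous_const.mul (continuous_unitary_entry hκ i j)).mul continuous_const

theorem IsTrig.continuous {u : Γ → ℂ} (hu : IsTrig u) : Continuous u := by
  obtain ⟨n, κ, v, w, hκ, rfl⟩ := hu
  exact continuous_matCoeff hκ v w

theorem IsPosTrig.isTrig {u : Γ → ℂ} (hu : IsPosTrig u) : IsTrig u := by
  obtain ⟨n, κ, v, hκ, rfl⟩ := hu
  exact ⟨n, κ, v, v, hκ, rfl⟩

/-- Any finite index type may be replaced by `Fin n`. -/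
theorem exists_fin_matCoeff {ι : Type*} [Fintype ι] [DecidableEq ι] (M : Γ →* Matrix ι ι ℂ)
    (hM : ∀ s, M s ∈ Matrix.unitaryGroup ι ℂ) (hc : ∀ i j, Continuous fun s => M s i j) :
    ∃ (n : ℕ) (κ : Γ →* Matrix.unitaryGroup (Fin n) ℂ) (e : ι ≃ Fin n), Continuous κ ∧
      (∀ s i j, (κ s : Matrix (Fin n) (Fin n) ℂ) (e i) (e j) = M s i j) ∧
      ∀ v w : ι → ℂ, matCoeff κ (v ∘ e.symm) (w ∘ e.symm) =
        fun s => ∑ i, ∑ j, star (w i) * M s i j * v j := by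
  let e := Fintype.equivFin ι
  let N : Γ →* Matrix (Fin (Fintype.card ι)) (Fin (Fintype.card ι)) ℂ :=
    (Matrix.reindexAlgEquiv ℂ ℂ e).toAlgHom.toMonoidHom.comp M
  have hN : ∀ s, N s = (M s).submatrix e.symm e.symm := fun s => rfl
  have hu : ∀ s, N s ∈ Matrix.unitaryGroup (Fin (Fintype.card ι)) ℂ := by
    intro s
    rw [Matrix.mem_unitaryGroup_iff, hN, Matrix.star_eq_conjTranspose,
      Matrix.conjTranspose_submatrix, Matrix.submatrix_mul_equiv, ← Matrix.star_eq_conjTranspose,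
      Matrix.mem_unitaryGroup_iff.1 (hM s), Matrix.submatrix_one_equiv]
  refine ⟨_, N.codRestrict _ hu, e, ?_, ?_, ?_⟩
  · refine Continuous.subtype_mk (continuous_matrix fun i j => ?_) _
    exact hc (e.symm i) (e.symm j)
  · intro s i j
    change N s (e i) (e j) = _
    simp [hN]
  · intro v w
    funext s
    change ∑ i, ∑ j, star (w (e.symm i)) * N s i j * v (e.symm j) = _
    rw [← e.sum_comp]
    refine Finset.sum_congr rfl fun i _ => ?_
    rw [← e.sum_comp]
    simp [hN]

theorem IsTrig.of_matrix {ι : Type*} [Fintype ι] [DecidableEq ι] (M : Γ →* Matrix ι ι ℂ)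
    (hM : ∀ s, M s ∈ Matrix.unitaryGroup ι ℂ) (hc : ∀ i j, Continuous fun s => M s i j)
    (v w : ι → ℂ) : IsTrig fun s => ∑ i, ∑ j, star (w i) * M s i j * v j := by
  obtain ⟨n, κ, e, hκ, -, h⟩ := exists_fin_matCoeff M hM hc
  exact ⟨n, κ, _, _, hκ, (h v w).symm⟩

theorem IsPosTrig.of_matrix {ι : Type*} [Fintype ι] [DecidableEq ι] (M : Γ →* Matrix ι ι ℂ)
    (hM : ∀ s, M s ∈ Matrix.unitaryGroup ι ℂ) (hc : ∀ i j, Continuous fun s => M s i j)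
    (v : ι → ℂ) : IsPosTrig fun s => ∑ i, ∑ j, star (v i) * M s i j * v j := by
  obtain ⟨n, κ, e, hκ, -, h⟩ := exists_fin_matCoeff M hM hc
  exact ⟨n, κ, _, hκ, (h v v).symm⟩

/-! ### Direct sums, tensor products and conjugates of matrix representations. -/

section constructions

variable {ι ι' : Type*} [Fintype ι] [Fintype ι'] [DecidableEq ι'] [DecidableEq ι]

/-- The direct sum of two matrix representations. -/
def blockSum (κ : Γ →* Matrix.unitaryGroup ι ℂ) (κ' : Γ →* Matrix.unitaryGroup ι' ℂ) :
    Γ →* Matrix (ι ⊕ ι') (ι ⊕ ι') ℂ where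
  toFun s := Matrix.fromBlocks (κ s) 0 0 (κ' s)
  map_one' := by simp
  map_mul' s t := by simp [Matrix.fromBlocks_multiply]

theorem blockSum_mem (κ : Γ →* Matrix.unitaryGroup ι ℂ) (κ' : Γ →* Matrix.unitaryGroup ι' ℂ)
    (s : Γ) : blockSum κ κ' s ∈ Matrix.unitaryGroup (ι ⊕ ι') ℂ := by
  rw [Matrix.mem_unitaryGroup_iff, Matrix.star_eq_conjTranspose]
  have h : blockSum κ κ' s = Matrix.fromBlocks (κ s) 0 0 (κ' s) := rfl
  rw [h, Matrix.fromBlocks_conjTranspose, Matrix.fromBlocks_multiply, ← Matrix.star_eq_conjTranspose,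
    ← Matrix.star_eq_conjTranspose, Matrix.mem_unitaryGroup_iff.1 (κ s).2,
    Matrix.mem_unitaryGroup_iff.1 (κ' s).2]
  simp

theorem continuous_blockSum {κ : Γ →* Matrix.unitaryGroup ι ℂ} {κ' : Γ →* Matrix.unitaryGroup ι' ℂ}
    (hκ : Continuous κ) (hκ' : Continuous κ') (i j : ι ⊕ ι') :
    Continuous fun s => blockSum κ κ' s i j := by
  rcases i with i | i <;> rcases j with j | j
  · exact continuous_unitary_entry hκ i j
  · exact continuous_const
  · exact continuous_const
  · exact continuous_unitary_entry hκ' i j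

theorem blockSum_coeff (κ : Γ →* Matrix.unitaryGroup ι ℂ) (κ' : Γ →* Matrix.unitaryGroup ι' ℂ)
    (v w : ι → ℂ) (v' w' : ι' → ℂ) :
    (fun s => ∑ i, ∑ j, star (Sum.elim w w' i) * blockSum κ κ' s i j * Sum.elim v v' j) =
      matCoeff κ v w + matCoeff κ' v' w' := by
  funext s
  simp [blockSum, matCoeff]

open scoped Kronecker in
/-- The tensor product of two matrix representations. -/
def kronRep (κ : Γ →* Matrix.unitaryGroup ι ℂ) (κ' : Γ →* Matrix.unitaryGroup ι' ℂ) :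
    Γ →* Matrix (ι × ι') (ι × ι') ℂ where
  toFun s := (κ s : Matrix ι ι ℂ) ⊗ₖ (κ' s : Matrix ι' ι' ℂ)
  map_one' := by simp
  map_mul' s t := by simp [Matrix.mul_kronecker_mul]

theorem kronRep_mem (κ : Γ →* Matrix.unitaryGroup ι ℂ) (κ' : Γ →* Matrix.unitaryGroup ι' ℂ)
    (s : Γ) : kronRep κ κ' s ∈ Matrix.unitaryGroup (ι × ι') ℂ :=
  Matrix.kronecker_mem_unitary (κ s).2 (κ' s).2

theorem continuous_kronRep {κ : Γ →* Matrix.unitaryGroup ι ℂ} {κ' : Γ →* Matrix.unitaryGroup ι' ℂ}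
    (hκ : Continuous κ) (hκ' : Continuous κ') (i j : ι × ι') :
    Continuous fun s => kronRep κ κ' s i j :=
  (continuous_unitary_entry hκ i.1 j.1).mul (continuous_unitary_entry hκ' i.2 j.2)

theorem kronRep_coeff (κ : Γ →* Matrix.unitaryGroup ι ℂ) (κ' : Γ →* Matrix.unitaryGroup ι' ℂ)
    (v w : ι → ℂ) (v' w' : ι' → ℂ) :
    (fun s => ∑ i : ι × ι', ∑ j : ι × ι',
      star (w i.1 * w' i.2) * kronRep κ κ' s i j * (v j.1 * v' j.2)) =
      matCoeff κ v w * matCoeff κ' v' w' := by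
  funext s
  simp only [Pi.mul_apply, matCoeff, Finset.sum_mul_sum, Fintype.sum_prod_type]
  refine Finset.sum_congr rfl fun i _ => Finset.sum_congr rfl fun i' _ => ?_
  refine Finset.sum_congr rfl fun j _ => Finset.sum_congr rfl fun j' _ => ?_
  simp only [kronRep, MonoidHom.coe_mk, OneHom.coe_mk, Matrix.kroneckerMap_apply, star_mul']
  ring

/-- The conjugate of a matrix representation. -/
def conjRep (κ : Γ →* Matrix.unitaryGroup ι ℂ) : Γ →* Matrix ι ι ℂ where
  toFun s := (κ s : Matrix ι ι ℂ).map (starRingEnd ℂ)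
  map_one' := by simp
  map_mul' s t := by simp [Matrix.map_mul]

theorem conjRep_mem (κ : Γ →* Matrix.unitaryGroup ι ℂ) (s : Γ) :
    conjRep κ s ∈ Matrix.unitaryGroup ι ℂ := by
  rw [Matrix.mem_unitaryGroup_iff]
  have h := congrArg (fun A : Matrix ι ι ℂ => A.map (starRingEnd ℂ))
    (Matrix.mem_unitaryGroup_iff.1 (κ s).2)
  simp only [Matrix.map_one _ (map_zero (starRingEnd ℂ)) (map_one (starRingEnd ℂ))] at h
  rw [← h, Matrix.map_mul]
  rfl

theorem continuous_conjRep {κ : Γ →* Matrix.unitaryGroup ι ℂ} (hκ : Continuous κ) (i j : ι) :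
    Continuous fun s => conjRep κ s i j :=
  Complex.continuous_conj.comp (continuous_unitary_entry hκ i j)

theorem conjRep_coeff (κ : Γ →* Matrix.unitaryGroup ι ℂ) (v w : ι → ℂ) :
    (fun s => ∑ i, ∑ j, star (star (w i)) * conjRep κ s i j * star (v j)) =
      star (matCoeff κ v w) := by
  funext s
  simp [matCoeff, conjRep]

end constructions

theorem IsTrig.add {f g : Γ → ℂ} (hf : IsTrig f) (hg : IsTrig g) : IsTrig (f + g) := by
  obtain ⟨n, κ, v, w, hκ, rfl⟩ := hf
  obtain ⟨n', κ', v', w', hκ', rfl⟩ := hg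
  rw [← blockSum_coeff]
  exact IsTrig.of_matrix _ (blockSum_mem κ κ') (continuous_blockSum hκ hκ') _ _

theorem IsPosTrig.add {f g : Γ → ℂ} (hf : IsPosTrig f) (hg : IsPosTrig g) :
    IsPosTrig (f + g) := by
  obtain ⟨n, κ, v, hκ, rfl⟩ := hf
  obtain ⟨n', κ', v', hκ', rfl⟩ := hg
  rw [← blockSum_coeff]
  exact IsPosTrig.of_matrix _ (blockSum_mem κ κ') (continuous_blockSum hκ hκ') _

theorem IsTrig.mul {f g : Γ → ℂ} (hf : IsTrig f) (hg : IsTrig g) : IsTrig (f * g) := by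
  obtain ⟨n, κ, v, w, hκ, rfl⟩ := hf
  obtain ⟨n', κ', v', w', hκ', rfl⟩ := hg
  rw [← kronRep_coeff]
  exact IsTrig.of_matrix _ (kronRep_mem κ κ') (continuous_kronRep hκ hκ')
    (fun j => v j.1 * v' j.2) (fun j => w j.1 * w' j.2)

theorem IsPosTrig.mul {f g : Γ → ℂ} (hf : IsPosTrig f) (hg : IsPosTrig g) :
    IsPosTrig (f * g) := by
  obtain ⟨n, κ, v, hκ, rfl⟩ := hf
  obtain ⟨n', κ', v', hκ', rfl⟩ := hg
  rw [← kronRep_coeff]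
  exact IsPosTrig.of_matrix _ (kronRep_mem κ κ') (continuous_kronRep hκ hκ')
    (fun j => v j.1 * v' j.2)

theorem IsTrig.star {f : Γ → ℂ} (hf : IsTrig f) : IsTrig (star f) := by
  obtain ⟨n, κ, v, w, hκ, rfl⟩ := hf
  rw [← conjRep_coeff]
  exact IsTrig.of_matrix _ (conjRep_mem κ) (continuous_conjRep hκ) (fun j => Star.star (v j))
    (fun j => Star.star (w j))

theorem IsPosTrig.star {f : Γ → ℂ} (hf : IsPosTrig f) : IsPosTrig (star f) := by
  obtain ⟨n, κ, v, hκ, rfl⟩ := hf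
  rw [← conjRep_coeff]
  exact IsPosTrig.of_matrix _ (conjRep_mem κ) (continuous_conjRep hκ) (fun j => Star.star (v j))

theorem isPosTrig_const {r : ℝ} (hr : 0 ≤ r) : IsPosTrig fun _ : Γ => (r : ℂ) := by
  refine ⟨1, 1, fun _ => (√r : ℂ), continuous_const, ?_⟩
  funext s
  simp only [matCoeff, MonoidHom.one_apply, Finset.univ_unique, Finset.sum_singleton]
  simp only [OneMemClass.coe_one, Matrix.one_apply_eq, mul_one, RCLike.star_def,
    Complex.conj_ofReal]
  rw [← Complex.ofReal_mul, Real.mul_self_sqrt hr]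

theorem isPosTrig_one : IsPosTrig (1 : Γ → ℂ) := by
  have h := isPosTrig_const (Γ := Γ) zero_le_one
  rwa [Complex.ofReal_one] at h

theorem IsTrig.smul (c : ℂ) {f : Γ → ℂ} (hf : IsTrig f) : IsTrig (c • f) := by
  obtain ⟨n, κ, v, w, hκ, rfl⟩ := hf
  refine ⟨n, κ, c • v, w, hκ, ?_⟩
  funext s
  simp only [matCoeff, Pi.smul_apply, smul_eq_mul, Finset.mul_sum]
  exact Finset.sum_congr rfl fun i _ => Finset.sum_congr rfl fun j _ => by ring

theorem matCoeff_single {ι : Type*} [Fintype ι] [DecidableEq ι] (κ : Γ →* Matrix.unitaryGroup ι ℂ)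
    (i j : ι) :
    matCoeff κ (Pi.single j 1) (Pi.single i 1) = fun s => (κ s : Matrix ι ι ℂ) i j := by
  funext s
  simp [matCoeff, Pi.single_apply]

variable (Γ) in
/-- The algebra of all coefficients of continuous representations by unitary matrices. -/
def trigAlgebra : Subalgebra ℂ (Γ → ℂ) where
  carrier := {f | IsTrig f}
  add_mem' := IsTrig.add
  mul_mem' := IsTrig.mul
  algebraMap_mem' c := by
    have h := isPosTrig_one.isTrig.smul (Γ := Γ) c
    rwa [← Algebra.algebraMap_eq_smul_one] at h

theorem mem_trigAlgebra {f : Γ → ℂ} : f ∈ trigAlgebra Γ ↔ IsTrig f := Iff.rfl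

theorem IsPosTrig.finsetSum {α : Type*} (s : Finset α) {f : α → Γ → ℂ}
    (hf : ∀ i ∈ s, IsPosTrig (f i)) : IsPosTrig (∑ i ∈ s, f i) :=
  Finset.sum_induction _ _ (fun _ _ => IsPosTrig.add)
    (by simpa [Pi.zero_def] using isPosTrig_const (Γ := Γ) le_rfl) hf

theorem IsPosTrig.finsetProd {α : Type*} (s : Finset α) {f : α → Γ → ℂ}
    (hf : ∀ i ∈ s, IsPosTrig (f i)) : IsPosTrig (∏ i ∈ s, f i) :=
  Finset.prod_induction _ _ (fun _ _ => IsPosTrig.mul) isPosTrig_one hf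

theorem IsPosTrig.pow {f : Γ → ℂ} (hf : IsPosTrig f) (n : ℕ) : IsPosTrig (f ^ n) := by
  have := IsPosTrig.finsetProd (Finset.range n) (f := fun _ => f) fun _ _ => hf
  simpa using this

theorem isPosTrig_entry {n : ℕ} {κ : Γ →* Matrix.unitaryGroup (Fin n) ℂ} (hκ : Continuous κ)
    (i : Fin n) : IsPosTrig fun s => (κ s : Matrix (Fin n) (Fin n) ℂ) i i :=
  ⟨n, κ, _, hκ, (matCoeff_single κ i i).symm⟩

theorem isTrig_entry {n : ℕ} {κ : Γ →* Matrix.unitaryGroup (Fin n) ℂ} (hκ : Continuous κ)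
    (i j : Fin n) : IsTrig fun s => (κ s : Matrix (Fin n) (Fin n) ℂ) i j :=
  ⟨n, κ, _, _, hκ, (matCoeff_single κ i j).symm⟩

/-- Finitely many coefficients lie in the span of the entries of one representation. -/
theorem exists_rep_span (F : Finset (Γ → ℂ)) (hF : ∀ f ∈ F, IsTrig f) :
    ∃ (n : ℕ) (κ : Γ →* Matrix.unitaryGroup (Fin n) ℂ), Continuous κ ∧
      ∀ f ∈ F, ∃ v w, f = matCoeff κ v w := by
  classical
  induction F using Finset.induction_on with
  | empty => exact ⟨0, 1, continuous_const, by simp⟩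
  | insert f F hfF ih =>
    obtain ⟨n, κ, hκ, h⟩ := ih fun g hg => hF g (Finset.mem_insert_of_mem hg)
    obtain ⟨n', κ', v', w', hκ', rfl⟩ := hF f (Finset.mem_insert_self _ _)
    obtain ⟨m, ρ, e, hρ, -, hm⟩ := exists_fin_matCoeff (blockSum κ κ') (blockSum_mem κ κ')
      (continuous_blockSum hκ hκ')
    refine ⟨m, ρ, hρ, fun g hg => ?_⟩
    rcases Finset.mem_insert.1 hg with rfl | hg
    -- Vectors padded by zeros see only one block of the direct sum.
    · refine ⟨_, _, Eq.trans ?_ (hm (Sum.elim 0 v') (Sum.elim 0 w')).symm⟩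
      rw [blockSum_coeff]
      funext s
      simp [matCoeff]
    · obtain ⟨v, w, rfl⟩ := h g hg
      refine ⟨_, _, Eq.trans ?_ (hm (Sum.elim v 0) (Sum.elim w 0)).symm⟩
      rw [blockSum_coeff]
      funext s
      simp [matCoeff]

/-- Two coefficients are coefficients of one and the same representation. -/
theorem IsTrig.exists_common {f g : Γ → ℂ} (hf : IsTrig f) (hg : IsTrig g) :
    ∃ (n : ℕ) (κ : Γ →* Matrix.unitaryGroup (Fin n) ℂ) (v w v' w' : Fin n → ℂ), Continuous κ ∧
      f = matCoeff κ v w ∧ g = matCoeff κ v' w' := by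
  classical
  obtain ⟨n, κ, hκ, h⟩ := exists_rep_span {f, g} (by simp [hf, hg])
  obtain ⟨v, w, hv⟩ := h f (by simp)
  obtain ⟨v', w', hvw⟩ := h g (by simp)
  exact ⟨n, κ, v, w, v', w', hκ, hv, hvw⟩

/-! ### A coefficient that peaks at the identity -/

section peak

variable {n : ℕ}

/-- An affine function of the real part of the trace, normalised to be `1` at the identity. -/
noncomputable def peak (U : Matrix.unitaryGroup (Fin n) ℂ) : ℝ :=
  (4 + ∑ i, (2 + 2 * ((U : Matrix (Fin n) (Fin n) ℂ) i i).re)) / (4 + 4 * n)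

theorem unitary_entry_re_le (U : Matrix.unitaryGroup (Fin n) ℂ) (i : Fin n) :
    |((U : Matrix (Fin n) (Fin n) ℂ) i i).re| ≤ 1 :=
  (Complex.abs_re_le_norm _).trans (entry_norm_bound_of_unitary U.2 i i)

theorem peak_nonneg (U : Matrix.unitaryGroup (Fin n) ℂ) : 0 ≤ peak U := by
  refine div_nonneg (add_nonneg (by norm_num) (Finset.sum_nonneg fun i _ => ?_)) (by positivity)
  linarith [(abs_le.1 (unitary_entry_re_le U i)).1]

/-- The rows of U are unit vectors, so the squared Hilbert-Schmidt distance from U to 1 is 2n - 2 Re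
tr U, an affine function of the trace. Thus `peak` is close to 1 exactly when U is close to the
identity. The summand 4 keeps the denominator positive for n = 0. -/
theorem sum_sq_norm_sub_one (U : Matrix.unitaryGroup (Fin n) ℂ) :
    ∑ i, ∑ j, ‖(U : Matrix (Fin n) (Fin n) ℂ) i j - (1 : Matrix (Fin n) (Fin n) ℂ) i j‖ ^ 2 =
      (4 + 4 * n) * (1 - peak U) := by
  have h1 : ∀ i, ∑ j, ‖(U : Matrix (Fin n) (Fin n) ℂ) i j‖ ^ 2 = 1 := by
    intro i
    have h := congrFun (congrFun (Matrix.mem_unitaryGroup_iff.1 U.2) i) i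
    rw [Matrix.mul_apply, Matrix.one_apply_eq] at h
    have h' := congrArg Complex.re h
    rw [Complex.re_sum] at h'
    simp only [Matrix.star_apply, RCLike.star_def, Complex.mul_conj, Complex.one_re,
      Complex.ofReal_re] at h'
    simpa only [Complex.normSq_eq_norm_sq] using h'
  have h2 : ∀ i j, ‖(U : Matrix (Fin n) (Fin n) ℂ) i j - (1 : Matrix (Fin n) (Fin n) ℂ) i j‖ ^ 2 =
      ‖(U : Matrix (Fin n) (Fin n) ℂ) i j‖ ^ 2 +
        if i = j then 1 - 2 * ((U : Matrix (Fin n) (Fin n) ℂ) i i).re else 0 := by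
    intro i j
    split_ifs with h
    · subst h
      rw [Matrix.one_apply_eq, ← Complex.normSq_eq_norm_sq, ← Complex.normSq_eq_norm_sq,
        Complex.normSq_apply, Complex.normSq_apply]
      simp
      ring
    · simp [Matrix.one_apply_ne h]
  have hn : (4 + 4 * (n : ℝ)) ≠ 0 := by positivity
  simp only [h2, Finset.sum_add_distrib, h1]
  rw [peak, mul_sub, mul_div_cancel₀ _ hn]
  simp [Finset.sum_add_distrib, Finset.sum_sub_distrib]
  ring

theorem peak_le_one (U : Matrix.unitaryGroup (Fin n) ℂ) : peak U ≤ 1 := by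
  have h := sum_sq_norm_sub_one U
  have h0 : 0 ≤ (4 + 4 * (n : ℝ)) * (1 - peak U) := by rw [← h]; positivity
  have hn : (0 : ℝ) < 4 + 4 * n := by positivity
  linarith [(mul_nonneg_iff_of_pos_left hn).1 h0]

theorem peak_one : peak (1 : Matrix.unitaryGroup (Fin n) ℂ) = 1 := by
  have h := sum_sq_norm_sub_one (1 : Matrix.unitaryGroup (Fin n) ℂ)
  have hn : (4 + 4 * (n : ℝ)) ≠ 0 := by positivity
  simp only [OneMemClass.coe_one, sub_self, norm_zero, ne_eq, OfNat.ofNat_ne_zero,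
    not_false_eq_true, zero_pow, Finset.sum_const_zero] at h
  linarith [(mul_eq_zero.1 h.symm).resolve_left hn]

theorem peak_lt_one {U : Matrix.unitaryGroup (Fin n) ℂ} (hU : U ≠ 1) : peak U < 1 := by
  refine lt_of_le_of_ne (peak_le_one U) fun h => hU ?_
  have h' := sum_sq_norm_sub_one U
  rw [h, sub_self, mul_zero, Finset.sum_eq_zero_iff_of_nonneg fun i _ => by positivity] at h'
  ext i j
  have h2 := h' i (Finset.mem_univ _)
  rw [Finset.sum_eq_zero_iff_of_nonneg fun j _ => by positivity] at h2
  have h3 := h2 j (Finset.mem_univ _)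
  rw [sq_eq_zero_iff, norm_eq_zero, sub_eq_zero] at h3
  exact h3

theorem continuous_peak : Continuous (peak (n := n)) := by
  unfold peak
  refine (continuous_const.add (continuous_finsetSum _ fun i _ => ?_)).div_const _
  exact continuous_const.add (continuous_const.mul
    (Complex.continuous_re.comp (continuous_subtype_val.matrix_elem i i)))

/-- Only the trace enters. This invariance is what later makes the approximate diagonal equal to 1
on the diagonal. -/
theorem peak_conj (U V : Matrix.unitaryGroup (Fin n) ℂ) : peak (V⁻¹ * U * V) = peak U := by
  have h : ∀ W : Matrix.unitaryGroup (Fin n) ℂ,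
      peak W = (4 + (2 * n + 2 * (Matrix.trace (W : Matrix (Fin n) (Fin n) ℂ)).re)) /
        (4 + 4 * n) := by
    intro W
    simp [peak, Matrix.trace, Finset.sum_add_distrib, Finset.mul_sum, mul_comm]
  rw [h, h]
  congr 5
  have : ((V⁻¹ * U * V : Matrix.unitaryGroup (Fin n) ℂ) : Matrix (Fin n) (Fin n) ℂ) =
      ((V⁻¹ : Matrix.unitaryGroup (Fin n) ℂ) : Matrix (Fin n) (Fin n) ℂ) * U * V := rfl
  rw [this, Matrix.trace_mul_comm, ← mul_assoc]
  have h2 : (V : Matrix (Fin n) (Fin n) ℂ) *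
      ((V⁻¹ : Matrix.unitaryGroup (Fin n) ℂ) : Matrix (Fin n) (Fin n) ℂ) = 1 :=
    congrArg Subtype.val (mul_inv_cancel V)
  rw [h2, one_mul]

/-- Twice the real part of a diagonal entry is the entry plus its conjugate, and all remaining
constants are nonnegative; positive definiteness survives these operations. -/
theorem isPosTrig_peak {κ : Γ →* Matrix.unitaryGroup (Fin n) ℂ} (hκ : Continuous κ) :
    IsPosTrig fun s => (peak (κ s) : ℂ) := by
  have hc : ∀ r : ℝ, 0 ≤ r → IsPosTrig fun _ : Γ => (r : ℂ) := fun r => isPosTrig_const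
  have h : (fun s => (peak (κ s) : ℂ)) =
      (fun _ : Γ => (((4 + 4 * n : ℝ)⁻¹ : ℝ) : ℂ)) * ((fun _ : Γ => ((4 : ℝ) : ℂ)) +
        ∑ i, ((fun _ : Γ => ((2 : ℝ) : ℂ)) + ((fun s => (κ s : Matrix (Fin n) (Fin n) ℂ) i i) +
          star fun s => (κ s : Matrix (Fin n) (Fin n) ℂ) i i))) := by
    funext s
    simp only [peak, Pi.mul_apply, Pi.add_apply, Finset.sum_apply, Pi.star_apply, RCLike.star_def,
      Complex.add_conj]
    push_cast
    rw [div_eq_inv_mul]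
  rw [h]
  refine (hc _ (by positivity)).mul ((hc _ (by norm_num)).add (IsPosTrig.finsetSum _ fun i _ => ?_))
  exact (hc _ (by norm_num)).add ((isPosTrig_entry hκ i).add (isPosTrig_entry hκ i).star)

end peak

end Trig

/-! ### Weak* closures of subspaces -/

section weakStarClosure

variable {A : Type u} [AddCommGroup A] [Module ℂ A] {P : Type v} [NormedAddCommGroup P]
  [NormedSpace ℂ P]

theorem continuous_weakStar_eval (ι : A →ₗ[ℂ] StrongDual ℂ P) (p : P) :
    Continuous[weakStar ι, inferInstance] fun a => ι a p := by
  let _ := weakStar ι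
  exact (WeakDual.eval_continuous p).comp continuous_induced_dom

/-- The weak*-closure of a subspace is its double annihilator. -/
theorem mem_closure_weakStar_iff (ι : A →ₗ[ℂ] StrongDual ℂ P) (T : Submodule ℂ A) (u : A) :
    u ∈ @closure A (weakStar ι) T ↔ ∀ p : P, (∀ t ∈ T, ι t p = 0) → ι u p = 0 := by
  let _ := weakStar ι
  constructor
  · intro hu p hp
    have hcl : IsClosed {a : A | ι a p = 0} :=
      isClosed_eq (continuous_weakStar_eval ι p) continuous_const
    exact closure_minimal (fun t ht => hp t ht) hcl hu
  · intro h
    by_contra hu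
    let f : A →ₗ[ℂ] WeakBilin (topDualPairing ℂ P) := ι
    have hf : IsInducing f := ⟨rfl⟩
    rw [hf.closure_eq_preimage_closure_image, Set.mem_preimage] at hu
    let S : Submodule ℂ (WeakBilin (topDualPairing ℂ P)) := T.map f
    have hS : f u ∉ (S.topologicalClosure : Set (WeakBilin (topDualPairing ℂ P))) := by
      rw [Submodule.topologicalClosure_coe]
      exact hu
    have hconv : Convex ℝ (S.topologicalClosure : Set (WeakBilin (topDualPairing ℂ P))) :=
      fun x hx y hy a b _ _ _ => add_mem (S.topologicalClosure.smul_mem (a : ℂ) hx)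
        (S.topologicalClosure.smul_mem (b : ℂ) hy)
    obtain ⟨φ, r, h1, h2⟩ := RCLike.geometric_hahn_banach_closed_point (𝕜 := ℂ)
      hconv S.isClosed_topologicalClosure hS
    -- A weak*-continuous functional is evaluation at a point of the predual.
    obtain ⟨p, hp⟩ := LinearMap.dualEmbedding_surjective (topDualPairing ℂ P) φ
    have hp' : ∀ a, φ (f a) = ι a p := fun a => by rw [← hp]; rfl
    have hr : 0 < r := by
      have := h1 0 (zero_mem S.topologicalClosure)
      simpa using this
    have h0 : ∀ t ∈ T, ι t p = 0 := by
      intro t ht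
      by_contra hne
      have hm : ∀ c : ℂ, (c * ι t p).re < r := by
        intro c
        have := h1 (f (c • t)) (S.le_topologicalClosure
          (Submodule.mem_map_of_mem (T.smul_mem c ht)))
        rw [hp', map_smul] at this
        exact this
      -- On a subspace the functional is either zero or of unbounded real part; this multiple of t
      -- attains the forbidden value r.
      have := hm (r / ι t p)
      rw [div_mul_cancel₀ _ hne, Complex.ofReal_re] at this
      exact lt_irrefl _ this
    have := h p h0
    rw [hp', this] at h2
    simp at h2
    linarith

end weakStarClosure

/-! ### Matrix norms -/

section matrixNorms

open scoped Matrix.Norms.L2Operator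

/-- Test the form at w = Av and cancel one factor ‖w‖. -/
theorem matrix_norm_le_of_form {ι κ : Type*} [Fintype ι] [Fintype κ] [DecidableEq κ]
    (A : Matrix ι κ ℂ) {C : ℝ} (hC : 0 ≤ C)
    (h : ∀ (w : EuclideanSpace ℂ ι) (v : EuclideanSpace ℂ κ),
      ‖∑ p, ∑ q, star (w p) * A p q * v q‖ ≤ C * ‖w‖ * ‖v‖) : ‖A‖ ≤ C := by
  rw [Matrix.l2_opNorm_def]
  refine ContinuousLinearMap.opNorm_le_bound _ hC fun v => ?_
  set w : EuclideanSpace ℂ ι := WithLp.toLp 2 (A.mulVec v) with hw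
  change ‖w‖ ≤ _
  have h1 := h w v
  have h2 : ∑ p, ∑ q, star (w p) * A p q * v q = ⟪w, w⟫_ℂ := by
    rw [PiLp.inner_apply]
    refine Finset.sum_congr rfl fun p _ => ?_
    simp only [mul_assoc, ← Finset.mul_sum]
    rw [RCLike.inner_apply, mul_comm]
    rfl
  rw [h2, inner_self_eq_norm_sq_to_K] at h1
  simp only [norm_pow, RCLike.norm_ofReal, abs_norm] at h1
  rcases (norm_nonneg w).eq_or_lt with h0 | h0
  · rw [← h0]; positivity
  · nlinarith

theorem norm_form_le {ι κ : Type*} [Fintype ι] [Fintype κ] [DecidableEq κ]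
    (A : Matrix ι κ ℂ) (w : EuclideanSpace ℂ ι) (v : EuclideanSpace ℂ κ) :
    ‖∑ p, ∑ q, star (w p) * A p q * v q‖ ≤ ‖A‖ * ‖w‖ * ‖v‖ := by
  have h2 : ∑ p, ∑ q, star (w p) * A p q * v q =
      ⟪w, (WithLp.toLp 2 (A.mulVec v) : EuclideanSpace ℂ ι)⟫_ℂ := by
    rw [PiLp.inner_apply]
    refine Finset.sum_congr rfl fun p _ => ?_
    simp only [mul_assoc, ← Finset.mul_sum]
    rw [RCLike.inner_apply, mul_comm]
    rfl
  rw [h2]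
  refine (norm_inner_le_norm _ _).trans ?_
  have := Matrix.l2_opNorm_mulVec A v
  calc _ ≤ ‖w‖ * (‖A‖ * ‖v‖) := by gcongr; exact this
    _ = _ := by ring

theorem norm_row_le {n : ℕ} (w : EuclideanSpace ℂ (Fin n)) :
    ‖(Matrix.of fun (_ : Fin 1) k => star (w k))‖ ≤ ‖w‖ := by
  refine matrix_norm_le_of_form _ (norm_nonneg _) fun c v => ?_
  have h : ∑ p, ∑ q, star (c p) * (Matrix.of fun (_ : Fin 1) k => star (w k)) p q * v q =
      star (c 0) * ⟪w, v⟫_ℂ := by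
    simp only [Finset.univ_unique, Finset.sum_singleton, PiLp.inner_apply, Finset.mul_sum,
      Matrix.of_apply, RCLike.inner_apply, Fin.default_eq_zero, RCLike.star_def]
    exact Finset.sum_congr rfl fun k _ => by ring
  rw [h, norm_mul, norm_star]
  have hc : ‖c 0‖ ≤ ‖c‖ := PiLp.norm_apply_le c 0
  calc _ ≤ ‖c‖ * (‖w‖ * ‖v‖) := by gcongr; exact norm_inner_le_norm _ _
    _ = _ := by ring

theorem norm_col_le {n : ℕ} (v : EuclideanSpace ℂ (Fin n)) :
    ‖(Matrix.of fun l (_ : Fin 1) => v l)‖ ≤ ‖v‖ := by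
  refine matrix_norm_le_of_form _ (norm_nonneg _) fun w c => ?_
  have h : ∑ p, ∑ q, star (w p) * (Matrix.of fun l (_ : Fin 1) => v l) p q * c q =
      ⟪w, v⟫_ℂ * c 0 := by
    simp only [Finset.univ_unique, Finset.sum_singleton, PiLp.inner_apply, Finset.sum_mul,
      Matrix.of_apply, RCLike.inner_apply, Fin.default_eq_zero, RCLike.star_def]
    exact Finset.sum_congr rfl fun k _ => by ring
  rw [h, norm_mul]
  have hc : ‖c 0‖ ≤ ‖c‖ := PiLp.norm_apply_le c 0
  calc _ ≤ (‖w‖ * ‖v‖) * ‖c‖ := by gcongr; exact norm_inner_le_norm _ _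
    _ = _ := by ring

/-! ### Abstract operator spaces and the matrix norms of their duals. -/

section operatorSpace

variable {V : Type w} [NormedAddCommGroup V] [NormedSpace ℂ V] [CompleteSpace V] [OperatorSpace V]

/-- Not an axiom: subadditivity applied to x + (-1)x = 0, with homogeneity, gives 0 ≤ 2‖x‖. -/
theorem OperatorSpace.mnorm_nonneg {n : ℕ} (x : Matrix (Fin n) (Fin n) V) :
    0 ≤ OperatorSpace.mnorm x := by
  have h0 : OperatorSpace.mnorm (0 : Matrix (Fin n) (Fin n) V) = 0 := by
    have := OperatorSpace.mnorm_smul (0 : ℂ) (0 : Matrix (Fin n) (Fin n) V)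
    simpa using this
  have h1 := OperatorSpace.mnorm_smul (-1 : ℂ) x
  have h2 := OperatorSpace.mnorm_add x ((-1 : ℂ) • x)
  have h3 : x + (-1 : ℂ) • x = 0 := by simp
  rw [h3, h0, h1] at h2
  simp at h2
  linarith

/-- Compression by a row and a column is an instance of `mnorm_mul` whose result is a 1 × 1 matrix,
and there the matrix norm is the norm of V. -/
theorem norm_sum_smul_le_mnorm {n : ℕ} (x : Matrix (Fin n) (Fin n) V)
    (w v : EuclideanSpace ℂ (Fin n)) :
    ‖∑ k, ∑ l, (star (w k) * v l) • x k l‖ ≤ OperatorSpace.mnorm x * ‖w‖ * ‖v‖ := by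
  have h := OperatorSpace.mnorm_mul (Matrix.of fun (_ : Fin 1) k => star (w k)) x
    (Matrix.of fun l (_ : Fin 1) => v l)
  rw [OperatorSpace.mnorm_one] at h
  refine h.trans ?_
  have := OperatorSpace.mnorm_nonneg x
  calc _ ≤ ‖w‖ * OperatorSpace.mnorm x * ‖v‖ := by
        gcongr
        · exact norm_row_le w
        · exact norm_col_le v
    _ = _ := by ring

variable {ι : Type} [Fintype ι] [DecidableEq ι]

/-- Bounded functionals are completely bounded, so the sum of the norms of the entries is an
admissible constant. Without this the infimum defining `dualMNorm` could be the junk value of the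
empty set. -/
theorem exists_dualMNorm_bound (φ : Matrix ι ι (StrongDual ℂ V)) :
    {C : ℝ | 0 ≤ C ∧ ∀ (m : ℕ) (x : Matrix (Fin m) (Fin m) V),
      ‖(Matrix.of fun p q : ι × Fin m => φ p.1 q.1 (x p.2 q.2))‖ ≤
        C * OperatorSpace.mnorm x}.Nonempty := by
  refine ⟨∑ i, ∑ j, ‖φ i j‖, by positivity, fun m x => ?_⟩
  have hx := OperatorSpace.mnorm_nonneg x
  refine matrix_norm_le_of_form _ (by positivity) fun w v => ?_
  let w' : ι → EuclideanSpace ℂ (Fin m) := fun i => WithLp.toLp 2 fun k => w (i, k)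
  let v' : ι → EuclideanSpace ℂ (Fin m) := fun i => WithLp.toLp 2 fun k => v (i, k)
  have hle : ∀ (a : EuclideanSpace ℂ (ι × Fin m)) (i : ι),
      ‖(WithLp.toLp 2 fun k => a (i, k) : EuclideanSpace ℂ (Fin m))‖ ≤ ‖a‖ := by
    intro a i
    refine (sq_le_sq₀ (norm_nonneg _) (norm_nonneg _)).1 ?_
    rw [EuclideanSpace.norm_sq_eq, EuclideanSpace.norm_sq_eq, Fintype.sum_prod_type]
    exact Finset.single_le_sum (f := fun i => ∑ k, ‖a (i, k)‖ ^ 2)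
      (fun _ _ => by positivity) (Finset.mem_univ i)
  have hs : ∑ p, ∑ q, star (w p) * (Matrix.of fun p q : ι × Fin m => φ p.1 q.1 (x p.2 q.2)) p q *
      v q = ∑ i, ∑ j, φ i j (∑ k, ∑ l, (star (w' i k) * v' j l) • x k l) := by
    simp only [Fintype.sum_prod_type, map_sum, map_smul, smul_eq_mul, Matrix.of_apply]
    refine Finset.sum_congr rfl fun i _ => ?_
    rw [Finset.sum_comm]
    refine Finset.sum_congr rfl fun j _ => Finset.sum_congr rfl fun k _ =>
      Finset.sum_congr rfl fun l _ => ?_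
    simp only [w', v']
    ring
  rw [hs, Finset.sum_mul, Finset.sum_mul, Finset.sum_mul]
  refine (norm_sum_le _ _).trans (Finset.sum_le_sum fun i _ => ?_)
  rw [Finset.sum_mul, Finset.sum_mul, Finset.sum_mul]
  refine (norm_sum_le _ _).trans (Finset.sum_le_sum fun j _ => ?_)
  refine ((φ i j).le_opNorm _).trans ?_
  have h1 := norm_sum_smul_le_mnorm x (w' i) (v' j)
  calc _ ≤ ‖φ i j‖ * (OperatorSpace.mnorm x * ‖w‖ * ‖v‖) := by
        gcongr
        refine h1.trans ?_
        gcongr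
        · exact hle w i
        · exact hle v j
    _ = _ := by ring

theorem dualMNorm_nonneg (φ : Matrix ι ι (StrongDual ℂ V)) : 0 ≤ dualMNorm φ :=
  Real.sInf_nonneg fun _ h => h.1

theorem dualMNorm_le (φ : Matrix ι ι (StrongDual ℂ V)) {C : ℝ} (hC : 0 ≤ C)
    (h : ∀ (m : ℕ) (x : Matrix (Fin m) (Fin m) V),
      ‖(Matrix.of fun p q : ι × Fin m => φ p.1 q.1 (x p.2 q.2))‖ ≤ C * OperatorSpace.mnorm x) :
    dualMNorm φ ≤ C :=
  csInf_le ⟨0, fun _ h => h.1⟩ ⟨hC, h⟩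

theorem dualMNorm_bound (φ : Matrix ι ι (StrongDual ℂ V)) {m : ℕ} (x : Matrix (Fin m) (Fin m) V) :
    ‖(Matrix.of fun p q : ι × Fin m => φ p.1 q.1 (x p.2 q.2))‖ ≤
      dualMNorm φ * OperatorSpace.mnorm x := by
  rcases (OperatorSpace.mnorm_nonneg x).eq_or_lt with h0 | h0
  · obtain ⟨C, hC⟩ := exists_dualMNorm_bound φ
    have := hC.2 m x
    rw [← h0, mul_zero] at this ⊢
    exact this
  · rw [← div_le_iff₀ h0]
    refine le_csInf (exists_dualMNorm_bound φ) fun C hC => ?_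
    rw [div_le_iff₀ h0]
    exact hC.2 m x

/-- Compressing a matrix of functionals by two vectors. -/
theorem norm_sum_smul_le_dualMNorm (φ : Matrix ι ι (StrongDual ℂ V)) (w v : EuclideanSpace ℂ ι) :
    ‖∑ p, ∑ q, (star (w p) * v q) • φ p q‖ ≤ dualMNorm φ * ‖w‖ * ‖v‖ := by
  refine ContinuousLinearMap.opNorm_le_bound _ (mul_nonneg (mul_nonneg (dualMNorm_nonneg φ)
    (norm_nonneg _)) (norm_nonneg _)) fun x => ?_
  -- The defining inequality is needed only for 1 × 1 matrices over V.
  let X : Matrix (Fin 1) (Fin 1) V := fun _ _ => x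
  let w' : EuclideanSpace ℂ (ι × Fin 1) := WithLp.toLp 2 fun p => w p.1
  let v' : EuclideanSpace ℂ (ι × Fin 1) := WithLp.toLp 2 fun p => v p.1
  have hn : ∀ a : EuclideanSpace ℂ ι,
      ‖(WithLp.toLp 2 fun p => a p.1 : EuclideanSpace ℂ (ι × Fin 1))‖ = ‖a‖ := by
    intro a
    rw [EuclideanSpace.norm_eq, EuclideanSpace.norm_eq, Fintype.sum_prod_type]
    simp
  have h := norm_form_le (Matrix.of fun p q : ι × Fin 1 => φ p.1 q.1 (X p.2 q.2)) w' v'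
  rw [hn, hn] at h
  have hX : OperatorSpace.mnorm X = ‖x‖ := OperatorSpace.mnorm_one X
  have hb := dualMNorm_bound φ X
  rw [hX] at hb
  have hs : (∑ p, ∑ q, (star (w p) * v q) • φ p q) x = ∑ p, ∑ q, star (w' p) *
      (Matrix.of fun p q : ι × Fin 1 => φ p.1 q.1 (X p.2 q.2)) p q * v' q := by
    simp only [Fintype.sum_prod_type, Finset.univ_unique, Finset.sum_singleton, w', v', X,
      Matrix.of_apply, sum_apply, smul_apply, smul_eq_mul]
    exact Finset.sum_congr rfl fun i _ => Finset.sum_congr rfl fun j _ => by ring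
  rw [hs]
  refine h.trans ?_
  calc _ ≤ dualMNorm φ * ‖x‖ * ‖w‖ * ‖v‖ := by gcongr
    _ = _ := by ring

end operatorSpace

end matrixNorms

/-! ### Tensor products of unitary representations -/

section tensor

open UniformSpace

/-- The extension of a linear isometry equivalence to the completion. -/
noncomputable def completionIsometryEquiv {E : Type*} [NormedAddCommGroup E] [NormedSpace ℂ E]
    (e : E ≃ₗᵢ[ℂ] E) : Completion E ≃ₗᵢ[ℂ] Completion E where
  toFun := Completion.map e
  invFun := Completion.map e.symm
  map_add' x y := by
    refine Completion.induction_on₂ x y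
      (isClosed_eq (Completion.continuous_map.comp continuous_add)
        (continuous_add.comp ((Completion.continuous_map.comp continuous_fst).prodMk
          (Completion.continuous_map.comp continuous_snd)))) fun a b => ?_
    rw [← Completion.coe_add, Completion.map_coe e.isometry.uniformContinuous,
      Completion.map_coe e.isometry.uniformContinuous,
      Completion.map_coe e.isometry.uniformContinuous, map_add, Completion.coe_add]
  map_smul' c x := by
    refine Completion.induction_on x
      (isClosed_eq (Completion.continuous_map.comp (continuous_const_smul c))
        ((continuous_const_smul c).comp Completion.continuous_map)) fun a => ?_
    rw [← Completion.coe_smul, Completion.map_coe e.isometry.uniformContinuous,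
      Completion.map_coe e.isometry.uniformContinuous, map_smul, Completion.coe_smul]
    rfl
  left_inv x := by
    refine Completion.induction_on x
      (isClosed_eq (Completion.continuous_map.comp Completion.continuous_map) continuous_id)
      fun a => ?_
    rw [Completion.map_coe e.isometry.uniformContinuous,
      Completion.map_coe e.symm.isometry.uniformContinuous, e.symm_apply_apply]
  right_inv x := by
    refine Completion.induction_on x
      (isClosed_eq (Completion.continuous_map.comp Completion.continuous_map) continuous_id)
      fun a => ?_
    rw [Completion.map_coe e.symm.isometry.uniformContinuous,
      Completion.map_coe e.isometry.uniformContinuous, e.apply_symm_apply]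
  norm_map' x := by
    refine Completion.induction_on (p := fun x => ‖Completion.map e x‖ = ‖x‖) x
      (isClosed_eq (continuous_norm.comp Completion.continuous_map) continuous_norm) fun a => ?_
    rw [Completion.map_coe e.isometry.uniformContinuous, Completion.norm_coe, Completion.norm_coe,
      e.norm_map]

theorem completionIsometryEquiv_coe {E : Type*} [NormedAddCommGroup E] [NormedSpace ℂ E]
    (e : E ≃ₗᵢ[ℂ] E) (x : E) : completionIsometryEquiv e (x : Completion E) = (e x : E) :=
  Completion.map_coe e.isometry.uniformContinuous x

/-- A family of isometries that is strongly continuous at a dense set of vectors is strongly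
continuous. -/
theorem continuous_isometry_of_dense {X E : Type*} [TopologicalSpace X] [NormedAddCommGroup E]
    [NormedSpace ℂ E] (T : X → E ≃ₗᵢ[ℂ] E) {D : Set E} (hD : Dense D)
    (h : ∀ x ∈ D, Continuous fun s => T s x) (x : E) : Continuous fun s => T s x := by
  rw [continuous_iff_continuousAt]
  intro s
  rw [Metric.continuousAt_iff']
  intro ε hε
  obtain ⟨y, hy, hxy⟩ := Metric.dense_iff.1 hD x (ε / 3) (by positivity)
  rw [Metric.mem_ball] at hy
  filter_upwards [Metric.continuousAt_iff'.1 (h y hxy).continuousAt (ε / 3) (by positivity)]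
    with t ht
  calc dist (T t x) (T s x) ≤ dist (T t x) (T t y) + dist (T t y) (T s y) + dist (T s y) (T s x) :=
        dist_triangle4 _ _ _ _
    _ < ε / 3 + ε / 3 + ε / 3 := by
        rw [(T t).dist_map, (T s).dist_map, dist_comm x y]
        gcongr
    _ = ε := by ring

open scoped TensorProduct

/-- The tensor product of two unitary representations, on the completed tensor product. -/
noncomputable def UnitaryRep.tensor {G : Type u} [Group G] [TopologicalSpace G]
    (σ : UnitaryRep.{u, v} G) (ρ : UnitaryRep.{u, w} G) : UnitaryRep.{u, max v w} G where
  H := Completion (σ.H ⊗[ℂ] ρ.H)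
  toHom :=
    { toFun := fun s =>
        completionIsometryEquiv (TensorProduct.congrIsometry (σ.toHom s) (ρ.toHom s))
      map_one' := by
        ext x
        refine Completion.induction_on x (isClosed_eq (LinearIsometryEquiv.continuous _)
          (LinearIsometryEquiv.continuous _)) fun a => ?_
        rw [completionIsometryEquiv_coe, map_one, map_one]
        change ((TensorProduct.congrIsometry (.refl ℂ _) (.refl ℂ _) a : σ.H ⊗[ℂ] ρ.H) :
          Completion (σ.H ⊗[ℂ] ρ.H)) = _
        rw [TensorProduct.congrIsometry_refl_refl]
        rfl
      map_mul' := fun s t => by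
        ext x
        refine Completion.induction_on x (isClosed_eq (LinearIsometryEquiv.continuous _)
          (LinearIsometryEquiv.continuous _)) fun a => ?_
        change _ = completionIsometryEquiv _ (completionIsometryEquiv _ _)
        rw [completionIsometryEquiv_coe,
          completionIsometryEquiv_coe, completionIsometryEquiv_coe]
        congr 1
        induction a using TensorProduct.induction_on with
        | zero => simp
        | tmul a b => simp; rfl
        | add a b ha hb => rw [map_add, ha, hb, map_add, map_add] }
  continuous_toHom := by
    refine continuous_isometry_of_dense _ (Completion.denseRange_coe (α := σ.H ⊗[ℂ] ρ.H)) ?_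
    rintro _ ⟨a, rfl⟩
    change Continuous fun s => completionIsometryEquiv _ _
    simp only [completionIsometryEquiv_coe]
    refine (Completion.continuous_coe _).comp ?_
    induction a using TensorProduct.induction_on with
    | zero => simp only [map_zero]; exact continuous_const
    | tmul a b =>
      exact TensorProduct.continuous_tmul.comp
        ((σ.continuous_toHom a).prodMk (ρ.continuous_toHom b))
    | add a b ha hb => simp only [map_add]; exact ha.add hb

/-- An elementary tensor. -/
noncomputable def UnitaryRep.tmul {G : Type u} [Group G] [TopologicalSpace G]
    (σ : UnitaryRep.{u, v} G) (ρ : UnitaryRep.{u, w} G) (x : σ.H) (y : ρ.H) : (σ.tensor ρ).H :=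
  ((x ⊗ₜ[ℂ] y : σ.H ⊗[ℂ] ρ.H) : Completion (σ.H ⊗[ℂ] ρ.H))

theorem UnitaryRep.norm_tmul {G : Type u} [Group G] [TopologicalSpace G]
    (σ : UnitaryRep.{u, v} G) (ρ : UnitaryRep.{u, w} G) (x : σ.H) (y : ρ.H) :
    ‖σ.tmul ρ x y‖ = ‖x‖ * ‖y‖ :=
  (Completion.norm_coe _).trans (TensorProduct.norm_tmul x y)

theorem UnitaryRep.tensor_coeff {G : Type u} [Group G] [TopologicalSpace G]
    (σ : UnitaryRep.{u, v} G) (ρ : UnitaryRep.{u, w} G) (x x' : σ.H) (y y' : ρ.H) :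
    (σ.tensor ρ).coeff (σ.tmul ρ x y) (σ.tmul ρ x' y') = σ.coeff x x' * ρ.coeff y y' := by
  funext s
  have h : (σ.tensor ρ).toHom s (σ.tmul ρ x y) = σ.tmul ρ (σ.toHom s x) (ρ.toHom s y) :=
    completionIsometryEquiv_coe _ _
  change ⟪σ.tmul ρ x' y', (σ.tensor ρ).toHom s (σ.tmul ρ x y)⟫_ℂ = _
  rw [h]
  exact (Completion.inner_coe _ _).trans (TensorProduct.inner_tmul ℂ _ _ _ _)

theorem mul_mem_fourierStieltjes {G : Type u} [Group G] [TopologicalSpace G] {f g : G → ℂ}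
    (hf : f ∈ FourierStieltjes G) (hg : g ∈ FourierStieltjes G) : f * g ∈ FourierStieltjes G := by
  obtain ⟨σ, x, x', rfl⟩ := hf
  obtain ⟨ρ, y, y', rfl⟩ := hg
  exact ⟨σ.tensor ρ, _, _, (σ.tensor_coeff ρ x x' y y').symm⟩

end tensor

/-! ### Vectors of a direct sum -/

section directSumVectors

variable {G : Type u} [Group G] [TopologicalSpace G] {ι : Type w} (σ : ι → UnitaryRep.{u, v} G)

namespace UnitaryRep

open Classical in
/-- The vector of a direct sum that is supported by one summand. -/
noncomputable def dsSingle (i : ι) (ξ : (σ i).H) : (directSum σ).H :=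
  lp.single (E := fun i => (σ i).H) 2 i ξ

/-- A coordinate of a vector of a direct sum. -/
noncomputable def dsCoord (η : (directSum σ).H) (i : ι) : (σ i).H :=
  (show lp (fun i => (σ i).H) 2 from η) i

theorem toHom_dsSingle (s : G) (i : ι) (ξ : (σ i).H) :
    (directSum σ).toHom s (dsSingle σ i ξ) = dsSingle σ i ((σ i).toHom s ξ) := by
  classical
  refine lp.ext (funext fun j => ?_)
  refine (directSumOp_apply σ s _ j).trans ?_
  by_cases h : j = i
  · subst h; simp [dsSingle]
  · simp [dsSingle, lp.single_apply, h]

theorem inner_dsSingle_right (i : ι) (ξ : (σ i).H) (η : (directSum σ).H) :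
    ⟪η, dsSingle σ i ξ⟫_ℂ = ⟪dsCoord σ η i, ξ⟫_ℂ := by
  classical exact lp.inner_single_right (𝕜 := ℂ) i ξ (show lp (fun i => (σ i).H) 2 from η)

theorem dsCoord_dsSingle (i : ι) (ξ : (σ i).H) : dsCoord σ (dsSingle σ i ξ) i = ξ := by
  classical exact lp.single_apply_self (E := fun i => (σ i).H) 2 i ξ

theorem hasSum_dsSingle (η : (directSum σ).H) :
    HasSum (fun i => dsSingle σ i (dsCoord σ η i)) η := by
  classical exact lp.hasSum_single (E := fun i => (σ i).H) (p := 2) (by norm_num) η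

theorem sum_sq_dsCoord_le (F : Finset ι) (η : (directSum σ).H) :
    ∑ i ∈ F, ‖dsCoord σ η i‖ ^ 2 ≤ ‖η‖ ^ 2 := by
  have := lp.sum_rpow_le_norm_rpow (E := fun i => (σ i).H) (p := 2) (by norm_num) η F
  simp only [ENNReal.toReal_ofNat, Real.rpow_ofNat] at this
  exact this

theorem coeff_dsSingle_left (i : ι) (ξ : (σ i).H) (η : (directSum σ).H) :
    (directSum σ).coeff (dsSingle σ i ξ) η = (σ i).coeff ξ (dsCoord σ η i) := by
  funext s
  change ⟪η, (directSum σ).toHom s _⟫_ℂ = _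
  rw [toHom_dsSingle, inner_dsSingle_right]
  rfl

end UnitaryRep

end directSumVectors

/-! ### Matrix representations and finite-dimensional unitary representations -/

section matrixRep

variable {G : Type u} [Group G] [TopologicalSpace G]

/-- A vector of `ℂⁿ` in the universe `u`. -/
noncomputable def liftVec {n : ℕ} (v : Fin n → ℂ) : EuclideanSpace ℂ (ULift.{u} (Fin n)) :=
  WithLp.toLp 2 fun i => v i.down

theorem norm_liftVec {n : ℕ} (v : Fin n → ℂ) :
    ‖liftVec.{u} v‖ = ‖(WithLp.toLp 2 v : EuclideanSpace ℂ (Fin n))‖ := by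
  rw [EuclideanSpace.norm_eq, EuclideanSpace.norm_eq]
  exact congrArg _ (Equiv.ulift.sum_comp fun i => ‖v i‖ ^ 2)

theorem inner_liftVec {n : ℕ} (v w : Fin n → ℂ) :
    ⟪liftVec.{u} w, liftVec.{u} v⟫_ℂ = ∑ i, star (w i) * v i := by
  rw [PiLp.inner_apply]
  refine (Equiv.ulift.sum_comp fun i => ⟪w i, v i⟫_ℂ).trans ?_
  exact Finset.sum_congr rfl fun i _ => by rw [RCLike.inner_apply, mul_comm]; rfl

theorem norm_mulVec_unitary {n : ℕ} (U : Matrix.unitaryGroup (Fin n) ℂ) (v : Fin n → ℂ) :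
    ‖(WithLp.toLp 2 ((U : Matrix (Fin n) (Fin n) ℂ).mulVec v) : EuclideanSpace ℂ (Fin n))‖ =
      ‖(WithLp.toLp 2 v : EuclideanSpace ℂ (Fin n))‖ := by
  have h := (Unitary.linearIsometryEquiv (𝕜 := ℂ) (H := EuclideanSpace ℂ (Fin n))
    ⟨Matrix.toEuclideanCLM (n := Fin n) (𝕜 := ℂ) (U : Matrix (Fin n) (Fin n) ℂ),
      Unitary.map_mem _ U.2⟩).norm_map (WithLp.toLp 2 v)
  exact h

/-- The unitary representation given by a representation by unitary matrices. -/
noncomputable def UnitaryRep.ofMatrix {n : ℕ} (κ : G →* Matrix.unitaryGroup (Fin n) ℂ)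
    (hκ : Continuous κ) : UnitaryRep.{u, u} G where
  -- The lift places the space in the universe of G, over which `FourierStieltjes` and
  -- `universalRep` range.
  H := EuclideanSpace ℂ (ULift.{u} (Fin n))
  toHom :=
    { toFun := fun s =>
        { toFun := fun ξ => liftVec ((κ s : Matrix (Fin n) (Fin n) ℂ).mulVec fun j => ξ ⟨j⟩)
          invFun := fun ξ => liftVec ((κ s⁻¹ : Matrix (Fin n) (Fin n) ℂ).mulVec fun j => ξ ⟨j⟩)
          map_add' := fun ξ η => by
            ext i
            exact congrFun (Matrix.mulVec_add (κ s : Matrix (Fin n) (Fin n) ℂ) (fun j => ξ ⟨j⟩)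
              fun j => η ⟨j⟩) i.down
          map_smul' := fun c ξ => by
            ext i
            exact congrFun (Matrix.mulVec_smul (κ s : Matrix (Fin n) (Fin n) ℂ) c
              fun j => ξ ⟨j⟩) i.down
          left_inv := fun ξ => by
            ext ⟨i⟩
            change (κ s⁻¹ : Matrix (Fin n) (Fin n) ℂ).mulVec
              ((κ s : Matrix (Fin n) (Fin n) ℂ).mulVec fun j => ξ ⟨j⟩) i = _
            rw [Matrix.mulVec_mulVec, ← Submonoid.coe_mul, ← map_mul, inv_mul_cancel, map_one]
            simp
          right_inv := fun ξ => by
            ext ⟨i⟩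
            change (κ s : Matrix (Fin n) (Fin n) ℂ).mulVec
              ((κ s⁻¹ : Matrix (Fin n) (Fin n) ℂ).mulVec fun j => ξ ⟨j⟩) i = _
            rw [Matrix.mulVec_mulVec, ← Submonoid.coe_mul, ← map_mul, mul_inv_cancel, map_one]
            simp
          norm_map' := fun ξ => (norm_liftVec _).trans
            ((norm_mulVec_unitary (κ s) _).trans (norm_liftVec.{u} fun j => ξ ⟨j⟩).symm) }
      map_one' := by
        ext ξ ⟨i⟩
        change ((κ 1 : Matrix.unitaryGroup (Fin n) ℂ) : Matrix (Fin n) (Fin n) ℂ).mulVec _ i = _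
        rw [map_one]
        simp
      map_mul' := fun s t => by
        ext ξ ⟨i⟩
        change ((κ (s * t) : Matrix.unitaryGroup (Fin n) ℂ) : Matrix (Fin n) (Fin n) ℂ).mulVec _ i =
          (κ s : Matrix (Fin n) (Fin n) ℂ).mulVec
              ((κ t : Matrix (Fin n) (Fin n) ℂ).mulVec fun j => ξ ⟨j⟩) i
        rw [map_mul, Matrix.mulVec_mulVec]
        rfl }
  continuous_toHom ξ := by
    refine (PiLp.continuous_toLp 2 _).comp (continuous_pi fun i => ?_)
    exact continuous_finsetSum Finset.univ fun j _ =>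
      (continuous_unitary_entry hκ i.down j).mul (continuous_const (y := ξ ⟨j⟩))

theorem UnitaryRep.ofMatrix_coeff {n : ℕ} {κ : G →* Matrix.unitaryGroup (Fin n) ℂ}
    (hκ : Continuous κ) (v w : Fin n → ℂ) :
    (UnitaryRep.ofMatrix κ hκ).coeff (liftVec v : EuclideanSpace ℂ (ULift.{u} (Fin n)))
      (liftVec w : EuclideanSpace ℂ (ULift.{u} (Fin n))) = matCoeff κ v w := by
  funext s
  refine (inner_liftVec _ _).trans ?_
  simp only [matCoeff, mul_assoc, ← Finset.mul_sum]
  rfl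

theorem IsTrig.mem_fourierStieltjes {f : G → ℂ} (hf : IsTrig f) : f ∈ FourierStieltjes G := by
  obtain ⟨n, κ, v, w, hκ, rfl⟩ := hf
  exact ⟨UnitaryRep.ofMatrix κ hκ, _, _, (UnitaryRep.ofMatrix_coeff hκ v w).symm⟩

instance {n : ℕ} (κ : G →* Matrix.unitaryGroup (Fin n) ℂ) (hκ : Continuous κ) :
    FiniteDimensional ℂ (UnitaryRep.ofMatrix κ hκ).H :=
  inferInstanceAs (FiniteDimensional ℂ (EuclideanSpace ℂ (ULift.{u} (Fin n))))

/-- The matrices of a finite-dimensional unitary representation in an orthonormal basis. -/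
theorem UnitaryRep.exists_matrix (σ : UnitaryRep.{u, v} G) [FiniteDimensional ℂ σ.H] :
    ∃ (n : ℕ) (κ : G →* Matrix.unitaryGroup (Fin n) ℂ) (b : OrthonormalBasis (Fin n) ℂ σ.H),
      Continuous κ ∧ (∀ s i j, (κ s : Matrix (Fin n) (Fin n) ℂ) i j = σ.coeff (b j) (b i) s) := by
  let b := stdOrthonormalBasis ℂ σ.H
  let M : G →* Matrix (Fin (Module.finrank ℂ σ.H)) (Fin (Module.finrank ℂ σ.H)) ℂ :=
    { toFun := fun s => LinearMap.toMatrixOrthonormal b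
        ((σ.toHom s).toLinearEquiv : σ.H →ₗ[ℂ] σ.H)
      map_one' := by
        rw [map_one]
        exact map_one (LinearMap.toMatrixOrthonormal b)
      map_mul' := fun s t => by
        rw [map_mul]
        exact map_mul (LinearMap.toMatrixOrthonormal b) _ _ }
  have hM : ∀ s i j, M s i j = σ.coeff (b j) (b i) s := fun s i j =>
    LinearMap.toMatrixOrthonormal_apply_apply b _ i j
  have hu : ∀ s, M s ∈ Matrix.unitaryGroup (Fin (Module.finrank ℂ σ.H)) ℂ := by
    intro s
    have h : star (M s) = M s⁻¹ := by
      ext i j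
      rw [Matrix.star_apply, hM, hM]
      simp only [coeff, RCLike.star_def, inner_conj_symm]
      rw [← (σ.toHom s).inner_map_map (b i), map_inv]
      congr 1
      exact ((σ.toHom s).apply_symm_apply _).symm
    rw [Matrix.mem_unitaryGroup_iff, h, ← map_mul, mul_inv_cancel, map_one]
  refine ⟨_, M.codRestrict _ hu, b, ?_, hM⟩
  refine Continuous.subtype_mk (continuous_matrix fun i j => ?_) _
  simp only [hM]
  exact continuous_const.inner (σ.continuous_toHom _)

theorem UnitaryRep.isTrig_coeff (σ : UnitaryRep.{u, v} G) [FiniteDimensional ℂ σ.H] (ξ η : σ.H) :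
    IsTrig (σ.coeff ξ η) := by
  obtain ⟨n, κ, b, hκ, h⟩ := σ.exists_matrix
  refine ⟨n, κ, b.repr ξ, b.repr η, hκ, ?_⟩
  funext s
  conv_lhs => rw [← b.sum_repr ξ, ← b.sum_repr η]
  simp only [coeff, map_sum, map_smul, sum_inner, inner_sum, inner_smul_left, inner_smul_right,
    matCoeff, h, Finset.mul_sum]
  rw [Finset.sum_comm]
  exact Finset.sum_congr rfl fun i _ => Finset.sum_congr rfl fun j _ => by
    rw [RCLike.star_def]; ring

end matrixRep

/-! ### Density of the compactly supported continuous functions -/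

/-- Compactly supported continuous functions are dense in `L^p` of a regular measure on a locally
compact space. No normality of the space is needed. -/
theorem exists_hasCompactSupport_eLpNorm_sub_le {X : Type*} [TopologicalSpace X] [RegularSpace X]
    [LocallyCompactSpace X] [MeasurableSpace X] [BorelSpace X] {μ : Measure X} [μ.Regular]
    {p : ℝ≥0∞} (hp : p ≠ ∞) {f : X → ℂ} (hf : MemLp f p μ) {ε : ℝ≥0∞} (hε : ε ≠ 0) :
    ∃ g : X → ℂ, HasCompactSupport g ∧ eLpNorm (f - g) p μ ≤ ε ∧ Continuous g ∧ MemLp g p μ := by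
  suffices H : ∃ g : X → ℂ,
      eLpNorm (f - g) p μ ≤ ε ∧ Continuous g ∧ MemLp g p μ ∧ HasCompactSupport g by
    obtain ⟨g, hg, g_cont, g_mem, g_support⟩ := H
    exact ⟨g, g_support, hg, g_cont, g_mem⟩
  apply hf.induction_dense hp _ _ _ _ hε
  rotate_left
  · rintro f g ⟨f_cont, f_mem, hf⟩ ⟨g_cont, g_mem, hg⟩
    exact ⟨f_cont.add g_cont, f_mem.add g_mem, hf.add hg⟩
  · rintro f ⟨_, f_mem, _⟩
    exact f_mem.aestronglyMeasurable
  intro c t ht htμ ε hε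
  obtain ⟨δ, δpos, hδ⟩ := exists_Lp_half ℂ μ p hε
  obtain ⟨η, ηpos, hη⟩ := exists_eLpNorm_indicator_le (μ := μ) hp c δpos.ne'
  have hη_pos' : (0 : ℝ≥0∞) < η := ENNReal.coe_pos.2 ηpos
  obtain ⟨s, st, s_compact, s_closed, μs⟩ :=
    ht.exists_isCompact_isClosed_sdiff_lt htμ.ne hη_pos'.ne'
  have hsμ : μ s < ∞ := (measure_mono st).trans_lt htμ
  have I1 : eLpNorm ((s.indicator fun _ => c) - t.indicator fun _ => c) p μ ≤ δ := by
    rw [← eLpNorm_neg, neg_sub, ← Set.indicator_sdiff st]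
    exact hη _ μs.le
  obtain ⟨V, sV, V_open, -, hV⟩ := s_closed.measurableSet.exists_isOpen_sdiff_lt hsμ.ne hη_pos'.ne'
  -- Urysohn's lemma for a compact set inside an open one; local compactness and regularity suffice,
  -- and the cutoff has compact support. It differs from the indicator of `s` only on V \ s, which
  -- has small measure.
  obtain ⟨g, hgs, hgV, hgc, hg01⟩ := exists_continuous_one_zero_of_isCompact s_compact
    V_open.isClosed_compl (Set.disjoint_compl_right_iff_subset.2 sV)
  let F : X → ℂ := fun x => (g x : ℂ) * c
  have F_cont : Continuous F := (Complex.continuous_ofReal.comp g.continuous).mul continuous_const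
  have F_supp : HasCompactSupport F :=
    (hgc.comp_left (g := fun r : ℝ => (r : ℂ)) Complex.ofReal_zero).mul_right
  have F_mem : MemLp F p μ := F_cont.memLp_of_hasCompactSupport F_supp
  have I2 : eLpNorm (F - s.indicator fun _ => c) p μ ≤ δ := by
    refine (eLpNorm_mono fun x => ?_).trans (hη _ hV.le)
    by_cases hxs : x ∈ s
    · have : g x = 1 := hgs hxs
      simp [F, hxs, this]
    · by_cases hxV : x ∈ V
      · have h := hg01 x
        rw [Set.indicator_of_mem (show x ∈ V \ s from ⟨hxV, hxs⟩), Pi.sub_apply,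
          Set.indicator_of_notMem hxs, sub_zero, norm_mul, Complex.norm_real,
          Real.norm_of_nonneg h.1]
        exact mul_le_of_le_one_left (norm_nonneg _) h.2
      · have : g x = 0 := hgV hxV
        simp [F, hxs, this]
  refine ⟨F, ?_, F_cont, F_mem, F_supp⟩
  have := (hδ _ _ (F_mem.aestronglyMeasurable.sub
    (aestronglyMeasurable_const.indicator s_closed.measurableSet))
    ((aestronglyMeasurable_const.indicator s_closed.measurableSet).sub
      (aestronglyMeasurable_const.indicator ht)) I2 I1).le
  simpa only [sub_add_sub_cancel] using this

theorem exists_hasCompactSupport_integral_sub_le {X : Type*} [TopologicalSpace X] [RegularSpace X]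
    [LocallyCompactSpace X] [MeasurableSpace X] [BorelSpace X] {μ : Measure X} [μ.Regular]
    {f : X → ℂ} (hf : Integrable f μ) {ε : ℝ} (hε : 0 < ε) :
    ∃ g : X → ℂ, HasCompactSupport g ∧ ∫ x, ‖f x - g x‖ ∂μ ≤ ε ∧ Continuous g ∧
      Integrable g μ := by
  obtain ⟨g, hg, hfg, hgc, hgm⟩ := exists_hasCompactSupport_eLpNorm_sub_le ENNReal.one_ne_top
    (memLp_one_iff_integrable.2 hf) (ε := ENNReal.ofReal ε) (by simpa using hε)
  rw [memLp_one_iff_integrable] at hgm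
  refine ⟨g, hg, ?_, hgc, hgm⟩
  change ∫ x, ‖(f - g) x‖ ∂μ ≤ ε
  rw [integral_norm_eq_lintegral_enorm (hf.sub hgm).aestronglyMeasurable]
  rw [eLpNorm_one_eq_lintegral_enorm] at hfg
  exact ENNReal.toReal_le_of_le_ofReal hε.le hfg

/-! ### The duality between `B(G)` and `C*(G)` -/

section pairing

variable {G : Type u} [Group G] [TopologicalSpace G]

theorem UnitaryRep.norm_coeff_le (σ : UnitaryRep.{u, v} G) (ξ η : σ.H) (s : G) :
    ‖σ.coeff ξ η s‖ ≤ ‖ξ‖ * ‖η‖ := by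
  refine (norm_inner_le_norm _ _).trans ?_
  rw [LinearIsometryEquiv.norm_map, mul_comm]

theorem UnitaryRep.continuous_coeff (σ : UnitaryRep.{u, v} G) (ξ η : σ.H) :
    Continuous (σ.coeff ξ η) :=
  continuous_const.inner (σ.continuous_toHom ξ)

theorem FourierStieltjes.continuous (u : FourierStieltjes G) : Continuous (u : G → ℂ) := by
  obtain ⟨σ, ξ, η, h⟩ := u.2
  rw [h]
  exact σ.continuous_coeff ξ η

theorem FourierStieltjes.exists_bound (u : FourierStieltjes G) :
    ∃ C : ℝ, 0 ≤ C ∧ ∀ s, ‖(u : G → ℂ) s‖ ≤ C := by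
  obtain ⟨σ, ξ, η, h⟩ := u.2
  exact ⟨‖ξ‖ * ‖η‖, by positivity, fun s => by rw [h]; exact σ.norm_coeff_le ξ η s⟩

variable [IsTopologicalGroup G] [LocallyCompactSpace G] [MeasurableSpace G] [BorelSpace G]

theorem norm_vectorFunctional_le (σ : UnitaryRep.{u, u} G) (ξ η : σ.H) (a : groupCStar G) :
    ‖vectorFunctional σ ξ η a‖ ≤ ‖a‖ * (‖ξ‖ * ‖η‖) := by
  classical
  let x : (universalRep G).H := lp.single (E := fun σ : UnitaryRep.{u, u} G => σ.H) 2 σ ξ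
  let y : (universalRep G).H := lp.single (E := fun σ : UnitaryRep.{u, u} G => σ.H) 2 σ η
  have hx : ‖x‖ = ‖ξ‖ := lp.norm_single (by norm_num) σ ξ
  have hy : ‖y‖ = ‖η‖ := lp.norm_single (by norm_num) σ η
  have h1 : vectorFunctional σ ξ η a =
      ⟪y, (a : (universalRep G).H →L[ℂ] (universalRep G).H) x⟫_ℂ := by
    simp only [vectorFunctional, x, y]
    congr!
  rw [h1]
  refine (norm_inner_le_norm _ _).trans ?_
  rw [hy]
  calc _ ≤ ‖η‖ * (‖(a : (universalRep G).H →L[ℂ] (universalRep G).H)‖ * ‖x‖) := by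
        gcongr
        exact ContinuousLinearMap.le_opNorm _ _
    _ = _ := by rw [hx, Submodule.coe_norm]; ring

theorem norm_fsToDual_le (u : FourierStieltjes G) (σ : UnitaryRep.{u, u} G) (ξ η : σ.H)
    (h : (u : G → ℂ) = σ.coeff ξ η) (a : groupCStar G) :
    ‖fsToDual G u a‖ ≤ ‖a‖ * (‖ξ‖ * ‖η‖) := by
  rw [fsToDual_apply u σ ξ η h]
  exact norm_vectorFunctional_le σ ξ η a

/-- The bound holds for every way of writing u as a coefficient, hence for the infimum; a = 0 is set
apart to allow division by ‖a‖. It shows that norm limits in B(G) are weak* limits. -/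
theorem norm_fsToDual_le_fsNorm (u : FourierStieltjes G) (a : groupCStar G) :
    ‖fsToDual G u a‖ ≤ ‖a‖ * fsNorm u := by
  rcases (norm_nonneg a).eq_or_lt with h0 | h0
  · obtain ⟨σ, ξ, η, h⟩ := u.2
    have := norm_fsToDual_le u σ ξ η h a
    rw [← h0, zero_mul] at this ⊢
    exact this
  · rw [← div_le_iff₀' h0]
    refine le_csInf ?_ ?_
    · obtain ⟨σ, ξ, η, h⟩ := u.2
      exact ⟨_, σ, ξ, η, h, rfl⟩
    · rintro _ ⟨σ, ξ, η, h, rfl⟩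
      rw [div_le_iff₀' h0]
      exact norm_fsToDual_le u σ ξ η h a

theorem fsToDual_integratedForm (u : FourierStieltjes G) (f : G → ℂ) (T : groupCStar G)
    (hT : IsIntegratedForm (universalRep G) f T) :
    fsToDual G u T = ∫ s, f s * (u : G → ℂ) s ∂Measure.haar := by
  obtain ⟨σ, ξ, η, h⟩ := u.2
  rw [fsToDual_apply u σ ξ η h, vectorFunctional_integratedForm σ ξ η f T hT, h]

theorem integrable_mul_coeff' (σ : UnitaryRep.{u, v} G) (ξ η : σ.H) {f : G → ℂ}
    (hf : Integrable f Measure.haar) :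
    Integrable (fun s => f s * σ.coeff ξ η s) Measure.haar :=
  hf.mul_bdd (c := ‖ξ‖ * ‖η‖) (σ.continuous_coeff ξ η).aestronglyMeasurable
    (Filter.Eventually.of_forall (σ.norm_coeff_le ξ η))

theorem IsIntegratedForm.add {σ : UnitaryRep.{u, v} G} {f g : G → ℂ} {S T : σ.H →L[ℂ] σ.H}
    (hS : IsIntegratedForm σ f S) (hT : IsIntegratedForm σ g T) (hf : Integrable f Measure.haar)
    (hg : Integrable g Measure.haar) : IsIntegratedForm σ (f + g) (S + T) := by
  intro ξ η
  rw [add_apply, inner_add_right, hS, hT,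
    ← integral_add (integrable_mul_coeff' σ ξ η hf) (integrable_mul_coeff' σ ξ η hg)]
  simp [add_mul]

theorem IsIntegratedForm.smul {σ : UnitaryRep.{u, v} G} {f : G → ℂ} {S : σ.H →L[ℂ] σ.H}
    (hS : IsIntegratedForm σ f S) (c : ℂ) : IsIntegratedForm σ (c • f) (c • S) := by
  intro ξ η
  rw [smul_apply, inner_smul_right, hS, ← integral_const_mul]
  simp [mul_assoc]

theorem IsIntegratedForm.sub {σ : UnitaryRep.{u, v} G} {f g : G → ℂ} {S T : σ.H →L[ℂ] σ.H}
    (hS : IsIntegratedForm σ f S) (hT : IsIntegratedForm σ g T) (hf : Integrable f Measure.haar)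
    (hg : Integrable g Measure.haar) : IsIntegratedForm σ (f - g) (S - T) := by
  have h := hS.add (hT.smul (-1)) hf (hg.smul (-1))
  simpa [sub_eq_add_neg] using h

/-- The integrated forms are dense in `C*(G)`. -/
theorem exists_integratedForm_near (a : groupCStar G) {ε : ℝ} (hε : 0 < ε) :
    ∃ (f : G → ℂ) (T : groupCStar G), Integrable f Measure.haar ∧
      IsIntegratedForm (universalRep G) f T ∧ ‖a - T‖ < ε := by
  obtain ⟨T, hT, hd⟩ := Metric.mem_closure_iff.1 a.2 ε hε
  -- The integrated forms are already a subspace, so the span in `cstarOf` adds nothing.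
  have h : ∃ f : G → ℂ, Integrable f Measure.haar ∧ IsIntegratedForm (universalRep G) f T := by
    clear hd
    induction hT using Submodule.span_induction with
    | mem T hT => exact hT
    | zero => exact ⟨0, integrable_zero _ _ _, fun ξ η => by simp⟩
    | add S T _ _ hS hT =>
      obtain ⟨f, hf, hS⟩ := hS
      obtain ⟨g, hg, hT⟩ := hT
      exact ⟨f + g, hf.add hg, hS.add hT hf hg⟩
    | smul c S _ hS =>
      obtain ⟨f, hf, hS⟩ := hS
      exact ⟨c • f, hf.smul c, hS.smul c⟩
  obtain ⟨f, hf, hfT⟩ := h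
  refine ⟨f, ⟨T, Submodule.le_topologicalClosure _ hT⟩, hf, hfT, ?_⟩
  rw [dist_eq_norm] at hd
  exact hd

theorem mem_groupCStar_of_integratedForm {f : G → ℂ} (hf : Integrable f Measure.haar)
    {T : (universalRep G).H →L[ℂ] (universalRep G).H}
    (hT : IsIntegratedForm (universalRep G) f T) : T ∈ groupCStar G :=
  Submodule.le_topologicalClosure _ (Submodule.subset_span ⟨f, hf, hT⟩)

theorem FourierStieltjes.integrable_mul (u : FourierStieltjes G) {f : G → ℂ}
    (hf : Integrable f Measure.haar) : Integrable (fun s => f s * (u : G → ℂ) s) Measure.haar := by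
  obtain ⟨C, -, hC⟩ := FourierStieltjes.exists_bound u
  exact hf.mul_bdd (c := C) (FourierStieltjes.continuous u).aestronglyMeasurable (Filter.Eventually.of_forall hC)

/-- Every integrable function has an integrated form. -/
theorem exists_integratedForm (σ : UnitaryRep.{u, v} G) {f : G → ℂ}
    (hf : Integrable f Measure.haar) : ∃ T : σ.H →L[ℂ] σ.H, IsIntegratedForm σ f T := by
  have hb : ∀ ξ η : σ.H, ‖∫ s, f s * σ.coeff ξ η s ∂Measure.haar‖ ≤
      (∫ s, ‖f s‖ ∂Measure.haar) * ‖η‖ * ‖ξ‖ := by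
    intro ξ η
    refine (norm_integral_le_integral_norm _).trans ?_
    rw [mul_assoc, ← integral_mul_const]
    refine integral_mono (integrable_mul_coeff' σ ξ η hf).norm (hf.norm.mul_const _) fun s => ?_
    change ‖f s * _‖ ≤ _
    rw [norm_mul]
    gcongr
    rw [mul_comm]
    exact σ.norm_coeff_le ξ η s
  -- The form is conjugate-linear in η. Riesz represents it as ⟨Aη, ξ⟩ in the convention of Mathlib,
  -- so the operator sought is the adjoint of A.
  let B : σ.H →L⋆[ℂ] σ.H →L[ℂ] ℂ := LinearMap.mkContinuous₂
    (LinearMap.mk₂'ₛₗ (starRingEnd ℂ) (RingHom.id ℂ)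
      (fun η ξ => ∫ s, f s * σ.coeff ξ η s ∂Measure.haar)
      (fun η η' ξ => by
        rw [← integral_add (integrable_mul_coeff' σ _ _ hf) (integrable_mul_coeff' σ _ _ hf)]
        simp [UnitaryRep.coeff, mul_add])
      (fun c η ξ => by
        rw [smul_eq_mul, ← integral_const_mul]
        simp only [UnitaryRep.coeff, inner_smul_left, mul_left_comm])
      (fun η ξ ξ' => by
        rw [← integral_add (integrable_mul_coeff' σ _ _ hf) (integrable_mul_coeff' σ _ _ hf)]
        simp [UnitaryRep.coeff, mul_add])
      (fun c η ξ => by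
        rw [RingHom.id_apply, smul_eq_mul, ← integral_const_mul]
        simp [UnitaryRep.coeff, mul_left_comm]))
    (∫ s, ‖f s‖ ∂Measure.haar) (fun η ξ => hb ξ η)
  refine ⟨ContinuousLinearMap.adjoint (InnerProductSpace.continuousLinearMapOfBilin B),
    fun ξ η => ?_⟩
  rw [ContinuousLinearMap.adjoint_inner_right,
    InnerProductSpace.continuousLinearMapOfBilin_apply]
  rfl

/-- The module action of `B(G)` on `C*(G)` is bounded on integrated forms. -/
theorem norm_integratedForm_mul_le (ρ : UnitaryRep.{u, u} G) (x y : ρ.H) {f : G → ℂ}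
    (hf : Integrable f Measure.haar) {T S : (universalRep G).H →L[ℂ] (universalRep G).H}
    (hT : IsIntegratedForm (universalRep G) f T)
    (hS : IsIntegratedForm (universalRep G) (fun s => f s * ρ.coeff x y s) S) :
    ‖S‖ ≤ ‖T‖ * (‖x‖ * ‖y‖) := by
  set c := ‖T‖ * (‖x‖ * ‖y‖) with hc
  have hc0 : 0 ≤ c := by positivity
  let id' : UnitaryRep.{u, u} G → UnitaryRep.{u, u} G := fun σ => σ
  have hsingle : ∀ (σ : UnitaryRep.{u, u} G) (ξ : σ.H) (η : (universalRep G).H),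
      ‖⟪η, S (UnitaryRep.dsSingle id' σ ξ)⟫_ℂ‖ ≤
        c * (‖ξ‖ * ‖UnitaryRep.dsCoord id' η σ‖) := by
    intro σ ξ η
    -- On the summand σ, the weight ρ.coeff x y is absorbed by passing to σ ⊗ ρ. This is itself a
    -- summand of the universal representation, so the norm of T controls its coefficients.
    have h1 : ⟪η, S (UnitaryRep.dsSingle id' σ ξ)⟫_ℂ =
        vectorFunctional (σ.tensor ρ) (σ.tmul ρ ξ x) (σ.tmul ρ (UnitaryRep.dsCoord id' η σ) y)
          ⟨T, mem_groupCStar_of_integratedForm hf hT⟩ := by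
      refine (hS _ _).trans ?_
      rw [vectorFunctional_integratedForm _ _ _ f _ hT]
      congr 1
      funext s
      have hco := congrFun (UnitaryRep.coeff_dsSingle_left id' σ ξ η) s
      rw [UnitaryRep.tensor_coeff, Pi.mul_apply]
      calc _ = f s * ρ.coeff x y s * (id' σ).coeff ξ (UnitaryRep.dsCoord id' η σ) s := by
            rw [← hco]; rfl
        _ = _ := by ring
    rw [h1]
    refine (norm_vectorFunctional_le _ _ _ _).trans (le_of_eq ?_)
    rw [UnitaryRep.norm_tmul, UnitaryRep.norm_tmul, Submodule.coe_norm, hc]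
    ring
  refine ContinuousLinearMap.opNorm_le_bound _ hc0 fun ξ => ?_
  -- The bound on one summand involves only the matching coordinate of η, so Cauchy-Schwarz adds up
  -- the summands with no loss.
  have key : ∀ η : (universalRep G).H, ‖⟪η, S ξ⟫_ℂ‖ ≤ c * (‖ξ‖ * ‖η‖) := by
    intro η
    have hs : HasSum (fun σ => UnitaryRep.dsSingle id' σ (UnitaryRep.dsCoord id' ξ σ)) ξ :=
      UnitaryRep.hasSum_dsSingle id' ξ
    have hs' : HasSum (fun σ => ⟪η, S (UnitaryRep.dsSingle id' σ
        (UnitaryRep.dsCoord id' ξ σ))⟫_ℂ) ⟪η, S ξ⟫_ℂ :=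
      hs.mapL ((innerSL ℂ η) ∘L S)
    refine le_of_tendsto (continuous_norm.continuousAt.tendsto.comp hs')
      (Filter.Eventually.of_forall fun F => ?_)
    change ‖∑ σ ∈ F, _‖ ≤ _
    refine (norm_sum_le _ _).trans ((Finset.sum_le_sum fun σ _ => hsingle σ _ η).trans ?_)
    rw [← Finset.mul_sum]
    refine mul_le_mul_of_nonneg_left ?_ hc0
    refine (Real.sum_mul_le_sqrt_mul_sqrt F _ _).trans ?_
    exact mul_le_mul
      (Real.sqrt_le_iff.2 ⟨norm_nonneg _, UnitaryRep.sum_sq_dsCoord_le id' F ξ⟩)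
      (Real.sqrt_le_iff.2 ⟨norm_nonneg _, UnitaryRep.sum_sq_dsCoord_le id' F η⟩)
      (Real.sqrt_nonneg _) (norm_nonneg _)
  rcases (norm_nonneg (S ξ)).eq_or_lt with h0 | h0
  · rw [← h0]; positivity
  · have h := key (S ξ)
    rw [inner_self_eq_norm_sq_to_K] at h
    simp only [norm_pow, RCLike.norm_ofReal, abs_norm] at h
    nlinarith

/-- Multiplication by an element of `B(G)` is weak*-continuous on `B(G)`. -/
theorem exists_module_action (v : FourierStieltjes G) (a : groupCStar G) :
    ∃ b : groupCStar G, ∀ u uv : FourierStieltjes G, (uv : G → ℂ) = u * v →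
      fsToDual G u b = fsToDual G uv a := by
  obtain ⟨ρ, x, y, hv⟩ := v.2
  choose f T hf hT hTa using fun n : ℕ =>
    exists_integratedForm_near a (ε := 1 / (n + 1)) (by positivity)
  have hfv : ∀ n, Integrable (fun s => f n s * ρ.coeff x y s) Measure.haar := fun n =>
    integrable_mul_coeff' ρ x y (hf n)
  choose S hS using fun n => exists_integratedForm (universalRep G) (hfv n)
  let S' : ℕ → groupCStar G := fun n => ⟨S n, mem_groupCStar_of_integratedForm (hfv n) (hS n)⟩
  have hlim : Filter.Tendsto T Filter.atTop (𝓝 a) := by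
    rw [tendsto_iff_norm_sub_tendsto_zero]
    refine squeeze_zero (fun _ => norm_nonneg _) (fun n => ?_)
      tendsto_one_div_add_atTop_nhds_zero_nat
    rw [norm_sub_rev]
    exact (hTa n).le
  -- Passing from the integrated form of f to that of f · v is Lipschitz, so the action on
  -- integrated forms extends to the limit a.
  have hSle : ∀ m n, dist (S' m) (S' n) ≤ ‖x‖ * ‖y‖ * dist (T m) (T n) := by
    intro m n
    have h1 := (hT m).sub (hT n) (hf m) (hf n)
    have h2 := (hS m).sub (hS n) (hfv m) (hfv n)
    have h3 : ((fun s => f m s * ρ.coeff x y s) - fun s => f n s * ρ.coeff x y s) =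
        fun s => (f m - f n) s * ρ.coeff x y s := by
      funext s
      simp [sub_mul]
    rw [h3] at h2
    have := norm_integratedForm_mul_le ρ x y ((hf m).sub (hf n)) h1 h2
    rw [dist_eq_norm, dist_eq_norm, mul_comm]
    exact this
  have hcau : CauchySeq S' := by
    have hT' := hlim.cauchySeq
    rw [Metric.cauchySeq_iff] at hT' ⊢
    intro ε hε
    obtain ⟨N, hN⟩ := hT' (ε / (‖x‖ * ‖y‖ + 1)) (by positivity)
    refine ⟨N, fun m hm n hn => (hSle m n).trans_lt ?_⟩
    have h := hN m hm n hn
    rw [lt_div_iff₀ (by positivity)] at h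
    have := dist_nonneg (x := T m) (y := T n)
    nlinarith
  obtain ⟨b, hb⟩ := cauchySeq_tendsto_of_complete hcau
  refine ⟨b, fun u uv huv => ?_⟩
  refine tendsto_nhds_unique (((fsToDual G u).continuous.tendsto b).comp hb) ?_
  refine (((fsToDual G uv).continuous.tendsto a).comp hlim).congr fun n => ?_
  rw [Function.comp_apply, Function.comp_apply, fsToDual_integratedForm uv _ _ (hT n),
    fsToDual_integratedForm u _ _ (hS n), huv, hv]
  congr 1
  funext s
  simp only [Pi.mul_apply]
  ring

/-- A function on `G` that is approximated by trigonometric polynomials of bounded norm, uniformly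
on compact sets, lies in their weak*-closure. -/
theorem fsToDual_eq_zero_of_approx [T2Space G] (a : groupCStar G)
    (ha : ∀ t : FourierStieltjes G, IsTrig (t : G → ℂ) → fsToDual G t a = 0)
    (u : FourierStieltjes G) (C : ℝ)
    (h : ∀ (K : Set G) (ε : ℝ), IsCompact K → 0 < ε → ∃ t : FourierStieltjes G,
      IsTrig (t : G → ℂ) ∧ (∀ b, ‖fsToDual G t b‖ ≤ ‖b‖ * C) ∧ (∀ s, ‖(t : G → ℂ) s‖ ≤ C) ∧
        ∀ s ∈ K, ‖(u : G → ℂ) s - (t : G → ℂ) s‖ ≤ ε) :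
    fsToDual G u a = 0 := by
  have hC : 0 ≤ C := by
    obtain ⟨t, -, -, h1, -⟩ := h ∅ 1 isCompact_empty one_pos
    exact (norm_nonneg _).trans (h1 1)
  obtain ⟨M, hM, huM⟩ := FourierStieltjes.exists_bound u
  obtain ⟨τ, α, β, hu⟩ := u.2
  set L := ‖α‖ * ‖β‖ with hL
  have key : ∀ ε : ℝ, 0 < ε → ‖fsToDual G u a‖ ≤ ε * (L + M + 1 + C + C) := by
    intro ε hε
    obtain ⟨f, T, hf, hT, hTa⟩ := exists_integratedForm_near a hε
    obtain ⟨g, hgc, hfg, hgcont, hg⟩ := exists_hasCompactSupport_integral_sub_le hf hε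
    -- The compact set is the support of g, and the tolerance is divided by its L¹-norm; the summand
    -- 1 covers g = 0.
    obtain ⟨t, httrig, htC, htsup, happ⟩ := h (tsupport g) (ε / (∫ s, ‖g s‖ ∂Measure.haar + 1))
      hgc (by positivity)
    have hta := ha t httrig
    have h1 : ‖fsToDual G u (a - T)‖ ≤ ε * L := by
      refine (norm_fsToDual_le u τ α β hu _).trans ?_
      gcongr
    have h5 : ‖fsToDual G t (a - T)‖ ≤ ε * C := by
      refine (htC _).trans ?_
      gcongr
    have hdiff : ∀ (w : G → ℂ) (D : ℝ), 0 ≤ D → Continuous w → (∀ s, ‖w s‖ ≤ D) →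
        ‖∫ s, (f s - g s) * w s ∂Measure.haar‖ ≤ ε * D := by
      intro w D hD hw hwD
      refine (norm_integral_le_integral_norm _).trans ?_
      calc _ ≤ ∫ s, ‖f s - g s‖ * D ∂Measure.haar := by
            refine integral_mono ((hf.sub hg).mul_bdd (c := D) hw.aestronglyMeasurable
              (Filter.Eventually.of_forall hwD)).norm ((hf.sub hg).norm.mul_const D) fun s => ?_
            change ‖(f s - g s) * w s‖ ≤ _
            rw [norm_mul]
            exact mul_le_mul_of_nonneg_left (hwD s) (norm_nonneg _)
        _ ≤ ε * D := by
            rw [integral_mul_const]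
            gcongr
    have h2 := hdiff u M hM (FourierStieltjes.continuous u) huM
    have h4 := hdiff t C hC (FourierStieltjes.continuous t) htsup
    have h3 : ‖∫ s, g s * ((u : G → ℂ) s - (t : G → ℂ) s) ∂Measure.haar‖ ≤ ε := by
      refine (norm_integral_le_integral_norm _).trans ?_
      have hb : ∀ s, ‖g s * ((u : G → ℂ) s - (t : G → ℂ) s)‖ ≤
          ‖g s‖ * (ε / (∫ s, ‖g s‖ ∂Measure.haar + 1)) := by
        intro s
        rw [norm_mul]
        by_cases hs : s ∈ tsupport g
        · exact mul_le_mul_of_nonneg_left (happ s hs) (norm_nonneg _)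
        · rw [image_eq_zero_of_notMem_tsupport hs]
          simp
      have hint : Integrable (fun s => g s * ((u : G → ℂ) s - (t : G → ℂ) s)) Measure.haar := by
        have := (FourierStieltjes.integrable_mul u hg).sub (FourierStieltjes.integrable_mul t hg)
        refine this.congr (Filter.Eventually.of_forall fun s => ?_)
        simp [mul_sub]
      calc _ ≤ ∫ s, ‖g s‖ * (ε / (∫ s, ‖g s‖ ∂Measure.haar + 1)) ∂Measure.haar :=
            integral_mono hint.norm (hg.norm.mul_const _) hb
        _ ≤ ε := by
            have hn : 0 ≤ ∫ s, ‖g s‖ ∂Measure.haar := integral_nonneg fun s => norm_nonneg _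
            rw [integral_mul_const, ← mul_div_assoc, div_le_iff₀ (by positivity)]
            nlinarith
    -- Telescope ⟨u, a⟩ - ⟨t, a⟩, whose second term is zero. Replacing a by T and then f by g costs
    -- little for either function by boundedness; against g the two functions are uniformly close.
    have hsum : fsToDual G u a = fsToDual G u (a - T) +
        ∫ s, (f s - g s) * (u : G → ℂ) s ∂Measure.haar +
        ∫ s, g s * ((u : G → ℂ) s - (t : G → ℂ) s) ∂Measure.haar -
        ∫ s, (f s - g s) * (t : G → ℂ) s ∂Measure.haar - fsToDual G t (a - T) := by
      have e1 : ∫ s, (f s - g s) * (u : G → ℂ) s ∂Measure.haar =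
          fsToDual G u T - ∫ s, g s * (u : G → ℂ) s ∂Measure.haar := by
        rw [fsToDual_integratedForm u f T hT, ← integral_sub (FourierStieltjes.integrable_mul u hf)
          (FourierStieltjes.integrable_mul u hg)]
        simp [sub_mul]
      have e2 : ∫ s, (f s - g s) * (t : G → ℂ) s ∂Measure.haar =
          fsToDual G t T - ∫ s, g s * (t : G → ℂ) s ∂Measure.haar := by
        rw [fsToDual_integratedForm t f T hT, ← integral_sub (FourierStieltjes.integrable_mul t hf)
          (FourierStieltjes.integrable_mul t hg)]
        simp [sub_mul]
      have e3 : ∫ s, g s * ((u : G → ℂ) s - (t : G → ℂ) s) ∂Measure.haar =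
          ∫ s, g s * (u : G → ℂ) s ∂Measure.haar - ∫ s, g s * (t : G → ℂ) s ∂Measure.haar := by
        rw [← integral_sub (FourierStieltjes.integrable_mul u hg) (FourierStieltjes.integrable_mul t hg)]
        simp [mul_sub]
      rw [e1, e2, e3, map_sub, map_sub, hta]
      ring
    rw [hsum]
    refine (norm_sub_le _ _).trans ?_
    have n1 := norm_sub_le (fsToDual G u (a - T) +
        ∫ s, (f s - g s) * (u : G → ℂ) s ∂Measure.haar +
        ∫ s, g s * ((u : G → ℂ) s - (t : G → ℂ) s) ∂Measure.haar)
        (∫ s, (f s - g s) * (t : G → ℂ) s ∂Measure.haar)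
    have n2 := norm_add₃_le (a := fsToDual G u (a - T))
        (b := ∫ s, (f s - g s) * (u : G → ℂ) s ∂Measure.haar)
        (c := ∫ s, g s * ((u : G → ℂ) s - (t : G → ℂ) s) ∂Measure.haar)
    nlinarith
  have hK : 0 ≤ L + M + 1 + C + C := by positivity
  rw [← norm_le_zero_iff]
  refine le_of_forall_pos_le_add fun δ hδ => ?_
  refine (key (δ / (L + M + 1 + C + C + 1)) (by positivity)).trans ?_
  rw [zero_add, div_mul_eq_mul_div, div_le_iff₀ (by positivity)]
  nlinarith

end pairing

/-! ### The direct sum of the finite-dimensional irreducible representations -/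

section finDimSum

variable {G : Type u} [Group G] [TopologicalSpace G]

/-- The restriction of a unitary representation to a complete invariant subspace. -/
noncomputable def UnitaryRep.restrict (σ : UnitaryRep.{u, v} G) (K : Submodule ℂ σ.H)
    [CompleteSpace K] (hK : ∀ s, ∀ ξ ∈ K, σ.toHom s ξ ∈ K) : UnitaryRep.{u, v} G where
  H := K
  toHom :=
    { toFun := fun s =>
        { toFun := fun ξ => ⟨σ.toHom s ξ, hK s ξ ξ.2⟩
          invFun := fun ξ => ⟨σ.toHom s⁻¹ ξ, hK s⁻¹ ξ ξ.2⟩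
          map_add' := fun ξ η => by ext; simp
          map_smul' := fun c ξ => by ext; simp
          left_inv := fun ξ => by
            ext
            change σ.toHom s⁻¹ (σ.toHom s ξ) = ξ
            rw [map_inv]
            exact (σ.toHom s).symm_apply_apply _
          right_inv := fun ξ => by
            ext
            change σ.toHom s (σ.toHom s⁻¹ ξ) = ξ
            rw [map_inv]
            exact (σ.toHom s).apply_symm_apply _
          norm_map' := fun ξ => (σ.toHom s).norm_map ξ }
      map_one' := by
        ext ξ
        change σ.toHom 1 (ξ : σ.H) = ξ
        simp
      map_mul' := fun s t => by
        ext ξ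
        change σ.toHom (s * t) (ξ : σ.H) = σ.toHom s (σ.toHom t ξ)
        simp }
  continuous_toHom := fun ξ => (σ.continuous_toHom ξ).subtype_mk _

theorem UnitaryRep.restrict_coeff (σ : UnitaryRep.{u, v} G) (K : Submodule ℂ σ.H)
    [CompleteSpace K] (hK : ∀ s, ∀ ξ ∈ K, σ.toHom s ξ ∈ K) (ξ η : K) :
    (σ.restrict K hK).coeff ξ η = σ.coeff ξ η := rfl

/-- The adjoint of σ(s) is σ(s⁻¹), which maps K into K. -/
theorem UnitaryRep.orthogonal_invariant (σ : UnitaryRep.{u, v} G) (K : Submodule ℂ σ.H)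
    (hK : ∀ s, ∀ ξ ∈ K, σ.toHom s ξ ∈ K) : ∀ s, ∀ ξ ∈ Kᗮ, σ.toHom s ξ ∈ Kᗮ := by
  intro s ξ hξ
  rw [Submodule.mem_orthogonal] at hξ ⊢
  intro η hη
  have h := hξ _ (hK s⁻¹ η hη)
  rw [← (σ.toHom s).inner_map_map, map_inv] at h
  have h2 : σ.toHom s ((σ.toHom s)⁻¹ η) = η := (σ.toHom s).apply_symm_apply η
  rwa [h2] at h

theorem coeff_mem_span_finDimSum_of_irreducible (σ : UnitaryRep.{u, u} G)
    [hfd : FiniteDimensional ℂ σ.H] (hσ : σ.IsIrreducible) (ξ η : σ.H) :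
    ∃ x y, σ.coeff ξ η = (finDimSum G).coeff x y := by
  let q : UnitaryDual G := Quotient.mk (irrepSetoid G) ⟨σ, hσ⟩
  have hq : q.rep.Equivalent σ := Quotient.mk_out (s := irrepSetoid G) ⟨σ, hσ⟩
  obtain ⟨U, hU⟩ := hq
  have hfq : FiniteDimensional ℂ q.rep.H :=
    LinearEquiv.finiteDimensional U.toLinearEquiv.symm
  let ρ : {q : UnitaryDual G // FiniteDimensional ℂ q.rep.H} → UnitaryRep.{u, u} G :=
    fun q => q.1.rep
  refine ⟨UnitaryRep.dsSingle ρ ⟨q, hfq⟩ (U.symm ξ), UnitaryRep.dsSingle ρ ⟨q, hfq⟩ (U.symm η), ?_⟩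
  refine Eq.trans ?_ (UnitaryRep.coeff_dsSingle_left ρ ⟨q, hfq⟩ (U.symm ξ) _).symm
  rw [UnitaryRep.dsCoord_dsSingle]
  funext s
  change ⟪η, σ.toHom s ξ⟫_ℂ = ⟪U.symm η, q.rep.toHom s (U.symm ξ)⟫_ℂ
  rw [← U.inner_map_map, hU]
  simp

/-- Complete reducibility: every coefficient of a finite-dimensional unitary representation is a
linear combination of coefficients of the direct sum of the irreducible ones. -/
theorem coeff_mem_span_finDimSum (σ : UnitaryRep.{u, u} G) [hfd : FiniteDimensional ℂ σ.H]
    (ξ η : σ.H) :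
    σ.coeff ξ η ∈ Submodule.span ℂ {c | ∃ x y, c = (finDimSum G).coeff x y} := by
  obtain ⟨n, hn⟩ : ∃ n, Module.finrank ℂ σ.H = n := ⟨_, rfl⟩
  induction n using Nat.strong_induction_on generalizing σ with
  | _ n ih =>
    by_cases hirr : σ.IsIrreducible
    · exact Submodule.subset_span (coeff_mem_span_finDimSum_of_irreducible σ hirr ξ η)
    by_cases hnt : Nontrivial σ.H
    swap
    · rw [not_nontrivial_iff_subsingleton] at hnt
      have : σ.coeff ξ η = 0 := by
        funext s
        simp [UnitaryRep.coeff, Subsingleton.elim η 0]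
      rw [this]
      exact Submodule.zero_mem _
    rw [UnitaryRep.IsIrreducible, not_and] at hirr
    have h := hirr hnt
    push Not at h
    obtain ⟨K, -, hK, hbot, htop⟩ := h
    have hK' := σ.orthogonal_invariant K hK
    have h1 : Module.finrank ℂ K < n := hn ▸ Submodule.finrank_lt htop
    have h2 : Module.finrank ℂ Kᗮ < n := by
      refine hn ▸ Submodule.finrank_lt fun h => hbot ?_
      rwa [Submodule.orthogonal_eq_top_iff] at h
    -- Split both vectors along K and its orthogonal complement. Both parts have smaller dimension,
    -- and the mixed coefficients vanish (`z1`, `z2`) by invariance.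
    have e1 := ih _ h1 (σ.restrict K hK) (hfd := inferInstanceAs (FiniteDimensional ℂ K))
      (K.orthogonalProjectionOnto ξ) (K.orthogonalProjectionOnto η) rfl
    have e2 := ih _ h2 (σ.restrict Kᗮ hK') (hfd := inferInstanceAs (FiniteDimensional ℂ Kᗮ))
      (Kᗮ.orthogonalProjectionOnto ξ) (Kᗮ.orthogonalProjectionOnto η) rfl
    refine (congrArg (· ∈ _) ?_).mp (Submodule.add_mem _ e1 e2)
    rw [UnitaryRep.restrict_coeff, UnitaryRep.restrict_coeff]
    funext s
    have hξ : (K.orthogonalProjectionOnto ξ : σ.H) + Kᗮ.orthogonalProjectionOnto ξ = ξ :=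
      K.starProjection_add_starProjection_orthogonal ξ
    have hη : (K.orthogonalProjectionOnto η : σ.H) + Kᗮ.orthogonalProjectionOnto η = η :=
      K.starProjection_add_starProjection_orthogonal η
    have z1 : ⟪(K.orthogonalProjectionOnto η : σ.H),
        σ.toHom s (Kᗮ.orthogonalProjectionOnto ξ)⟫_ℂ = 0 :=
      (Submodule.mem_orthogonal K _).1 (hK' s _ (Kᗮ.orthogonalProjectionOnto ξ).2) _
        (K.orthogonalProjectionOnto η).2
    have z2 : ⟪(Kᗮ.orthogonalProjectionOnto η : σ.H),
        σ.toHom s (K.orthogonalProjectionOnto ξ)⟫_ℂ = 0 :=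
      (Submodule.mem_orthogonal' K _).1 (Kᗮ.orthogonalProjectionOnto η).2 _
        (hK s _ (K.orthogonalProjectionOnto ξ).2)
    conv_rhs => rw [← hξ, ← hη]
    simp only [UnitaryRep.coeff, Pi.add_apply, map_add, inner_add_left, inner_add_right, z1, z2]
    ring

variable [IsTopologicalGroup G] [LocallyCompactSpace G] [MeasurableSpace G] [BorelSpace G]

theorem IsTrig.mem_span_finDimSum {f : G → ℂ} (hf : IsTrig f) :
    f ∈ Submodule.span ℂ {c | ∃ x y, c = (finDimSum G).coeff x y} := by
  obtain ⟨n, κ, v, w, hκ, rfl⟩ := hf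
  rw [← UnitaryRep.ofMatrix_coeff hκ v w]
  exact coeff_mem_span_finDimSum _ _ _

theorem isTrig_sum {ι : Type*} {f : ι → G → ℂ} (hf : ∀ i, IsTrig (f i)) (F : Finset ι) :
    IsTrig (∑ i ∈ F, f i) :=
  mem_trigAlgebra.1 (Subalgebra.sum_mem _ fun i _ => mem_trigAlgebra.2 (hf i))

/-- A coefficient of a direct sum of finite-dimensional representations is a uniform limit of
trigonometric polynomials of bounded norm. -/
theorem exists_trig_near_directSum_coeff {ι : Type w} (σ : ι → UnitaryRep.{u, u} G)
    (hσ : ∀ i, FiniteDimensional ℂ (σ i).H) (x y : (UnitaryRep.directSum σ).H) {ε : ℝ}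
    (hε : 0 < ε) :
    ∃ t : FourierStieltjes G, IsTrig (t : G → ℂ) ∧
      (∀ b, ‖fsToDual G t b‖ ≤ ‖b‖ * (‖x‖ * ‖y‖)) ∧ (∀ s, ‖(t : G → ℂ) s‖ ≤ ‖x‖ * ‖y‖) ∧
        ∀ s, ‖(UnitaryRep.directSum σ).coeff x y s - (t : G → ℂ) s‖ ≤ ε := by
  have hs := UnitaryRep.hasSum_dsSingle σ x
  -- Only x has to be truncated: the discarded tail is paired with the whole of y.
  obtain ⟨F, hF⟩ := (Metric.tendsto_nhds.1 hs (ε / (‖y‖ + 1)) (by positivity)).exists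
  rw [dist_eq_norm] at hF
  let t : ι → FourierStieltjes G := fun i =>
    ⟨(σ i).coeff (UnitaryRep.dsCoord σ x i) (UnitaryRep.dsCoord σ y i), σ i, _, _, rfl⟩
  -- Makes the norm bound on the truncation independent of F, hence of ε.
  have hCS : ∑ i ∈ F, ‖UnitaryRep.dsCoord σ x i‖ * ‖UnitaryRep.dsCoord σ y i‖ ≤ ‖x‖ * ‖y‖ :=
    (Real.sum_mul_le_sqrt_mul_sqrt F _ _).trans (mul_le_mul
      (Real.sqrt_le_iff.2 ⟨norm_nonneg _, UnitaryRep.sum_sq_dsCoord_le σ F x⟩)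
      (Real.sqrt_le_iff.2 ⟨norm_nonneg _, UnitaryRep.sum_sq_dsCoord_le σ F y⟩)
      (Real.sqrt_nonneg _) (norm_nonneg _))
  have hcoe : ((∑ i ∈ F, t i : FourierStieltjes G) : G → ℂ) =
      ∑ i ∈ F, (σ i).coeff (UnitaryRep.dsCoord σ x i) (UnitaryRep.dsCoord σ y i) := by
    simp [t]
  refine ⟨∑ i ∈ F, t i, ?_, fun b => ?_, fun s => ?_, fun s => ?_⟩
  · rw [hcoe]
    exact isTrig_sum (fun i => (σ i).isTrig_coeff _ _) F
  · rw [map_sum, sum_apply]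
    refine (norm_sum_le _ _).trans ((Finset.sum_le_sum fun i _ =>
      norm_fsToDual_le (t i) (σ i) _ _ rfl b).trans ?_)
    rw [← Finset.mul_sum]
    gcongr
  · rw [hcoe, Finset.sum_apply]
    exact (norm_sum_le _ _).trans ((Finset.sum_le_sum fun i _ =>
      (σ i).norm_coeff_le _ _ s).trans hCS)
  · have h1 : ((∑ i ∈ F, t i : FourierStieltjes G) : G → ℂ) s =
        (UnitaryRep.directSum σ).coeff
          (∑ i ∈ F, UnitaryRep.dsSingle σ i (UnitaryRep.dsCoord σ x i)) y s := by
      rw [hcoe, Finset.sum_apply]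
      simp only [UnitaryRep.coeff, map_sum, inner_sum]
      exact Finset.sum_congr rfl fun i _ =>
        (congrFun (UnitaryRep.coeff_dsSingle_left σ i (UnitaryRep.dsCoord σ x i) y) s).symm
    rw [h1]
    have h2 : (UnitaryRep.directSum σ).coeff x y s - (UnitaryRep.directSum σ).coeff
          (∑ i ∈ F, UnitaryRep.dsSingle σ i (UnitaryRep.dsCoord σ x i)) y s =
        (UnitaryRep.directSum σ).coeff
          (x - ∑ i ∈ F, UnitaryRep.dsSingle σ i (UnitaryRep.dsCoord σ x i)) y s := by
      simp only [UnitaryRep.coeff, map_sub, inner_sub_right]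
    rw [h2]
    refine (UnitaryRep.norm_coeff_le _ _ _ s).trans ?_
    rw [norm_sub_rev]
    have h3 := hF.le
    rw [le_div_iff₀ (by positivity)] at h3
    refine le_trans ?_ h3
    gcongr
    linarith

/-- `finDimSum` is an infinite sum, so its coefficients need not be trigonometric polynomials. They
are bounded uniform limits of such, a property that linear combinations keep, and
`fsToDual_eq_zero_of_approx` applies. -/
theorem fsToDual_eq_zero_of_mem_span_finDimSum [T2Space G] (a : groupCStar G)
    (ha : ∀ t : FourierStieltjes G, IsTrig (t : G → ℂ) → fsToDual G t a = 0)
    (u : FourierStieltjes G)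
    (hu : (u : G → ℂ) ∈ Submodule.span ℂ {c | ∃ x y, c = (finDimSum G).coeff x y}) :
    fsToDual G u a = 0 := by
  have key : ∀ f ∈ Submodule.span ℂ {c | ∃ x y, c = (finDimSum G).coeff x y},
      ∃ C : ℝ, 0 ≤ C ∧ ∀ ε : ℝ, 0 < ε → ∃ t : FourierStieltjes G, IsTrig (t : G → ℂ) ∧
        (∀ b, ‖fsToDual G t b‖ ≤ ‖b‖ * C) ∧ (∀ s, ‖(t : G → ℂ) s‖ ≤ C) ∧
          ∀ s, ‖f s - (t : G → ℂ) s‖ ≤ ε := by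
    intro f hf
    induction hf using Submodule.span_induction with
    | mem f hf =>
      obtain ⟨x, y, rfl⟩ := hf
      exact ⟨‖x‖ * ‖y‖, by positivity, fun ε hε =>
        exists_trig_near_directSum_coeff (fun q : {q : UnitaryDual G //
          FiniteDimensional ℂ q.rep.H} => q.1.rep) (fun q => q.2) x y hε⟩
    | zero =>
      refine ⟨0, le_rfl, fun ε hε => ⟨0, ?_, by simp, by simp, by simp [hε.le]⟩⟩
      exact mem_trigAlgebra.1 (Subalgebra.zero_mem _)
    | add f g _ _ hf hg =>
      obtain ⟨C, hC, hf⟩ := hf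
      obtain ⟨D, hD, hg⟩ := hg
      refine ⟨C + D, by positivity, fun ε hε => ?_⟩
      obtain ⟨t, ht, ht1, ht2, ht3⟩ := hf (ε / 2) (by positivity)
      obtain ⟨r, hr, hr1, hr2, hr3⟩ := hg (ε / 2) (by positivity)
      refine ⟨t + r, ht.add hr, fun b => ?_, fun s => ?_, fun s => ?_⟩
      · rw [map_add, add_apply, mul_add]
        exact (norm_add_le _ _).trans (add_le_add (ht1 b) (hr1 b))
      · exact (norm_add_le _ _).trans (add_le_add (ht2 s) (hr2 s))
      · have h : (f + g) s - ((t + r : FourierStieltjes G) : G → ℂ) s =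
            (f s - (t : G → ℂ) s) + (g s - (r : G → ℂ) s) := by
          simp only [Pi.add_apply, Submodule.coe_add]
          ring
        rw [h]
        refine (norm_add_le _ _).trans ?_
        linarith [ht3 s, hr3 s]
    | smul c f _ hf =>
      obtain ⟨C, hC, hf⟩ := hf
      refine ⟨‖c‖ * C, by positivity, fun ε hε => ?_⟩
      obtain ⟨t, ht, ht1, ht2, ht3⟩ := hf (ε / (‖c‖ + 1)) (by positivity)
      refine ⟨c • t, ht.smul c, fun b => ?_, fun s => ?_, fun s => ?_⟩
      · rw [map_smul, smul_apply, norm_smul, mul_left_comm]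
        gcongr
        exact ht1 b
      · rw [Submodule.coe_smul, Pi.smul_apply, norm_smul]
        gcongr
        exact ht2 s
      · rw [Submodule.coe_smul, Pi.smul_apply, Pi.smul_apply, ← smul_sub, norm_smul]
        have h3 := ht3 s
        rw [le_div_iff₀ (by positivity)] at h3
        nlinarith [norm_nonneg (f s - (t : G → ℂ) s)]
  obtain ⟨C, -, hC⟩ := key u hu
  refine fsToDual_eq_zero_of_approx a ha u C fun K ε _ hε => ?_
  obtain ⟨t, h1, h2, h3, h4⟩ := hC ε hε
  exact ⟨t, h1, h2, h3, fun s _ => h4 s⟩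

/-- The weak*-closure of the trigonometric polynomials. -/
theorem mem_fourierStieltjesSpace_finDimSum [T2Space G] (u : FourierStieltjes G) :
    u ∈ fourierStieltjesSpace (finDimSum G) ↔ ∀ a : groupCStar G,
      (∀ t : FourierStieltjes G, IsTrig (t : G → ℂ) → fsToDual G t a = 0) →
        fsToDual G u a = 0 := by
  let S : Submodule ℂ (FourierStieltjes G) :=
    (Submodule.span ℂ {c | ∃ x y, c = (finDimSum G).coeff x y}).comap (FourierStieltjes G).subtype
  have h := mem_closure_weakStar_iff (fsToDual G) S u
  refine Iff.trans h (forall_congr' fun a => ?_)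
  refine ⟨fun h ha => h fun t ht => ?_, fun h ha => h fun t ht => ha t ?_⟩
  · exact fsToDual_eq_zero_of_mem_span_finDimSum a ha t ht
  · exact ht.mem_span_finDimSum

end finDimSum

/-! ### Concentration of trigonometric polynomials -/

/-- The powers of a function with values in `[0, 1]` concentrate where the function is large. -/
theorem exists_pow_concentrated {X : Type*} [MeasurableSpace X] (μ : Measure X) [IsFiniteMeasure μ]
    {φ : X → ℝ} (hm : Measurable φ) (h0 : ∀ x, 0 ≤ φ x) (h1 : ∀ x, φ x ≤ 1) {r r' : ℝ}
    (hr0 : 0 ≤ r) (hr : r < r') (hpos : 0 < μ {x | r' < φ x}) {A : Set X} (hA : MeasurableSet A)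
    (hAr : ∀ x ∈ A, φ x ≤ r) {ε : ℝ} (hε : 0 < ε) :
    ∃ n : ℕ, 0 < ∫ x, φ x ^ n ∂μ ∧ ∫ x in A, φ x ^ n ∂μ ≤ ε * ∫ x, φ x ^ n ∂μ := by
  set V := {x | r' < φ x} with hVdef
  have hV : MeasurableSet V := measurableSet_lt measurable_const hm
  have hr' : 0 < r' := hr0.trans_lt hr
  have hint : ∀ n, Integrable (fun x => φ x ^ n) μ := fun n =>
    Integrable.of_bound (hm.pow_const n).aestronglyMeasurable 1 (Filter.Eventually.of_forall
      fun x => by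
        rw [Real.norm_of_nonneg (pow_nonneg (h0 x) n)]
        exact pow_le_one₀ (h0 x) (h1 x))
  have hmV : 0 < μ.real V := ENNReal.toReal_pos hpos.ne' (measure_ne_top _ _)
  have hlow : ∀ n, r' ^ n * μ.real V ≤ ∫ x, φ x ^ n ∂μ := by
    intro n
    calc r' ^ n * μ.real V = ∫ x in V, r' ^ n ∂μ := by rw [setIntegral_const, smul_eq_mul, mul_comm]
      _ ≤ ∫ x in V, φ x ^ n ∂μ := by
          refine setIntegral_mono_on (integrable_const _).integrableOn (hint n).integrableOn hV
            fun x hx => pow_le_pow_left₀ hr'.le (le_of_lt hx) n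
      _ ≤ _ := setIntegral_le_integral (hint n)
          (Filter.Eventually.of_forall fun x => pow_nonneg (h0 x) n)
  have hup : ∀ n, ∫ x in A, φ x ^ n ∂μ ≤ r ^ n * μ.real A := by
    intro n
    calc ∫ x in A, φ x ^ n ∂μ ≤ ∫ x in A, r ^ n ∂μ := by
          refine setIntegral_mono_on (hint n).integrableOn (integrable_const _).integrableOn hA
            fun x hx => pow_le_pow_left₀ (h0 x) (hAr x hx) n
      _ = r ^ n * μ.real A := by rw [setIntegral_const, smul_eq_mul, mul_comm]
  -- On A the n-th power has mass of order at most rⁿ, while the total mass is at least of order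
  -- r'ⁿ.
  have hlim : Filter.Tendsto (fun n : ℕ => (r / r') ^ n * μ.real A) Filter.atTop (𝓝 0) := by
    have := (tendsto_pow_atTop_nhds_zero_of_lt_one (div_nonneg hr0 hr'.le)
      ((div_lt_one hr').2 hr)).mul_const (μ.real A)
    rwa [zero_mul] at this
  obtain ⟨n, hn⟩ := (hlim.eventually (gt_mem_nhds (mul_pos hε hmV))).exists
  refine ⟨n, (by positivity : 0 < r' ^ n * μ.real V).trans_le (hlow n), (hup n).trans ?_⟩
  rw [div_pow, div_mul_eq_mul_div, div_lt_iff₀ (by positivity)] at hn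
  have := mul_le_mul_of_nonneg_left (hlow n) hε.le
  linarith

/-! ### Approximation of the Fourier algebra by trigonometric polynomials. -/

section approximation

variable {G : Type u} [Group G] [TopologicalSpace G] [IsTopologicalGroup G]

open scoped Pointwise in
-- Uniform continuity for right translations. If z stays in a compact neighbourhood V of 1, both
-- values vanish unless w lies in the compact set supp(g)·V⁻¹, where the tube lemma applies.
theorem exists_nhds_one_norm_sub_le [LocallyCompactSpace G] {g : G → ℂ} (hg : Continuous g)
    (hgc : HasCompactSupport g) {ε : ℝ} (hε : 0 < ε) :
    ∃ N ∈ 𝓝 (1 : G), ∀ z ∈ N, ∀ w, ‖g (w * z) - g w‖ ≤ ε := by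
  obtain ⟨V, hVc, hV⟩ := exists_compact_mem_nhds (1 : G)
  have hK : IsCompact (tsupport g * V⁻¹) := IsCompact.mul hgc hVc.inv
  have h := hK.eventually_forall_of_forall_eventually (x₀ := (1 : G))
    (P := fun z w => ‖g (w * z) - g w‖ ≤ ε) fun w _ => by
      have hc : Continuous fun p : G × G => ‖g (p.2 * p.1) - g p.2‖ := by fun_prop
      have := hc.tendsto (1, w)
      simp only [mul_one, sub_self, norm_zero] at this
      exact (this.eventually (gt_mem_nhds hε)).mono fun _ h => le_of_lt h
  refine ⟨V ∩ {z | ∀ w ∈ tsupport g * V⁻¹, ‖g (w * z) - g w‖ ≤ ε}, Filter.inter_mem hV h, ?_⟩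
  rintro z ⟨hzV, hz⟩ w
  by_cases hw : w ∈ tsupport g * V⁻¹
  · exact hz w hw
  · have h1 : g (w * z) = 0 := by
      by_contra hne
      exact hw ⟨w * z, subset_tsupport g hne, z⁻¹, Set.inv_mem_inv.2 hzV, by simp⟩
    have h2 : g w = 0 := by
      by_contra hne
      exact hw ⟨w, subset_tsupport g hne, 1, by simpa using mem_of_mem_nhds hV, by simp⟩
    simp [h1, h2, hε.le]

/-- On a maximally almost periodic group, there are positive definite trigonometric polynomials
with values in `[0, 1]` that peak at the identity, relative to a compact set. -/
theorem exists_peak_function (hG : IsMaximallyAlmostPeriodic G) {A : Set G} (hA : IsCompact A)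
    (h1A : 1 ∉ A) :
    ∃ (φ : G → ℝ) (r : ℝ), Continuous φ ∧ (∀ s, 0 ≤ φ s) ∧ (∀ s, φ s ≤ 1) ∧ φ 1 = 1 ∧
      (∀ n : ℕ, IsPosTrig fun s => ((φ s ^ n : ℝ) : ℂ)) ∧ 0 ≤ r ∧ r < 1 ∧ ∀ s ∈ A, φ s ≤ r := by
  classical
  -- Each s ≠ 1 is moved by some finite-dimensional representation, whose normalised real trace is
  -- then below 1 near s. Finitely many such neighbourhoods cover A, and the product of the
  -- corresponding functions is below 1 on all of A.
  have hsep : ∀ s : A, ∃ (n : ℕ) (κ : G →* Matrix.unitaryGroup (Fin n) ℂ),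
      Continuous κ ∧ peak (κ s) < 1 := by
    rintro ⟨s, hs⟩
    obtain ⟨σ, hfd, hne⟩ := hG s 1 (fun h => h1A (h ▸ hs))
    obtain ⟨n, κ, b, hκ, hb⟩ := σ.exists_matrix
    refine ⟨n, κ, hκ, peak_lt_one fun h => hne ?_⟩
    rw [map_one]
    have hlin : ((σ.toHom s).toLinearEquiv : σ.H →ₗ[ℂ] σ.H) = LinearMap.id := by
      refine b.toBasis.ext fun j => b.repr.injective ?_
      ext i
      rw [b.repr_apply_apply, b.repr_apply_apply, b.coe_toBasis]
      change σ.coeff (b j) (b i) s = ⟪b i, b j⟫_ℂ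
      rw [← hb, h, orthonormal_iff_ite.1 b.orthonormal]
      simp [Matrix.one_apply]
    ext1 ξ
    exact LinearMap.congr_fun hlin ξ
  choose n κ hκ hpk using hsep
  obtain ⟨F, hF⟩ := hA.elim_finite_subcover (fun s : A => {t | peak (κ s t) < 1})
    (fun s => isOpen_lt (continuous_peak.comp (hκ s)) continuous_const)
    (fun s hs => Set.mem_iUnion.2 ⟨⟨s, hs⟩, hpk ⟨s, hs⟩⟩)
  let φ : G → ℝ := fun t => ∏ s ∈ F, peak (κ s t)
  have hφc : Continuous φ := continuous_finsetProd _ fun s _ => continuous_peak.comp (hκ s)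
  have hφ0 : ∀ t, 0 ≤ φ t := fun t => Finset.prod_nonneg fun s _ => peak_nonneg _
  have hφ1 : ∀ t, φ t ≤ 1 := fun t => Finset.prod_le_one (fun s _ => peak_nonneg _)
    fun s _ => peak_le_one _
  have hlt : ∀ t ∈ A, φ t < 1 := by
    intro t ht
    obtain ⟨s, hs, hst⟩ := Set.mem_iUnion₂.1 (hF ht)
    calc φ t ≤ peak (κ s t) := by
          change ∏ s ∈ F, peak (κ s t) ≤ _
          rw [← Finset.mul_prod_erase F _ hs]
          exact mul_le_of_le_one_right (peak_nonneg _)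
            (Finset.prod_le_one (fun s _ => peak_nonneg _) fun s _ => peak_le_one _)
      _ < 1 := hst
  have hr : ∃ r : ℝ, 0 ≤ r ∧ r < 1 ∧ ∀ s ∈ A, φ s ≤ r := by
    rcases A.eq_empty_or_nonempty with rfl | hne
    · exact ⟨0, le_rfl, one_pos, by simp⟩
    · obtain ⟨s, hs, hmax⟩ := hA.exists_isMaxOn hne hφc.continuousOn
      exact ⟨φ s, hφ0 s, hlt s hs, fun t ht => hmax ht⟩
  obtain ⟨r, hr0, hr1, hrA⟩ := hr
  refine ⟨φ, r, hφc, hφ0, hφ1, by simp [φ, peak_one], fun k => ?_, hr0, hr1, hrA⟩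
  have h := (IsPosTrig.finsetProd F fun s _ => isPosTrig_peak (hκ s)).pow k
  convert h using 1
  funext t
  simp [φ]

variable [LocallyCompactSpace G] [MeasurableSpace G] [BorelSpace G]

/-- A concentrated weight is an approximate identity for convolution with a function of compact
support. -/
theorem norm_integral_mul_weight_sub_le [T2Space G] {g : G → ℂ} (hg : Continuous g) {M : ℝ}
    (hM : ∀ w, ‖g w‖ ≤ M) {ψ : G → ℝ} (hψ : Continuous ψ) (hψ0 : ∀ z, 0 ≤ ψ z) {C N : Set G}
    (hC : IsCompact C) (hN : MeasurableSet N) {δ : ℝ} (hδ : 0 ≤ δ)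
    (hgN : ∀ z ∈ N, ∀ w, ‖g (w * z) - g w‖ ≤ δ)
    (hconc : ∫ z in C \ N, ψ z ∂Measure.haar ≤ δ * ∫ z in C, ψ z ∂Measure.haar) {w : G}
    (hw : ∀ z ∉ C, g (w * z) = 0) :
    ‖∫ z, g (w * z) * ψ z ∂Measure.haar - g w * ∫ z in C, ψ z ∂Measure.haar‖ ≤
      (δ + 2 * M * δ) * ∫ z in C, ψ z ∂Measure.haar := by
  have hM0 : 0 ≤ M := (norm_nonneg _).trans (hM 1)
  have hψi : IntegrableOn ψ C Measure.haar := hψ.continuousOn.integrableOn_compact hC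
  have hψi' : IntegrableOn (fun z => (ψ z : ℂ)) C Measure.haar := hψi.ofReal
  have hgi : IntegrableOn (fun z => g (w * z) * ψ z) C Measure.haar :=
    (by fun_prop : Continuous fun z => g (w * z) * ψ z).continuousOn.integrableOn_compact hC
  have h1 : ∫ z, g (w * z) * ψ z ∂Measure.haar = ∫ z in C, g (w * z) * ψ z ∂Measure.haar :=
    (setIntegral_eq_integral_of_forall_compl_eq_zero fun z hz => by rw [hw z hz, zero_mul]).symm
  have h2 : g w * ∫ z in C, ψ z ∂Measure.haar = ∫ z in C, g w * ψ z ∂Measure.haar := by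
    rw [integral_const_mul, integral_complex_ofReal]
  rw [h1, h2, ← integral_sub hgi (hψi'.const_mul (g w))]
  -- On N the oscillation of g is at most δ; off N it is at most 2M, but there the weight has little
  -- mass.
  have hb : ∀ z, ‖g (w * z) * ψ z - g w * ψ z‖ ≤
      δ * ψ z + Nᶜ.indicator (fun z => 2 * M * ψ z) z := by
    intro z
    rw [← sub_mul, norm_mul, Complex.norm_real, Real.norm_of_nonneg (hψ0 z)]
    by_cases hz : z ∈ N
    · rw [Set.indicator_of_notMem (by simpa using hz), add_zero]
      exact mul_le_mul_of_nonneg_right (hgN z hz w) (hψ0 z)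
    · rw [Set.indicator_of_mem (by simpa using hz), ← add_mul]
      refine mul_le_mul_of_nonneg_right ?_ (hψ0 z)
      refine (norm_sub_le _ _).trans ?_
      linarith [hM w, hM (w * z)]
  have hind : IntegrableOn (Nᶜ.indicator fun z => 2 * M * ψ z) C Measure.haar :=
    (hψi.const_mul (2 * M)).indicator hN.compl
  refine (norm_integral_le_of_norm_le ((hψi.const_mul δ).add hind)
    (Filter.Eventually.of_forall hb)).trans ?_
  simp only [Pi.add_apply]
  rw [integral_add (hψi.const_mul δ) hind, setIntegral_indicator hN.compl, ← Set.sdiff_eq,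
    integral_const_mul, integral_const_mul, add_mul]
  have := mul_le_mul_of_nonneg_left hconc (by positivity : 0 ≤ 2 * M)
  linarith

/-- `∫ g(x) ρ(x)v dx` -/
noncomputable def UnitaryRep.smear (ρ : UnitaryRep.{u, v} G) (g : G → ℂ) (v : ρ.H) : ρ.H :=
  ∫ x, g x • ρ.toHom x v ∂Measure.haar

theorem UnitaryRep.toHom_smear (ρ : UnitaryRep.{u, v} G) (g : G → ℂ) (v : ρ.H) (y : G) :
    ρ.toHom y (ρ.smear g v) = ρ.smear (fun x => g (y⁻¹ * x)) v := by
  unfold UnitaryRep.smear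
  have h := (ρ.toHom y).toContinuousLinearEquiv.integral_comp_comm (μ := Measure.haar)
    (fun x => g x • ρ.toHom x v)
  refine h.symm.trans ?_
  rw [← integral_mul_left_eq_self (fun x => g (y⁻¹ * x) • ρ.toHom x v) y]
  congr 1
  funext x
  simp

theorem UnitaryRep.integrable_smear (ρ : UnitaryRep.{u, v} G) {g : G → ℂ} (hg : Continuous g)
    (hgc : HasCompactSupport g) (v : ρ.H) :
    Integrable (fun x => g x • ρ.toHom x v) Measure.haar :=
  (hg.smul (ρ.continuous_toHom v)).integrable_of_hasCompactSupport hgc.smul_right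

theorem UnitaryRep.inner_toHom_smear (ρ : UnitaryRep.{u, v} G) {g : G → ℂ} (hg : Continuous g)
    (hgc : HasCompactSupport g) (v : ρ.H) (s y : G) :
    ⟪ρ.toHom y v, ρ.toHom s (ρ.smear g v)⟫_ℂ =
      ∫ z, g (s⁻¹ * y * z) * ρ.coeff v v z ∂Measure.haar := by
  have htrans : ∀ y, Continuous (fun x => g (y * x)) ∧ HasCompactSupport (fun x => g (y * x)) :=
    fun y => ⟨by fun_prop, hgc.comp_homeomorph (Homeomorph.mulLeft y)⟩
  have h2 : ρ.toHom s (ρ.smear g v) = ρ.toHom y (ρ.toHom (y⁻¹ * s) (ρ.smear g v)) := by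
    conv_lhs => rw [← mul_inv_cancel_left y s, map_mul]
    rfl
  rw [h2, (ρ.toHom y).inner_map_map, ρ.toHom_smear]
  unfold UnitaryRep.smear
  rw [← integral_inner (ρ.integrable_smear (htrans _).1 (htrans _).2 v)]
  congr 1
  funext z
  rw [inner_smul_right]
  simp [UnitaryRep.coeff]

theorem UnitaryRep.integrable_inner_smear (ρ : UnitaryRep.{u, v} G) {g h : G → ℂ}
    (hg : Continuous g) (hgc : HasCompactSupport g) (hh : Continuous h)
    (hhc : HasCompactSupport h) (v : ρ.H) (s : G) :
    Integrable (fun y => star (h y) * ∫ z, g (s⁻¹ * y * z) * ρ.coeff v v z ∂Measure.haar)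
      Measure.haar := by
  simp only [← ρ.inner_toHom_smear hg hgc v s]
  refine Continuous.integrable_of_hasCompactSupport
    (hh.star.mul ((ρ.continuous_toHom v).inner continuous_const)) ?_
  exact (hhc.comp_left (g := star) (star_zero ℂ)).mul_right

/-- The representation enters the right side only through the diagonal coefficient of v. If that
coefficient is an approximate identity, the inner integral tends to g(s⁻¹y), and the whole becomes a
coefficient of the regular representation. -/
theorem UnitaryRep.coeff_smear (ρ : UnitaryRep.{u, v} G) {g h : G → ℂ} (hg : Continuous g)
    (hgc : HasCompactSupport g) (hh : Continuous h) (hhc : HasCompactSupport h) (v : ρ.H) (s : G) :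
    ρ.coeff (ρ.smear g v) (ρ.smear h v) s =
      ∫ y, star (h y) * ∫ z, g (s⁻¹ * y * z) * ρ.coeff v v z ∂Measure.haar ∂Measure.haar := by
  simp only [← ρ.inner_toHom_smear hg hgc v s]
  unfold UnitaryRep.coeff
  rw [← inner_conj_symm]
  conv_lhs => rw [show ρ.smear h v = ∫ x, h x • ρ.toHom x v ∂Measure.haar from rfl]
  rw [← integral_inner (ρ.integrable_smear hh hhc v), ← integral_conj]
  congr 1
  funext y
  rw [inner_conj_symm, inner_smul_left]
  rfl

open scoped Pointwise in
/-- The coefficients of the regular representation at functions of compact support are limits of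
trigonometric polynomials of bounded norm. -/
theorem fsToDual_eq_zero_of_compactSupport [T2Space G] (hG : IsMaximallyAlmostPeriodic G)
    (a : groupCStar G)
    (ha : ∀ t : FourierStieltjes G, IsTrig (t : G → ℂ) → fsToDual G t a = 0)
    {g h : G → ℂ} (hg : Continuous g) (hgc : HasCompactSupport g) (hh : Continuous h)
    (hhc : HasCompactSupport h) (u : FourierStieltjes G)
    (hu : ∀ s, (u : G → ℂ) s = ∫ y, star (h y) * g (s⁻¹ * y) ∂Measure.haar) :
    fsToDual G u a = 0 := by
  set Ig := ‖∫ y, star (g y) * g (1⁻¹ * y) ∂Measure.haar‖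
  set Ih := ‖∫ y, star (h y) * h (1⁻¹ * y) ∂Measure.haar‖
  -- `Ig` and `Ih` are the squared L²-norms of g and h. The normalised squared norms of the smeared
  -- vectors exceed them by at most 1.
  refine fsToDual_eq_zero_of_approx a ha u ((Ig + 1) + (Ih + 1)) fun K ε hK hε => ?_
  obtain ⟨Mg, hMg⟩ := hgc.exists_bound_of_continuous hg
  obtain ⟨Mh, hMh⟩ := hhc.exists_bound_of_continuous hh
  set M := max Mg Mh
  have hM0 : 0 ≤ M := ((norm_nonneg _).trans (hMg 1)).trans (le_max_left _ _)
  set L := tsupport g ∪ tsupport h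
  have hL : IsCompact L := hgc.union hhc
  set J := ∫ y, ‖g y‖ ∂Measure.haar + ∫ y, ‖h y‖ ∂Measure.haar + 1
  have hJg0 : 0 ≤ ∫ y, ‖g y‖ ∂Measure.haar := integral_nonneg fun _ => norm_nonneg _
  have hJh0 : 0 ≤ ∫ y, ‖h y‖ ∂Measure.haar := integral_nonneg fun _ => norm_nonneg _
  have hJ : 0 < J := by positivity
  -- The bound by 1 serves the norm estimate, the bound by ε the approximation.
  set e := min 1 ε
  have he : 0 < e := lt_min one_pos hε
  -- Solves J(δ + 2Mδ) = e, the total error of `key`.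
  set δ := e / ((1 + 2 * M) * J) with hδdef
  have hδ : 0 < δ := by positivity
  obtain ⟨N1, hN1, hgN1⟩ := exists_nhds_one_norm_sub_le hg hgc hδ
  obtain ⟨N2, hN2, hhN2⟩ := exists_nhds_one_norm_sub_le hh hhc hδ
  set N := interior (N1 ∩ N2)
  have hNo : IsOpen N := isOpen_interior
  have h1N : (1 : G) ∈ N := mem_interior_iff_mem_nhds.2 (Filter.inter_mem hN1 hN2)
  obtain ⟨V, hVc, hV⟩ := exists_compact_mem_nhds (1 : G)
  -- The identity is adjoined because the norms of the smeared vectors are read off at s = 1.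
  set S := insert 1 K
  have hS : IsCompact S := hK.insert 1
  -- For y in L and s in S, p(s⁻¹yz) ≠ 0 forces z into y⁻¹sL, so the weight matters only on C and
  -- the peak function need not be controlled elsewhere. The neighbourhood V gives C positive mass
  -- near 1.
  set C := L⁻¹ * S * L ∪ V
  have hC : IsCompact C := ((hL.inv.mul hS).mul hL).union hVc
  obtain ⟨φ, r, hφc, hφ0, hφ1, hφ11, hφt, hr0, hr1, hrA⟩ :=
    exists_peak_function hG (hC.diff hNo) (fun h => h.2 h1N)
  have : IsFiniteMeasure ((Measure.haar : Measure G).restrict C) :=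
    ⟨by rw [Measure.restrict_apply_univ]; exact hC.measure_lt_top⟩
  -- Any level strictly between r and φ(1) = 1 would do.
  have hpos : 0 < (Measure.haar : Measure G).restrict C {x | (1 + r) / 2 < φ x} := by
    have hnhds : {x | (1 + r) / 2 < φ x} ∩ V ∈ 𝓝 (1 : G) := by
      refine Filter.inter_mem ((isOpen_lt continuous_const hφc).mem_nhds ?_) hV
      rw [Set.mem_ofPred_eq, hφ11]
      linarith
    rw [Measure.restrict_apply' hC.measurableSet]
    exact (Measure.measure_pos_of_mem_nhds _ hnhds).trans_le
      (measure_mono (Set.inter_subset_inter_right _ Set.subset_union_right))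
  obtain ⟨k, hIpos, hconc⟩ := exists_pow_concentrated ((Measure.haar : Measure G).restrict C)
    hφc.measurable hφ0 hφ1 hr0 (by linarith : r < (1 + r) / 2) hpos
    (hC.diff hNo).measurableSet hrA hδ
  rw [Measure.restrict_restrict (hC.diff hNo).measurableSet,
    Set.inter_eq_left.2 Set.sdiff_subset] at hconc
  set I := ∫ x in C, φ x ^ k ∂Measure.haar
  obtain ⟨n, κ, v, hκ, hκv⟩ := hφt k
  let ρ := UnitaryRep.ofMatrix κ hκ
  let ξ : ρ.H := (liftVec v : EuclideanSpace ℂ (ULift.{u} (Fin n)))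
  have hξ : ∀ z, ρ.coeff ξ ξ z = ((φ z ^ k : ℝ) : ℂ) := fun z => by
    rw [congrFun (UnitaryRep.ofMatrix_coeff hκ v v) z, ← hκv]
  have key : ∀ (p q : G → ℂ), Continuous p → HasCompactSupport p → Continuous q →
      HasCompactSupport q → (∀ w, ‖p w‖ ≤ M) → tsupport p ⊆ L → tsupport q ⊆ L →
      (∀ z ∈ N, ∀ w, ‖p (w * z) - p w‖ ≤ δ) → (∫ y, ‖q y‖ ∂Measure.haar ≤ J) → ∀ s ∈ S,
      ‖(I⁻¹ : ℂ) * ρ.coeff (ρ.smear p ξ) (ρ.smear q ξ) s -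
        ∫ y, star (q y) * p (s⁻¹ * y) ∂Measure.haar‖ ≤ e := by
    intro p q hp hpc hq hqc hpM hpL hqL hpN hqJ s hs
    have hi1 := (ρ.integrable_inner_smear hp hpc hq hqc ξ s).const_mul (I⁻¹ : ℂ)
    have hi2 : Integrable (fun y => star (q y) * p (s⁻¹ * y)) Measure.haar :=
      Continuous.integrable_of_hasCompactSupport (by fun_prop)
        (hqc.comp_left (g := star) (star_zero ℂ)).mul_right
    rw [ρ.coeff_smear hp hpc hq hqc, ← integral_const_mul, ← integral_sub hi1 hi2]
    have hqi : Integrable q Measure.haar := hq.integrable_of_hasCompactSupport hqc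
    refine (norm_integral_le_of_norm_le (hqi.norm.mul_const (δ + 2 * M * δ))
      (Filter.Eventually.of_forall fun y => ?_)).trans ?_
    · by_cases hy : y ∈ tsupport q
      swap
      · rw [image_eq_zero_of_notMem_tsupport hy]
        simp
      have hw : ∀ z ∉ C, p (s⁻¹ * y * z) = 0 := by
        intro z hz
        by_contra hne
        refine hz (Or.inl ⟨y⁻¹ * s, ⟨y⁻¹, Set.inv_mem_inv.2 (hqL hy), s, hs, rfl⟩,
          s⁻¹ * y * z, hpL (subset_tsupport p hne), ?_⟩)
        simp only
        group
      have hb := norm_integral_mul_weight_sub_le hp hpM (hφc.pow k)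
        (fun z => pow_nonneg (hφ0 z) k) hC hNo.measurableSet hδ.le hpN hconc hw
      simp only [hξ]
      have hI' : (I : ℂ) ≠ 0 := by exact_mod_cast hIpos.ne'
      have heq : (I⁻¹ : ℂ) * (star (q y) *
            ∫ z, p (s⁻¹ * y * z) * ((φ z ^ k : ℝ) : ℂ) ∂Measure.haar) - star (q y) * p (s⁻¹ * y) =
          star (q y) * ((I⁻¹ : ℂ) * (∫ z, p (s⁻¹ * y * z) * ((φ z ^ k : ℝ) : ℂ) ∂Measure.haar -
            p (s⁻¹ * y) * (I : ℂ))) := by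
        field_simp
      rw [heq, norm_mul, norm_star, norm_mul, norm_inv, Complex.norm_real,
        Real.norm_of_nonneg hIpos.le]
      refine mul_le_mul_of_nonneg_left ?_ (norm_nonneg _)
      rw [inv_mul_le_iff₀ hIpos, mul_comm I]
      exact hb
    · rw [integral_mul_const]
      calc _ ≤ J * (δ + 2 * M * δ) := by gcongr
        _ = e := by rw [hδdef]; field_simp
  have hgM : ∀ w, ‖g w‖ ≤ M := fun w => (hMg w).trans (le_max_left _ _)
  have hhM : ∀ w, ‖h w‖ ≤ M := fun w => (hMh w).trans (le_max_right _ _)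
  have hgL : tsupport g ⊆ L := Set.subset_union_left
  have hhL : tsupport h ⊆ L := Set.subset_union_right
  have hgN : ∀ z ∈ N, ∀ w, ‖g (w * z) - g w‖ ≤ δ := fun z hz => hgN1 z (interior_subset hz).1
  have hhN : ∀ z ∈ N, ∀ w, ‖h (w * z) - h w‖ ≤ δ := fun z hz => hhN2 z (interior_subset hz).2
  have hgJ : ∫ y, ‖g y‖ ∂Measure.haar ≤ J := by simp only [J]; linarith
  have hhJ : ∫ y, ‖h y‖ ∂Measure.haar ≤ J := by simp only [J]; linarith
  have hsq : ∀ x : ρ.H, ‖ρ.coeff x x 1‖ = ‖x‖ ^ 2 := by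
    intro x
    simp only [UnitaryRep.coeff, map_one, LinearIsometryEquiv.coe_one, id_eq]
    rw [inner_self_eq_norm_sq_to_K]
    simp
  -- The diagonal case of `key` at s = 1, where the coefficient is a squared norm.
  have hng : I⁻¹ * ‖ρ.smear g ξ‖ ^ 2 ≤ Ig + 1 := by
    have h1 := key g g hg hgc hg hgc hgM hgL hgL hgN hgJ 1 (Set.mem_insert _ _)
    have h2 := norm_sub_norm_le ((I⁻¹ : ℂ) * ρ.coeff (ρ.smear g ξ) (ρ.smear g ξ) 1)
      (∫ y, star (g y) * g (1⁻¹ * y) ∂Measure.haar)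
    rw [norm_mul, hsq, norm_inv, Complex.norm_real, Real.norm_of_nonneg hIpos.le] at h2
    linarith [min_le_left 1 ε]
  have hnh : I⁻¹ * ‖ρ.smear h ξ‖ ^ 2 ≤ Ih + 1 := by
    have h1 := key h h hh hhc hh hhc hhM hhL hhL hhN hhJ 1 (Set.mem_insert _ _)
    have h2 := norm_sub_norm_le ((I⁻¹ : ℂ) * ρ.coeff (ρ.smear h ξ) (ρ.smear h ξ) 1)
      (∫ y, star (h y) * h (1⁻¹ * y) ∂Measure.haar)
    rw [norm_mul, hsq, norm_inv, Complex.norm_real, Real.norm_of_nonneg hIpos.le] at h2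
    linarith [min_le_left 1 ε]
  -- The mixed product follows from the two squares by 2ab ≤ a² + b².
  have hnorm : ‖(I⁻¹ : ℂ) • ρ.smear g ξ‖ * ‖ρ.smear h ξ‖ ≤ (Ig + 1) + (Ih + 1) := by
    rw [norm_smul, norm_inv, Complex.norm_real, Real.norm_of_nonneg hIpos.le]
    have h1 := mul_le_mul_of_nonneg_left (two_mul_le_add_sq ‖ρ.smear g ξ‖ ‖ρ.smear h ξ‖)
      (inv_nonneg.2 hIpos.le)
    have h2 : 0 ≤ I⁻¹ * ‖ρ.smear g ξ‖ * ‖ρ.smear h ξ‖ := by positivity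
    nlinarith
  let t : FourierStieltjes G :=
    ⟨ρ.coeff ((I⁻¹ : ℂ) • ρ.smear g ξ) (ρ.smear h ξ), ρ, _, _, rfl⟩
  refine ⟨t, ρ.isTrig_coeff _ _, fun b => ?_, fun s => ?_, fun s hs => ?_⟩
  · exact (norm_fsToDual_le t ρ _ _ rfl b).trans
      (mul_le_mul_of_nonneg_left hnorm (norm_nonneg _))
  · exact (ρ.norm_coeff_le _ _ s).trans hnorm
  · have h1 := key g h hg hgc hh hhc hgM hgL hhL hgN hhJ s (Set.mem_insert_of_mem _ hs)
    have h2 : (t : G → ℂ) s = (I⁻¹ : ℂ) * ρ.coeff (ρ.smear g ξ) (ρ.smear h ξ) s := by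
      simp [t, UnitaryRep.coeff]
    rw [hu, h2, norm_sub_rev]
    exact h1.trans (min_le_right _ _)

theorem leftRegular_coeff_toLp {g h : G → ℂ} (hg : MemLp g 2 (Measure.haar : Measure G))
    (hh : MemLp h 2 (Measure.haar : Measure G)) (s : G) :
    (leftRegular G).coeff (hg.toLp g) (hh.toLp h) s =
      ∫ y, star (h y) * g (s⁻¹ * y) ∂Measure.haar := by
  have h1 : (leftRegular G).toHom s (hg.toLp g) = DomMulAct.mk s⁻¹ • hg.toLp g := rfl
  unfold UnitaryRep.coeff
  rw [h1, DomMulAct.mk_smul_toLp]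
  refine (L2.inner_def _ _).trans (integral_congr_ae ?_)
  filter_upwards [hh.coeFn_toLp, (hg.comp_measurePreserving
    (measurePreserving_smul s⁻¹ (Measure.haar : Measure G))).coeFn_toLp] with y hy1 hy2
  rw [hy1]
  refine (congrArg (fun z => ⟪h y, z⟫_ℂ) hy2).trans ?_
  simp [mul_comm]

theorem exists_compactSupport_near_L2 [T2Space G] (f : Lp ℂ 2 (Measure.haar : Measure G)) {ε : ℝ}
    (hε : 0 < ε) : ∃ (g : G → ℂ) (hg : MemLp g 2 (Measure.haar : Measure G)), Continuous g ∧
      HasCompactSupport g ∧ ‖f - hg.toLp g‖ ≤ ε := by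
  obtain ⟨g, hgs, hgn, hgc, hgm⟩ := exists_hasCompactSupport_eLpNorm_sub_le (p := 2)
    (by norm_num) (Lp.memLp f) (ε := ENNReal.ofReal ε) (by simpa using hε)
  refine ⟨g, hgm, hgc, hgs, ?_⟩
  rw [Lp.norm_def]
  refine ENNReal.toReal_le_of_le_ofReal hε.le (le_of_eq_of_le (eLpNorm_congr_ae ?_) hgn)
  filter_upwards [Lp.coeFn_sub f (hgm.toLp g), hgm.coeFn_toLp] with y h1 h2
  rw [h1, Pi.sub_apply, Pi.sub_apply, h2]

/-- The pairing with a is bounded by ‖a‖‖ξ‖‖η‖, so both vectors may be replaced by nearby continuous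
functions of compact support. -/
theorem fsToDual_eq_zero_of_leftRegular_coeff [T2Space G] (hG : IsMaximallyAlmostPeriodic G)
    (a : groupCStar G)
    (ha : ∀ t : FourierStieltjes G, IsTrig (t : G → ℂ) → fsToDual G t a = 0)
    (ξ η : (leftRegular G).H) (u : FourierStieltjes G)
    (hu : (u : G → ℂ) = (leftRegular G).coeff ξ η) : fsToDual G u a = 0 := by
  let lam := leftRegular G
  let c : lam.H → lam.H → FourierStieltjes G := fun x y => ⟨lam.coeff x y, lam, x, y, rfl⟩
  have hc : ∀ x y, ‖fsToDual G (c x y) a‖ ≤ ‖a‖ * (‖x‖ * ‖y‖) := fun x y =>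
    norm_fsToDual_le _ lam x y rfl a
  have hu' : u = c ξ η := Subtype.ext hu
  have key : ∀ δ : ℝ, 0 < δ → δ ≤ 1 → ‖fsToDual G u a‖ ≤ δ * (‖a‖ * (‖η‖ + ‖ξ‖ + 1)) := by
    intro δ hδ hδ1
    obtain ⟨g, hg, hgc, hgs, hgn⟩ := exists_compactSupport_near_L2 ξ hδ
    obtain ⟨h, hh, hhc, hhs, hhn⟩ := exists_compactSupport_near_L2 η hδ
    let x : lam.H := hg.toLp g
    let y : lam.H := hh.toLp h
    have h0 : fsToDual G (c x y) a = 0 :=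
      fsToDual_eq_zero_of_compactSupport hG a ha hgc hgs hhc hhs _ (leftRegular_coeff_toLp hg hh)
    have hdec : c ξ η = c (ξ - x) η + c x (η - y) + c x y := by
      refine Subtype.ext (funext fun s => ?_)
      simp only [c, Submodule.coe_add, Pi.add_apply, UnitaryRep.coeff, map_sub, inner_sub_right,
        inner_sub_left]
      ring
    rw [hu', hdec, map_add, map_add, add_apply, add_apply, h0, add_zero]
    have hx : ‖x‖ ≤ ‖ξ‖ + 1 := by
      have := norm_sub_norm_le x ξ
      rw [norm_sub_rev] at this
      have h2 : ‖ξ - x‖ ≤ δ := hgn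
      linarith
    have e1 : ‖ξ - x‖ ≤ δ := hgn
    have e2 : ‖η - y‖ ≤ δ := hhn
    calc _ ≤ ‖a‖ * (‖ξ - x‖ * ‖η‖) + ‖a‖ * (‖x‖ * ‖η - y‖) :=
          (norm_add_le _ _).trans (add_le_add (hc _ _) (hc _ _))
      _ ≤ ‖a‖ * (δ * ‖η‖) + ‖a‖ * ((‖ξ‖ + 1) * δ) := by gcongr
      _ = _ := by ring
  rw [← norm_le_zero_iff]
  set R := ‖a‖ * (‖η‖ + ‖ξ‖ + 1)
  have hR : 0 ≤ R := by positivity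
  refine le_of_forall_pos_le_add fun δ hδ => ?_
  refine (key (min 1 (δ / (R + 1))) (lt_min one_pos (by positivity)) (min_le_left _ _)).trans ?_
  calc _ ≤ δ / (R + 1) * R := by gcongr; exact min_le_right _ _
    _ ≤ 0 + δ := by
        rw [zero_add, div_mul_eq_mul_div, div_le_iff₀ (by positivity)]
        nlinarith

/-- The Fourier algebra of a maximally almost periodic group lies in the weak*-closure of the
trigonometric polynomials. -/
theorem fourierAlgebra_subset [T2Space G] (hG : IsMaximallyAlmostPeriodic G) :
    fourierAlgebra G ⊆ fourierStieltjesSpace (finDimSum G) := by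
  intro u hu
  rw [mem_fourierStieltjesSpace_finDimSum]
  intro a ha
  have hspan : ∀ f ∈ Submodule.span ℂ {c | ∃ ξ η, c = (leftRegular G).coeff ξ η},
      ∃ hf : f ∈ FourierStieltjes G, fsToDual G ⟨f, hf⟩ a = 0 := by
    intro f hf
    induction hf using Submodule.span_induction with
    | mem f hf =>
      obtain ⟨ξ, η, rfl⟩ := hf
      exact ⟨⟨leftRegular G, ξ, η, rfl⟩,
        fsToDual_eq_zero_of_leftRegular_coeff hG a ha ξ η _ rfl⟩
    | zero => exact ⟨Submodule.zero_mem _, by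
        rw [show (⟨0, Submodule.zero_mem _⟩ : FourierStieltjes G) = 0 from rfl, map_zero]; rfl⟩
    | add f g _ _ hf hg =>
      obtain ⟨hf, hf0⟩ := hf
      obtain ⟨hg, hg0⟩ := hg
      refine ⟨Submodule.add_mem _ hf hg, ?_⟩
      have := map_add (fsToDual G) ⟨f, hf⟩ ⟨g, hg⟩
      exact (congrArg (fun F => F a) this).trans (by rw [add_apply, hf0, hg0, add_zero])
    | smul c f _ hf =>
      obtain ⟨hf, hf0⟩ := hf
      refine ⟨Submodule.smul_mem _ c hf, ?_⟩
      have := map_smul (fsToDual G) c ⟨f, hf⟩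
      exact (congrArg (fun F => F a) this).trans (by rw [smul_apply, hf0, smul_zero])
  rw [← norm_le_zero_iff]
  refine le_of_forall_pos_le_add fun δ hδ => ?_
  obtain ⟨v, hv, hvn⟩ := hu (δ / (‖a‖ + 1)) (by positivity)
  obtain ⟨hv', hv0⟩ := hspan v hv
  have h1 : fsToDual G u a = fsToDual G (u - v) a := by
    rw [map_sub, sub_apply]
    exact (sub_eq_self.2 hv0).symm
  rw [h1, zero_add]
  refine (norm_fsToDual_le_fsNorm _ _).trans ?_
  rw [lt_div_iff₀ (by positivity)] at hvn
  have h2 : 0 ≤ fsNorm (u - v) := by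
    refine Real.sInf_nonneg ?_
    rintro _ ⟨σ, ξ, η, -, rfl⟩
    positivity
  nlinarith

end approximation

/-! ### Matrices of coefficients -/

section coefficientMatrices

variable {G : Type u} [Group G] [TopologicalSpace G]

theorem UnitaryRep.inner_tmul (σ : UnitaryRep.{u, v} G) (ρ : UnitaryRep.{u, w} G) (x x' : σ.H)
    (y y' : ρ.H) : ⟪σ.tmul ρ x y, σ.tmul ρ x' y'⟫_ℂ = ⟪x, x'⟫_ℂ * ⟪y, y'⟫_ℂ :=
  (UniformSpace.Completion.inner_coe _ _).trans (TensorProduct.inner_tmul ℂ _ _ _ _)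

theorem UnitaryRep.orthonormal_tmul (σ : UnitaryRep.{u, v} G) (ρ : UnitaryRep.{u, w} G)
    {ι : Type*} [DecidableEq ι] {x : ι → σ.H} (hx : Orthonormal ℂ x) {y : ρ.H} (hy : ‖y‖ = 1) :
    Orthonormal ℂ fun i => σ.tmul ρ (x i) y := by
  rw [orthonormal_iff_ite] at hx ⊢
  intro i j
  rw [UnitaryRep.inner_tmul, hx, inner_self_eq_norm_sq_to_K, hy]
  simp

theorem norm_sq_sum_smul_orthonormal {H : Type*} [NormedAddCommGroup H] [InnerProductSpace ℂ H]
    {ι : Type*} [Fintype ι] {x : ι → H} (hx : Orthonormal ℂ x) (c : ι → ℂ) :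
    ‖∑ i, c i • x i‖ ^ 2 = ∑ i, ‖c i‖ ^ 2 := by
  have h := hx.inner_sum c c Finset.univ
  rw [inner_self_eq_norm_sq_to_K] at h
  have h2 : ∀ i, (starRingEnd ℂ) (c i) * c i = ((‖c i‖ ^ 2 : ℝ) : ℂ) := fun i => by
    rw [RCLike.conj_mul]; simp
  simp only [h2] at h
  exact Complex.ofReal_injective (by push_cast at h ⊢; exact h)

variable [IsTopologicalGroup G] [LocallyCompactSpace G] [MeasurableSpace G] [BorelSpace G]

open scoped Matrix.Norms.L2Operator in
/-- The matrix of the coefficients of a representation at two orthonormal families is a complete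
contraction. -/
theorem dualMNorm_coeff_le (σ : UnitaryRep.{u, u} G) {m : ℕ} {x y : Fin m → σ.H}
    (hx : Orthonormal ℂ x) (hy : Orthonormal ℂ y)
    (c : Matrix (Fin m) (Fin m) (FourierStieltjes G))
    (hc : ∀ i j, (c i j : G → ℂ) = σ.coeff (x j) (y i)) :
    dualMNorm (c.map (fsToDual G)) ≤ 1 := by
  let id' : UnitaryRep.{u, u} G → UnitaryRep.{u, u} G := fun σ => σ
  let X : Fin m → (universalRep G).H := fun j => UnitaryRep.dsSingle id' σ (x j)
  let Y : Fin m → (universalRep G).H := fun j => UnitaryRep.dsSingle id' σ (y j)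
  have hX : Orthonormal ℂ X := by
    rw [orthonormal_iff_ite] at hx ⊢
    intro i j
    rw [← hx i j]
    refine (UnitaryRep.inner_dsSingle_right id' σ (x j) (X i)).trans ?_
    simp only [X, UnitaryRep.dsCoord_dsSingle]
  have hY : Orthonormal ℂ Y := by
    rw [orthonormal_iff_ite] at hy ⊢
    intro i j
    rw [← hy i j]
    refine (UnitaryRep.inner_dsSingle_right id' σ (y j) (Y i)).trans ?_
    simp only [Y, UnitaryRep.dsCoord_dsSingle]
  have hval : ∀ i j (a : groupCStar G), fsToDual G (c i j) a =
      ⟪Y i, (a : (universalRep G).H →L[ℂ] (universalRep G).H) (X j)⟫_ℂ := by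
    intro i j a
    rw [fsToDual_apply _ σ _ _ (hc i j)]
    simp only [vectorFunctional, X, Y, UnitaryRep.dsSingle]
    rfl
  refine dualMNorm_le _ zero_le_one fun k a => ?_
  rw [one_mul]
  obtain ⟨N, hN⟩ : ∃ N : ℝ, N = opMNorm (fun p q =>
    (a p q : (universalRep G).H →L[ℂ] (universalRep G).H)) := ⟨_, rfl⟩
  have ha0 : 0 ≤ N := hN ▸ opMNorm_nonneg _
  refine le_of_le_of_eq (b := N) ?_ hN
  refine matrix_norm_le_of_form _ ha0 fun w v => ?_
  -- Orthonormality makes (w, v) ↦ (W, V) isometric into k-fold sums of the Hilbert space. There the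
  -- form becomes ⟨W, aV⟩, bounded by the operator norm of the matrix a.
  let W : Fin k → (universalRep G).H := fun p => ∑ i, w (i, p) • Y i
  let V : Fin k → (universalRep G).H := fun q => ∑ j, v (j, q) • X j
  let Z : Fin k → (universalRep G).H := fun p =>
    ∑ q, (a p q : (universalRep G).H →L[ℂ] (universalRep G).H) (V q)
  have hform : ∑ p, ∑ q, star (w p) *
      (Matrix.of fun p q : Fin m × Fin k => c.map (fsToDual G) p.1 q.1 (a p.2 q.2)) p q * v q =
      ∑ p, ⟪W p, Z p⟫_ℂ := by
    simp only [Fintype.sum_prod_type, Matrix.of_apply, Matrix.map_apply, hval, W, Z, V, sum_inner,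
      inner_sum, map_sum, map_smul, inner_smul_left, inner_smul_right]
    rw [Finset.sum_comm]
    refine Finset.sum_congr rfl fun p _ => ?_
    simp only [Finset.mul_sum]
    rw [Finset.sum_congr rfl fun i _ => Finset.sum_comm, Finset.sum_comm]
    refine Finset.sum_congr rfl fun q _ => ?_
    rw [Finset.sum_comm]
    refine Finset.sum_congr rfl fun j _ => Finset.sum_congr rfl fun i _ => ?_
    simp only [RCLike.star_def]
    ring
  rw [hform]
  have hW : ∑ p, ‖W p‖ ^ 2 = ‖w‖ ^ 2 := by
    simp only [W, norm_sq_sum_smul_orthonormal hY]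
    rw [EuclideanSpace.norm_sq_eq, Fintype.sum_prod_type, Finset.sum_comm]
  have hV : ∑ q, ‖V q‖ ^ 2 = ‖v‖ ^ 2 := by
    simp only [V, norm_sq_sum_smul_orthonormal hX]
    rw [EuclideanSpace.norm_sq_eq, Fintype.sum_prod_type, Finset.sum_comm]
  have hZ : ∑ p, ‖Z p‖ ^ 2 ≤ (N * ‖v‖) ^ 2 := by
    rw [mul_pow, ← hV, hN]
    exact opMNorm_bound_sq (fun p q => (a p q : (universalRep G).H →L[ℂ] (universalRep G).H)) V
  calc ‖∑ p, ⟪W p, Z p⟫_ℂ‖ ≤ ∑ p, ‖W p‖ * ‖Z p‖ :=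
        (norm_sum_le _ _).trans (Finset.sum_le_sum fun p _ => norm_inner_le_norm _ _)
    _ ≤ √(∑ p, ‖W p‖ ^ 2) * √(∑ p, ‖Z p‖ ^ 2) := Real.sum_mul_le_sqrt_mul_sqrt _ _ _
    _ ≤ ‖w‖ * (N * ‖v‖) := by
        refine mul_le_mul ?_ ?_ (Real.sqrt_nonneg _) (norm_nonneg _)
        · rw [hW, Real.sqrt_sq (norm_nonneg _)]
        · exact Real.sqrt_le_iff.2 ⟨by positivity, hZ⟩
    _ = _ := by ring

theorem orthonormal_liftVec_single {n : ℕ} : Orthonormal ℂ fun i : Fin n =>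
    (liftVec (Pi.single i 1) : EuclideanSpace ℂ (ULift.{u} (Fin n))) := by
  rw [orthonormal_iff_ite]
  intro i j
  rw [inner_liftVec]
  simp [Pi.single_apply, eq_comm]

/-- The entries of a unitary representation, multiplied by one entry of another one, form a
complete contraction. -/
theorem dualMNorm_entries_mul_le {m n : ℕ} {κ : G →* Matrix.unitaryGroup (Fin m) ℂ}
    (hκ : Continuous κ) {τ : G →* Matrix.unitaryGroup (Fin n) ℂ} (hτ : Continuous τ) (k l : Fin n)
    (c : Matrix (Fin m) (Fin m) (FourierStieltjes G))
    (hc : ∀ i j, (c i j : G → ℂ) = fun s => (κ s : Matrix (Fin m) (Fin m) ℂ) i j *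
      (τ s : Matrix (Fin n) (Fin n) ℂ) k l) :
    dualMNorm (c.map (fsToDual G)) ≤ 1 := by
  let σ := UnitaryRep.ofMatrix κ hκ
  let ρ := UnitaryRep.ofMatrix τ hτ
  let e : Fin m → σ.H := fun i => (liftVec (Pi.single i 1) : EuclideanSpace ℂ (ULift.{u} (Fin m)))
  let f : Fin n → ρ.H := fun i => (liftVec (Pi.single i 1) : EuclideanSpace ℂ (ULift.{u} (Fin n)))
  have he : Orthonormal ℂ e := orthonormal_liftVec_single
  have hf : Orthonormal ℂ f := orthonormal_liftVec_single
  -- Multiplying by one fixed entry of τ tensors the basis vectors with fixed unit vectors, which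
  -- keeps them orthonormal.
  refine dualMNorm_coeff_le (σ.tensor ρ) (σ.orthonormal_tmul ρ he (hf.norm_eq_one l))
    (σ.orthonormal_tmul ρ he (hf.norm_eq_one k)) c fun i j => ?_
  rw [hc, UnitaryRep.tensor_coeff]
  have h1 : σ.coeff (e j) (e i) = _ := UnitaryRep.ofMatrix_coeff hκ _ _
  have h2 : ρ.coeff (f l) (f k) = _ := UnitaryRep.ofMatrix_coeff hτ _ _
  rw [h1, h2, matCoeff_single, matCoeff_single]
  rfl

end coefficientMatrices

/-! ### Functions of two variables -/

section tensor

open scoped TensorProduct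

variable {S : Type*} (B : Subalgebra ℂ (S → ℂ))

/-- An element of `B ⊗ B` as a function of two variables. -/
noncomputable def evalTensor : B ⊗[ℂ] B →ₗ[ℂ] S → S → ℂ :=
  TensorProduct.lift (LinearMap.mk₂ ℂ (fun b c s t => (b : S → ℂ) s * (c : S → ℂ) t)
    (fun b b' c => by funext s t; simp [add_mul])
    (fun r b c => by funext s t; simp [mul_assoc])
    (fun b c c' => by funext s t; simp [mul_add])
    (fun r b c => by funext s t; simp [mul_left_comm]))

theorem evalTensor_tmul (b c : B) (s t : S) :
    evalTensor B (b ⊗ₜ c) s t = (b : S → ℂ) s * (c : S → ℂ) t := rfl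

/-- Expand in a basis of the second factor: for each s, linear independence kills all coefficients.
Identities in B ⊗ B can therefore be checked pointwise. -/
theorem evalTensor_injective : Function.Injective (evalTensor B) := by
  classical
  rw [injective_iff_map_eq_zero]
  intro z hz
  let 𝒞 := Module.Basis.ofVectorSpace ℂ B
  obtain ⟨b, rfl⟩ := (TensorProduct.equivFinsuppOfBasisRight (M := B) 𝒞).symm.surjective z
  rw [TensorProduct.equivFinsuppOfBasisRight_symm_apply] at hz ⊢
  have hb : b = 0 := by
    have hlin : ∀ s, ∑ i ∈ b.support, ((b i : B) : S → ℂ) s • 𝒞 i = 0 := by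
      intro s
      refine Subtype.ext (funext fun t => ?_)
      have h := congrFun (congrFun hz s) t
      simp only [Finsupp.sum, map_sum, Finset.sum_apply, evalTensor_tmul, Pi.zero_apply] at h
      simpa [Finset.sum_apply] using h
    ext i s
    by_cases hi : i ∈ b.support
    · exact linearIndependent_iff'.1 𝒞.linearIndependent b.support _ (hlin s) i hi
    · simp [Finsupp.notMem_support_iff.1 hi]
  rw [hb, Finsupp.sum_zero_index]

end tensor

/-! ### Square roots of positive semidefinite matrices -/

open scoped ComplexOrder in
/-- A positive semidefinite matrix has a square root that commutes with everything that commutes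
with the matrix. -/
theorem Matrix.PosSemidef.exists_sqrt_commute {ι : Type*} [Fintype ι] [DecidableEq ι]
    {Q : Matrix ι ι ℂ} (hQ : Q.PosSemidef) :
    ∃ S : Matrix ι ι ℂ, S.IsHermitian ∧ S * S = Q ∧ ∀ U, U * Q = Q * U → U * S = S * U := by
  let V : Matrix ι ι ℂ := hQ.isHermitian.eigenvectorUnitary
  have hV1 : star V * V = 1 := Unitary.coe_star_mul_self hQ.isHermitian.eigenvectorUnitary
  have hV2 : V * star V = 1 := Unitary.coe_mul_star_self hQ.isHermitian.eigenvectorUnitary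
  let d : ι → ℝ := hQ.isHermitian.eigenvalues
  have hd : ∀ i, 0 ≤ d i := hQ.eigenvalues_nonneg
  let Dg : Matrix ι ι ℂ := Matrix.diagonal fun i => (d i : ℂ)
  let Rt : Matrix ι ι ℂ := Matrix.diagonal fun i => ((√(d i) : ℝ) : ℂ)
  have hQV : Q = V * Dg * star V := by
    have h := hQ.isHermitian.spectral_theorem
    rw [Unitary.conjStarAlgAut_apply] at h
    exact h
  have hRR : Rt * Rt = Dg := by
    simp only [Rt, Dg, Matrix.diagonal_mul_diagonal]
    congr 1
    funext i
    rw [← Complex.ofReal_mul, Real.mul_self_sqrt (hd i)]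
  refine ⟨V * Rt * star V, ?_, ?_, fun U hU => ?_⟩
  · have hR : star Rt = Rt := by
      simp only [Rt, Matrix.star_eq_conjTranspose, Matrix.diagonal_conjTranspose]
      congr 1
      funext i
      simp
    change star (V * Rt * star V) = _
    rw [star_mul, star_mul, star_star, hR, mul_assoc]
  · calc V * Rt * star V * (V * Rt * star V) = V * Rt * (star V * V) * Rt * star V := by
          simp only [mul_assoc]
      _ = V * (Rt * Rt) * star V := by rw [hV1, mul_one, mul_assoc V]
      _ = Q := by rw [hRR, hQV]
  · set W := star V * U * V with hW
    have hUW : U = V * W * star V := by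
      calc U = (V * star V) * U * (V * star V) := by rw [hV2, one_mul, mul_one]
        _ = _ := by simp only [hW, mul_assoc]
    have hWD : W * Dg = Dg * W := by
      calc W * Dg = star V * (U * (V * Dg * star V)) * V := by
            simp only [hW, mul_assoc, hV1, mul_one]
        _ = star V * (V * Dg * star V * U) * V := by rw [← hQV, hU]
        _ = (star V * V) * Dg * (star V * U * V) := by simp only [mul_assoc]
        _ = _ := by rw [hV1, one_mul]
    -- Commuting with a diagonal matrix means that W i j = 0 unless the eigenvalues d i and d j
    -- agree, and then their roots agree as well.
    have hWR : W * Rt = Rt * W := by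
      ext i j
      have h := congrFun (congrFun hWD i) j
      simp only [Dg, Rt, Matrix.mul_diagonal, Matrix.diagonal_mul] at h ⊢
      by_cases h0 : W i j = 0
      · simp [h0]
      · rw [mul_comm] at h
        have h' : d j = d i := by exact_mod_cast mul_right_cancel₀ h0 h
        rw [h', mul_comm]
    calc U * (V * Rt * star V) = V * W * (star V * V) * Rt * star V := by
          rw [hUW]; simp only [mul_assoc]
      _ = V * (Rt * W) * star V := by rw [hV1, mul_one, mul_assoc V, hWR]
      _ = V * Rt * (star V * V) * W * star V := by rw [hV1, mul_one, mul_assoc V Rt]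
      _ = _ := by conv_rhs => rw [hUW]
                  simp only [mul_assoc]

/-! ### Matrix coefficients of compact groups -/

section compactGroup

variable {K : Type*} [Group K] [TopologicalSpace K] [IsTopologicalGroup K] [CompactSpace K]
  [MeasurableSpace K] [BorelSpace K]

/-- A right translate of the Haar probability measure is again a Haar probability measure, hence
equal to it. -/
theorem exists_biinvariant_probability (K : Type*) [Group K] [TopologicalSpace K]
    [IsTopologicalGroup K] [CompactSpace K] [MeasurableSpace K] [BorelSpace K] :
    ∃ μ : Measure K, IsProbabilityMeasure μ ∧ μ.IsMulLeftInvariant ∧ μ.IsMulRightInvariant ∧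
      μ.IsOpenPosMeasure := by
  let K₀ : TopologicalSpace.PositiveCompacts K := ⊤
  let μ : Measure K := Measure.haarMeasure K₀
  have hμ : IsProbabilityMeasure μ := ⟨Measure.haarMeasure_self⟩
  refine ⟨μ, hμ, inferInstance, ⟨fun g => ?_⟩, inferInstance⟩
  have hm : Measurable fun x : K => x * g := (continuous_mul_const g).measurable
  have h1 : IsProbabilityMeasure (μ.map (· * g)) :=
    Measure.isProbabilityMeasure_map hm.aemeasurable
  exact Measure.isHaarMeasure_eq_of_isProbabilityMeasure _ _

theorem continuous_integrable (μ : Measure K) [IsFiniteMeasure μ] {F : Type*}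
    [NormedAddCommGroup F] {f : K → F} (hf : Continuous f) : Integrable f μ :=
  hf.integrable_of_hasCompactSupport (HasCompactSupport.of_compactSpace f)

open scoped ComplexOrder in
/-- The functions `(s, t) ↦ ∫ f(s⁻¹xt) conj h(x) dx` are coefficients of the representation
`conj κ ⊗ κ` of `K × K`, at vectors of the right norm. -/
theorem exists_coeff_vectors (μ : Measure K) [IsFiniteMeasure μ] [μ.IsMulLeftInvariant]
    [μ.IsMulRightInvariant] {n : ℕ} {κ : K →* Matrix.unitaryGroup (Fin n) ℂ} (hκ : Continuous κ) :
    ∃ S : Matrix (Fin n × Fin n) (Fin n × Fin n) ℂ, ∀ v w v' w' : Fin n → ℂ,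
      let α : EuclideanSpace ℂ (Fin n × Fin n) :=
        WithLp.toLp 2 (S.mulVec fun q => star (w q.1) * v q.2)
      let β : EuclideanSpace ℂ (Fin n × Fin n) :=
        WithLp.toLp 2 (S.mulVec fun q => star (w' q.1) * v' q.2)
      (∀ s t : K, ∑ p, ∑ q, (star (β p) * α q) *
        (star ((κ s : Matrix (Fin n) (Fin n) ℂ) p.1 q.1) *
          (κ t : Matrix (Fin n) (Fin n) ℂ) p.2 q.2) =
        ∫ x, matCoeff κ v w (s⁻¹ * x * t) * star (matCoeff κ v' w' x) ∂μ) ∧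
      ‖α‖ ^ 2 = ∫ x, ‖matCoeff κ v w x‖ ^ 2 ∂μ := by
  let e : Fin n × Fin n → K → ℂ := fun q x => (κ x : Matrix (Fin n) (Fin n) ℂ) q.1 q.2
  have hec : ∀ q, Continuous (e q) := fun q => continuous_unitary_entry hκ q.1 q.2
  let F : (Fin n × Fin n → ℂ) → K → ℂ := fun A x => ∑ q, A q * e q x
  let Q : Matrix (Fin n × Fin n) (Fin n × Fin n) ℂ :=
    Matrix.of fun p q => ∫ x, star (e p x) * e q x ∂μ
  let U : K → K → Matrix (Fin n × Fin n) (Fin n × Fin n) ℂ := fun s t => Matrix.of fun p q =>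
    star ((κ s : Matrix (Fin n) (Fin n) ℂ) p.1 q.1) * (κ t : Matrix (Fin n) (Fin n) ℂ) p.2 q.2
  have hstar : ∀ (s : K) i j, star ((κ s : Matrix (Fin n) (Fin n) ℂ) i j) =
      (κ s⁻¹ : Matrix (Fin n) (Fin n) ℂ) j i := by
    intro s i j
    rw [map_inv]
    rfl
  have hmul : ∀ (s t : K) i j, (κ (s * t) : Matrix (Fin n) (Fin n) ℂ) i j =
      ∑ k, (κ s : Matrix (Fin n) (Fin n) ℂ) i k * (κ t : Matrix (Fin n) (Fin n) ℂ) k j := by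
    intro s t i j
    rw [map_mul]
    rfl
  have htr : ∀ q s x t, e q (s⁻¹ * x * t) = ∑ r, U s t r q * e r x := by
    intro q s x t
    simp only [e, U, Matrix.of_apply, Fintype.sum_prod_type, hmul, Finset.sum_mul, hstar]
    rw [Finset.sum_comm]
    exact Finset.sum_congr rfl fun k _ => Finset.sum_congr rfl fun l _ => by ring
  have htr' : ∀ p s x t, e p (s * x * t⁻¹) = ∑ r, star (U s t p r) * e r x := by
    intro p s x t
    simp only [e, U, Matrix.of_apply, Fintype.sum_prod_type, hmul, Finset.sum_mul, star_mul',
      hstar, inv_inv]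
    rw [Finset.sum_comm]
    exact Finset.sum_congr rfl fun k _ => Finset.sum_congr rfl fun l _ => by ring
  have hint : ∀ p q, Integrable (fun x => star (e p x) * e q x) μ := fun p q =>
    continuous_integrable μ ((hec p).star.mul (hec q))
  -- Both products are integrals of a conjugated entry times an entry, with the translation placed
  -- on one side or the other; bi-invariance of μ identifies them.
  have hcomm : ∀ s t, U s t * Q = Q * U s t := by
    intro s t
    ext p q
    have h1 : (Q * U s t) p q = ∫ x, star (e p x) * e q (s⁻¹ * x * t) ∂μ := by
      simp only [Matrix.mul_apply, Q, Matrix.of_apply, htr, Finset.mul_sum]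
      rw [integral_finsetSum _ fun r _ => ?_]
      · refine Finset.sum_congr rfl fun r _ => ?_
        rw [← integral_mul_const]
        congr 1
        funext x
        ring
      · exact ((hint p r).const_mul (U s t r q)).congr
          (Filter.Eventually.of_forall fun x => by simp only; ring)
    have h2 : (U s t * Q) p q = ∫ x, star (e p (s * x * t⁻¹)) * e q x ∂μ := by
      simp only [Matrix.mul_apply, Q, Matrix.of_apply, htr', star_sum, star_mul', star_star,
        Finset.sum_mul]
      rw [integral_finsetSum _ fun r _ => ?_]
      · refine Finset.sum_congr rfl fun r _ => ?_
        rw [← integral_const_mul]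
        congr 1
        funext x
        ring
      · exact ((hint r q).const_mul (U s t p r)).congr
          (Filter.Eventually.of_forall fun x => by simp only; ring)
    rw [h1, h2, ← integral_mul_left_eq_self _ s⁻¹, ← integral_mul_right_eq_self _ t]
    congr 1
    funext x
    group
  have hform : ∀ A B : Fin n × Fin n → ℂ,
      dotProduct (star B) (Q.mulVec A) = ∫ x, F A x * star (F B x) ∂μ := by
    intro A B
    simp only [dotProduct, Matrix.mulVec, Q, Matrix.of_apply, F, star_sum, Finset.mul_sum,
      Finset.sum_mul, star_mul', Pi.star_apply]
    rw [integral_finsetSum _ fun p _ => integrable_finsetSum _ fun q _ =>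
      ((hint p q).const_mul (star (B p) * A q)).congr
        (Filter.Eventually.of_forall fun x => by simp only; ring)]
    refine Finset.sum_congr rfl fun p _ => ?_
    rw [integral_finsetSum _ fun q _ => ((hint p q).const_mul (star (B p) * A q)).congr
        (Filter.Eventually.of_forall fun x => by simp only; ring)]
    refine Finset.sum_congr rfl fun q _ => ?_
    rw [mul_comm _ (A q), ← mul_assoc, ← integral_const_mul]
    congr 1
    funext x
    ring
  have hself : ∀ A : Fin n × Fin n → ℂ,
      dotProduct (star A) (Q.mulVec A) = ((∫ x, ‖F A x‖ ^ 2 ∂μ : ℝ) : ℂ) := by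
    intro A
    rw [hform, ← integral_complex_ofReal]
    congr 1
    funext x
    rw [RCLike.star_def, RCLike.mul_conj]
    simp
  have hQ : Q.PosSemidef := by
    refine Matrix.PosSemidef.of_dotProduct_mulVec_nonneg ?_ fun A => ?_
    · ext p q
      simp only [Matrix.conjTranspose_apply, Q, Matrix.of_apply, RCLike.star_def]
      rw [← integral_conj]
      congr 1
      funext x
      simp [mul_comm]
    · rw [hself]
      exact_mod_cast integral_nonneg fun x => by positivity
  -- The Gram matrix Q expresses L² inner products of combinations of entries. Its root moves Q into
  -- the vectors: ⟨B, QUA⟩ = ⟨SB, U(SA)⟩ and ‖SA‖² = ⟨A, QA⟩. No linear independence of the entries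
  -- is needed.
  obtain ⟨S, hS, hSS, hSU⟩ := hQ.exists_sqrt_commute
  refine ⟨S, fun v w v' w' => ?_⟩
  have hF : ∀ v w : Fin n → ℂ, F (fun q => star (w q.1) * v q.2) = matCoeff κ v w := by
    intro v w
    funext x
    simp only [F, e, matCoeff, Fintype.sum_prod_type]
    exact Finset.sum_congr rfl fun i _ => Finset.sum_congr rfl fun j _ => by ring
  set A : Fin n × Fin n → ℂ := fun q => star (w q.1) * v q.2
  set B : Fin n × Fin n → ℂ := fun q => star (w' q.1) * v' q.2
  have hS' : ∀ A B : Fin n × Fin n → ℂ, dotProduct (star (S.mulVec B)) A =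
      dotProduct (star B) (S.mulVec A) := by
    intro A B
    rw [Matrix.star_mulVec, hS.eq, Matrix.dotProduct_mulVec]
  refine ⟨fun s t => ?_, ?_⟩
  · have h1 : ∀ x, F A (s⁻¹ * x * t) = F ((U s t).mulVec A) x := by
      intro x
      simp only [F, htr, Matrix.mulVec, dotProduct, Finset.mul_sum, Finset.sum_mul]
      rw [Finset.sum_comm]
      exact Finset.sum_congr rfl fun k _ => Finset.sum_congr rfl fun l _ => by ring
    rw [← hF v w, ← hF v' w']
    change _ = ∫ x, F A (s⁻¹ * x * t) * star (F B x) ∂μ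
    simp only [h1]
    rw [← hform, ← hSS, ← Matrix.mulVec_mulVec, ← hS', Matrix.mulVec_mulVec, ← hSU _ (hcomm s t), ← Matrix.mulVec_mulVec]
    set α := S.mulVec A
    set β := S.mulVec B
    simp only [dotProduct, Matrix.mulVec, Finset.mul_sum, Pi.star_apply, U, Matrix.of_apply]
    exact Finset.sum_congr rfl fun k _ => Finset.sum_congr rfl fun l _ => by ring
  · have h1 : (((‖(WithLp.toLp 2 (S.mulVec A) : EuclideanSpace ℂ (Fin n × Fin n))‖ ^ 2 : ℝ)) : ℂ) =
        ((∫ x, ‖F A x‖ ^ 2 ∂μ : ℝ) : ℂ) := by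
      rw [← hself, ← hSS, ← Matrix.mulVec_mulVec, ← hS', EuclideanSpace.norm_sq_eq]
      simp only [dotProduct, Pi.star_apply, RCLike.star_def]
      push_cast
      refine Finset.sum_congr rfl fun i _ => ?_
      rw [RCLike.conj_mul]
      simp
    rw [← hF v w]
    exact Complex.ofReal_injective h1

end compactGroup

/-! ### Class functions on U(N) concentrated at the identity. -/

section unitaryGroup

variable {N : ℕ}

instance Matrix.unitaryGroup.compactSpace : CompactSpace (Matrix.unitaryGroup (Fin N) ℂ) := by
  refine isCompact_iff_compactSpace.1 ?_
  have hc : IsCompact (Set.pi Set.univ fun _ : Fin N => Set.pi Set.univ fun _ : Fin N =>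
      Metric.closedBall (0 : ℂ) 1) :=
    isCompact_univ_pi fun _ => isCompact_univ_pi fun _ => isCompact_closedBall _ _
  refine IsCompact.of_isClosed_subset hc ?_ ?_
  · have : ((Matrix.unitaryGroup (Fin N) ℂ : Submonoid (Matrix (Fin N) (Fin N) ℂ)) :
        Set (Matrix (Fin N) (Fin N) ℂ)) = {A | A * star A = 1} := by
      ext A
      exact Matrix.mem_unitaryGroup_iff
    rw [this]
    exact isClosed_eq (by fun_prop) continuous_const
  · intro A hA i _ j _
    rw [mem_closedBall_zero_iff]
    exact entry_norm_bound_of_unitary hA i j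

variable [MeasurableSpace (Matrix.unitaryGroup (Fin N) ℂ)]
  [BorelSpace (Matrix.unitaryGroup (Fin N) ℂ)]

/-- A high power of `peak`, normalised in L², puts nearly all the mass of |f|² where x is close to
1, and there the entries of x* - 1 are small. -/
theorem exists_concentrated_class_function (μ : Measure (Matrix.unitaryGroup (Fin N) ℂ))
    [IsProbabilityMeasure μ] [μ.IsOpenPosMeasure] {ε : ℝ} (hε : 0 < ε) :
    ∃ f : Matrix.unitaryGroup (Fin N) ℂ → ℂ, IsTrig f ∧ (∀ x y, f (y⁻¹ * x * y) = f x) ∧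
      ∫ x, ‖f x‖ ^ 2 ∂μ = 1 ∧ ∀ j l, ∫ x, ‖(star ((x : Matrix (Fin N) (Fin N) ℂ) j l) -
        (1 : Matrix (Fin N) (Fin N) ℂ) j l) * f x‖ ^ 2 ∂μ ≤ ε := by
  set c : ℝ := 4 + 4 * N with hc
  have hc0 : 0 < c := by positivity
  -- Where peak > 1 - η, the squared entry distance is at most cη ≤ ε/2. On the complement it is at
  -- most 4, and the mass bound ε/8 makes up the other half.
  set η : ℝ := min (1 / 2) (ε / (2 * c)) with hη
  have hη0 : 0 < η := by positivity
  have hη1 : η ≤ 1 / 2 := min_le_left _ _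
  have hηε : c * η ≤ ε / 2 := by
    have : η ≤ ε / (2 * c) := min_le_right _ _
    rw [le_div_iff₀ (by positivity)] at this
    linarith
  let φ : Matrix.unitaryGroup (Fin N) ℂ → ℝ := fun x => peak x ^ 2
  have hφc : Continuous φ := continuous_peak.pow 2
  have hφ0 : ∀ x, 0 ≤ φ x := fun x => sq_nonneg _
  have hφ1 : ∀ x, φ x ≤ 1 := fun x => pow_le_one₀ (peak_nonneg x) (peak_le_one x)
  let A : Set (Matrix.unitaryGroup (Fin N) ℂ) := {x | peak x ≤ 1 - η}
  have hA : MeasurableSet A := (isClosed_le continuous_peak continuous_const).measurableSet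
  have hpos : 0 < μ {x | (1 - η / 2) ^ 2 < φ x} := by
    refine IsOpen.measure_pos μ (isOpen_lt continuous_const hφc) ⟨1, ?_⟩
    change (1 - η / 2) ^ 2 < peak 1 ^ 2
    rw [peak_one]
    nlinarith
  obtain ⟨n, hI, hconc⟩ := exists_pow_concentrated μ hφc.measurable hφ0 hφ1 (sq_nonneg (1 - η))
    (by nlinarith : (1 - η) ^ 2 < (1 - η / 2) ^ 2) hpos hA
    (fun x hx => pow_le_pow_left₀ (peak_nonneg x) hx 2) (by positivity : 0 < ε / 8)
  set I := ∫ x, φ x ^ n ∂μ with hIdef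
  let f : Matrix.unitaryGroup (Fin N) ℂ → ℂ := fun x => (((√I)⁻¹ : ℝ) : ℂ) * (peak x : ℂ) ^ n
  have hfn : ∀ x, ‖f x‖ ^ 2 = I⁻¹ * φ x ^ n := by
    intro x
    simp only [f, φ, norm_mul, norm_pow, Complex.norm_real, Real.norm_of_nonneg (peak_nonneg x),
      mul_pow]
    rw [Real.norm_of_nonneg (by positivity), inv_pow, Real.sq_sqrt hI.le, ← pow_mul, ← pow_mul,
      mul_comm n 2]
  refine ⟨f, ?_, fun x y => ?_, ?_, fun j l => ?_⟩
  · have h := ((isPosTrig_peak (κ := MonoidHom.id (Matrix.unitaryGroup (Fin N) ℂ))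
      continuous_id).pow n).isTrig.smul (((√I)⁻¹ : ℝ) : ℂ)
    exact h
  · simp only [f, peak_conj]
  · simp only [hfn]
    rw [integral_const_mul, inv_mul_cancel₀ hI.ne']
  · have hb : ∀ x : Matrix.unitaryGroup (Fin N) ℂ,
        ‖(star ((x : Matrix (Fin N) (Fin N) ℂ) j l) - (1 : Matrix (Fin N) (Fin N) ℂ) j l) * f x‖ ^ 2
          ≤ I⁻¹ * (ε / 2 * φ x ^ n + A.indicator (fun x => 4 * φ x ^ n) x) := by
      intro x
      have hpn : 0 ≤ φ x ^ n := pow_nonneg (hφ0 x) n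
      rw [norm_mul, mul_pow, hfn, ← mul_assoc, mul_comm _ I⁻¹, mul_assoc]
      refine mul_le_mul_of_nonneg_left ?_ (inv_nonneg.2 hI.le)
      have hstar : ‖star ((x : Matrix (Fin N) (Fin N) ℂ) j l) -
          (1 : Matrix (Fin N) (Fin N) ℂ) j l‖ = ‖(x : Matrix (Fin N) (Fin N) ℂ) j l -
          (1 : Matrix (Fin N) (Fin N) ℂ) j l‖ := by
        rw [← norm_star]
        congr 1
        simp [Matrix.one_apply, apply_ite (starRingEnd ℂ)]
      rw [hstar]
      by_cases hx : x ∈ A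
      · rw [Set.indicator_of_mem hx, ← add_mul]
        refine mul_le_mul_of_nonneg_right ?_ hpn
        have h1 : ‖(x : Matrix (Fin N) (Fin N) ℂ) j l‖ ≤ 1 := entry_norm_bound_of_unitary x.2 j l
        have h2 : ‖(1 : Matrix (Fin N) (Fin N) ℂ) j l‖ ≤ 1 :=
          entry_norm_bound_of_unitary (one_mem _) j l
        have h3 := norm_sub_le ((x : Matrix (Fin N) (Fin N) ℂ) j l)
          ((1 : Matrix (Fin N) (Fin N) ℂ) j l)
        have h4 := norm_nonneg ((x : Matrix (Fin N) (Fin N) ℂ) j l -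
          (1 : Matrix (Fin N) (Fin N) ℂ) j l)
        nlinarith
      · rw [Set.indicator_of_notMem hx, add_zero]
        refine mul_le_mul_of_nonneg_right ?_ hpn
        have h1 := sum_sq_norm_sub_one x
        have h2 : ‖(x : Matrix (Fin N) (Fin N) ℂ) j l - (1 : Matrix (Fin N) (Fin N) ℂ) j l‖ ^ 2 ≤
            (4 + 4 * N) * (1 - peak x) := by
          rw [← h1]
          refine (Finset.single_le_sum (f := fun l => ‖(x : Matrix (Fin N) (Fin N) ℂ) j l -
            (1 : Matrix (Fin N) (Fin N) ℂ) j l‖ ^ 2) (fun _ _ => sq_nonneg _)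
            (Finset.mem_univ l)).trans ?_
          exact Finset.single_le_sum (f := fun j => ∑ l, ‖(x : Matrix (Fin N) (Fin N) ℂ) j l -
            (1 : Matrix (Fin N) (Fin N) ℂ) j l‖ ^ 2)
            (fun _ _ => Finset.sum_nonneg fun _ _ => sq_nonneg _) (Finset.mem_univ j)
        have h3 : 1 - η < peak x := not_le.1 hx
        refine h2.trans (le_trans ?_ hηε)
        exact mul_le_mul_of_nonneg_left (by linarith) hc0.le
    have hφi : Integrable (fun x => φ x ^ n) μ := continuous_integrable μ (hφc.pow n)
    have hind : Integrable (A.indicator fun x => 4 * φ x ^ n) μ := (hφi.const_mul 4).indicator hA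
    have hfc : Continuous f := by
      have := continuous_peak (n := N)
      fun_prop
    refine (integral_mono (continuous_integrable μ ?_)
      (((hφi.const_mul (ε / 2)).add hind).const_mul I⁻¹) hb).trans ?_
    · have h1 : Continuous fun x : Matrix.unitaryGroup (Fin N) ℂ =>
          (x : Matrix (Fin N) (Fin N) ℂ) j l :=
        continuous_unitary_entry (κ := MonoidHom.id _) continuous_id j l
      exact ((h1.star.sub continuous_const).mul hfc).norm.pow 2
    · simp only [Pi.add_apply]
      rw [integral_const_mul, integral_add (hφi.const_mul (ε / 2)) hind, integral_const_mul,
        integral_indicator hA, integral_const_mul, inv_mul_le_iff₀ hI]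
      linarith

end unitaryGroup

/-! ### Approximate diagonals -/

section tensor

open scoped TensorProduct

variable {S : Type*} (B : Subalgebra ℂ (S → ℂ))

/-- Multiplication of the second variable by an element of the algebra. -/
noncomputable def mulSnd (a : B) : B ⊗[ℂ] B →ₗ[ℂ] B ⊗[ℂ] B :=
  LinearMap.lTensor B (LinearMap.mulRight ℂ a)

/-- Multiplication of the first variable by an element of the algebra. -/
noncomputable def mulFst (a : B) : B ⊗[ℂ] B →ₗ[ℂ] B ⊗[ℂ] B :=
  LinearMap.rTensor B (LinearMap.mulLeft ℂ a)

theorem evalTensor_mulSnd (a : B) (z : B ⊗[ℂ] B) (s t : S) :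
    evalTensor B (mulSnd B a z) s t = (a : S → ℂ) t * evalTensor B z s t := by
  induction z using TensorProduct.induction_on with
  | zero => simp
  | tmul b c =>
    simp only [mulSnd, LinearMap.lTensor_tmul, LinearMap.mulRight_apply, evalTensor_tmul,
      MulMemClass.coe_mul, Pi.mul_apply]
    ring
  | add z z' h h' => simp only [map_add, Pi.add_apply, h, h', mul_add]

theorem evalTensor_mulFst (a : B) (z : B ⊗[ℂ] B) (s t : S) :
    evalTensor B (mulFst B a z) s t = (a : S → ℂ) s * evalTensor B z s t := by
  induction z using TensorProduct.induction_on with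
  | zero => simp
  | tmul b c =>
    simp only [mulFst, LinearMap.rTensor_tmul, LinearMap.mulLeft_apply, evalTensor_tmul,
      MulMemClass.coe_mul, Pi.mul_apply]
    ring
  | add z z' h h' => simp only [map_add, Pi.add_apply, h, h', mul_add]

theorem mul'_apply_eq_evalTensor (z : B ⊗[ℂ] B) (s : S) :
    (LinearMap.mul' ℂ B z : S → ℂ) s = evalTensor B z s s := by
  induction z using TensorProduct.induction_on with
  | zero => simp
  | tmul b c => simp [evalTensor_tmul]
  | add z z' h h' => simp only [map_add, Pi.add_apply, h, h', AddMemClass.coe_add]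

end tensor

/-! ### Approximate solutions for the entries of one representation. -/

section amenability

open scoped TensorProduct

variable {G : Type u} [Group G] [TopologicalSpace G]

/-- The complex conjugate of a representation by unitary matrices. -/
noncomputable def conjUnitary {n : ℕ} (κ : G →* Matrix.unitaryGroup (Fin n) ℂ) :
    G →* Matrix.unitaryGroup (Fin n) ℂ :=
  (conjRep κ).codRestrict _ (conjRep_mem κ)

theorem continuous_conjUnitary {n : ℕ} {κ : G →* Matrix.unitaryGroup (Fin n) ℂ}
    (hκ : Continuous κ) : Continuous (conjUnitary κ) :=
  (continuous_matrix fun i j => continuous_conjRep hκ i j).subtype_mk _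

variable [IsTopologicalGroup G] [LocallyCompactSpace G] [MeasurableSpace G] [BorelSpace G]
  {B : Subalgebra ℂ (G → ℂ)} {hB : ∀ u ∈ B, u ∈ FourierStieltjes G}
  {X : Type w} [NormedAddCommGroup X] [NormedSpace ℂ X] [CompleteSpace X] [OperatorSpace X]

/-- An entry of a continuous representation by unitary matrices. -/
def IsUnitaryEntry (f : G → ℂ) : Prop :=
  ∃ (n : ℕ) (τ : G →* Matrix.unitaryGroup (Fin n) ℂ) (k l : Fin n), Continuous τ ∧
    f = fun s => (τ s : Matrix (Fin n) (Fin n) ℂ) k l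

theorem isUnitaryEntry_one : IsUnitaryEntry (1 : G → ℂ) :=
  ⟨1, 1, 0, 0, continuous_const, by funext s; simp⟩

/-- The entries of a representation as elements of an algebra. -/
def entryMatrix (hT : trigAlgebra G ≤ B) {n : ℕ} {κ : G →* Matrix.unitaryGroup (Fin n) ℂ}
    (hκ : Continuous κ) : Matrix (Fin n) (Fin n) B :=
  fun i j => ⟨fun s => (κ s : Matrix (Fin n) (Fin n) ℂ) i j, hT (isTrig_entry hκ i j)⟩

/-- Multiplication in the second variable takes place before D is applied, so the estimate must
survive multiplication by an entry. -/
theorem dualMNorm_entryMatrix_mul_le (hT : trigAlgebra G ≤ B) {n : ℕ}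
    {κ : G →* Matrix.unitaryGroup (Fin n) ℂ} (hκ : Continuous κ) {a : B}
    (ha : IsUnitaryEntry (a : G → ℂ)) :
    dualMNorm (((entryMatrix hT hκ).map (· * a)).map (subalgebraToDual B hB)) ≤ 1 := by
  obtain ⟨m, τ, k, l, hτ, ha⟩ := ha
  refine dualMNorm_entries_mul_le hκ hτ k l
    (fun i j => ⟨(entryMatrix hT hκ i j * a : B), hB _ (entryMatrix hT hκ i j * a).2⟩) fun i j => ?_
  funext s
  simp [entryMatrix, ha]

theorem dualMNorm_entryMatrix_le (hT : trigAlgebra G ≤ B) {n : ℕ}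
    {κ : G →* Matrix.unitaryGroup (Fin n) ℂ} (hκ : Continuous κ) :
    dualMNorm ((entryMatrix hT hκ).map (subalgebraToDual B hB)) ≤ 1 := by
  have h := dualMNorm_entryMatrix_mul_le (hB := hB) hT hκ (a := 1) isUnitaryEntry_one
  have h1 : (entryMatrix hT hκ).map (· * (1 : B)) = entryMatrix hT hκ := by
    ext i j : 2
    simp
  rwa [h1] at h

/-- The map `b ⊗ c ↦ b · D(c)`. -/
noncomputable def actTensor (E : NormalDualBimodule (subalgebraToDual B hB) X)
    (D : B →ₗ[ℂ] StrongDual ℂ X) : B ⊗[ℂ] B →ₗ[ℂ] StrongDual ℂ X :=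
  TensorProduct.lift (E.left.compl₂ D)

theorem actTensor_tmul (E : NormalDualBimodule (subalgebraToDual B hB) X)
    (D : B →ₗ[ℂ] StrongDual ℂ X) (b c : B) : actTensor E D (b ⊗ₜ c) = E.left b (D c) := rfl

theorem actTensor_mulFst (E : NormalDualBimodule (subalgebraToDual B hB) X)
    (D : B →ₗ[ℂ] StrongDual ℂ X) (a : B) (z : B ⊗[ℂ] B) :
    actTensor E D (mulFst B a z) = E.left a (actTensor E D z) := by
  induction z using TensorProduct.induction_on with
  | zero => simp
  | tmul b c =>
    simp only [mulFst, LinearMap.rTensor_tmul, LinearMap.mulLeft_apply, actTensor_tmul, E.left_mul]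
  | add z z' h h' => simp only [map_add, h, h']

/-- The derivation rule b·D(ca) = bc·D(a) + (b·D(c))·a. Its first term is the source of 1·D(a) once
the product of z is 1. -/
theorem actTensor_mulSnd (E : NormalDualBimodule (subalgebraToDual B hB) X)
    (D : B →ₗ[ℂ] StrongDual ℂ X) (hD : ∀ a b, D (a * b) = E.left a (D b) + E.right b (D a))
    (a : B) (z : B ⊗[ℂ] B) :
    actTensor E D (mulSnd B a z) =
      E.left (LinearMap.mul' ℂ B z) (D a) + E.right a (actTensor E D z) := by
  induction z using TensorProduct.induction_on with
  | zero => simp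
  | tmul b c =>
    simp only [mulSnd, LinearMap.lTensor_tmul, LinearMap.mulRight_apply, actTensor_tmul, hD,
      map_add, LinearMap.mul'_apply, E.left_mul, E.left_right]
  | add z z' h h' =>
    simp only [map_add, h, h', LinearMap.add_apply]
    abel

/-- Coefficients of `conj κ ⊗ κ` act boundedly, in terms of the norms of the vectors. -/
theorem norm_actTensor_coeff_le (hT : trigAlgebra G ≤ B)
    (E : NormalDualBimodule (subalgebraToDual B hB) X) (D : B →ₗ[ℂ] StrongDual ℂ X) {C₁ C₂ : ℝ}
    (hC₁ : 0 ≤ C₁) (hC₂ : 0 ≤ C₂)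
    (hE : ∀ (m n : ℕ) (a : Matrix (Fin m) (Fin m) B) (x : Matrix (Fin n) (Fin n) (StrongDual ℂ X)),
      dualMNorm (Matrix.of fun p q : Fin m × Fin n => E.left (a p.1 q.1) (x p.2 q.2)) ≤
        C₁ * dualMNorm (a.map (subalgebraToDual B hB)) * dualMNorm x)
    (hDC : ∀ (n : ℕ) (a : Matrix (Fin n) (Fin n) B),
      dualMNorm (a.map D) ≤ C₂ * dualMNorm (a.map (subalgebraToDual B hB)))
    {n : ℕ} {κ : G →* Matrix.unitaryGroup (Fin n) ℂ} (hκ : Continuous κ)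
    (α β : EuclideanSpace ℂ (Fin n × Fin n)) {a : B} (ha : IsUnitaryEntry (a : G → ℂ)) :
    ‖actTensor E D (mulSnd B a (∑ p, ∑ q, (star (β p) * α q) •
      (entryMatrix hT (continuous_conjUnitary hκ) p.1 q.1 ⊗ₜ entryMatrix hT hκ p.2 q.2)))‖ ≤
      C₁ * C₂ * (‖α‖ * ‖β‖) := by
  set c := entryMatrix hT (continuous_conjUnitary hκ) with hc
  set e := (entryMatrix hT hκ).map (· * a) with he
  have h1 : actTensor E D (mulSnd B a (∑ p, ∑ q, (star (β p) * α q) •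
      (c p.1 q.1 ⊗ₜ entryMatrix hT hκ p.2 q.2))) =
      ∑ p, ∑ q, (star (β p) * α q) • (Matrix.of fun p q : Fin n × Fin n =>
        E.left (c p.1 q.1) (e.map D p.2 q.2)) p q := by
    simp only [map_sum, map_smul]
    rfl
  rw [h1]
  refine (norm_sum_smul_le_dualMNorm _ _ _).trans ?_
  -- Joint complete boundedness enters here: both entry matrices have norm at most 1 whatever the
  -- size n, so the bound does not depend on the representation.
  have h2 : dualMNorm (Matrix.of fun p q : Fin n × Fin n =>
      E.left (c p.1 q.1) (e.map D p.2 q.2)) ≤ C₁ * C₂ := by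
    have h3 : dualMNorm (c.map (subalgebraToDual B hB)) ≤ 1 := dualMNorm_entryMatrix_le hT _
    have h4 : dualMNorm (e.map D) ≤ C₂ := (hDC n e).trans
      (mul_le_of_le_one_right hC₂ (dualMNorm_entryMatrix_mul_le hT hκ ha))
    refine (hE n n c (e.map D)).trans ?_
    exact mul_le_mul (mul_le_of_le_one_right hC₁ h3) h4 (dualMNorm_nonneg _) hC₁
  calc _ ≤ C₁ * C₂ * ‖β‖ * ‖α‖ := by gcongr
    _ = _ := by ring

/-- The function `(s, t) ↦ ∫ f(τ(s)⁻¹xτ(t)) conj h(x) dx` belongs to `B ⊗ B`, and it acts with the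
norm `‖f‖₂ ‖h‖₂`. -/
theorem exists_tensor_of_trig (hT : trigAlgebra G ≤ B)
    (E : NormalDualBimodule (subalgebraToDual B hB) X) (D : B →ₗ[ℂ] StrongDual ℂ X) {C₁ C₂ : ℝ}
    (hC₁ : 0 ≤ C₁) (hC₂ : 0 ≤ C₂)
    (hE : ∀ (m n : ℕ) (a : Matrix (Fin m) (Fin m) B) (x : Matrix (Fin n) (Fin n) (StrongDual ℂ X)),
      dualMNorm (Matrix.of fun p q : Fin m × Fin n => E.left (a p.1 q.1) (x p.2 q.2)) ≤
        C₁ * dualMNorm (a.map (subalgebraToDual B hB)) * dualMNorm x)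
    (hDC : ∀ (n : ℕ) (a : Matrix (Fin n) (Fin n) B),
      dualMNorm (a.map D) ≤ C₂ * dualMNorm (a.map (subalgebraToDual B hB)))
    {K : Type*} [Group K] [TopologicalSpace K] [IsTopologicalGroup K] [CompactSpace K]
    [MeasurableSpace K] [BorelSpace K] (μ : Measure K) [IsFiniteMeasure μ] [μ.IsMulLeftInvariant]
    [μ.IsMulRightInvariant] {τ : G →* K} (hτ : Continuous τ) {f h : K → ℂ} (hf : IsTrig f)
    (hh : IsTrig h) :
    ∃ z : B ⊗[ℂ] B,
      (∀ s t, evalTensor B z s t = ∫ x, f ((τ s)⁻¹ * x * τ t) * star (h x) ∂μ) ∧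
      ∀ a : B, IsUnitaryEntry (a : G → ℂ) → ‖actTensor E D (mulSnd B a z)‖ ≤
        C₁ * C₂ * (√(∫ x, ‖f x‖ ^ 2 ∂μ) * √(∫ x, ‖h x‖ ^ 2 ∂μ)) := by
  obtain ⟨n, κ, v, w, v', w', hκ, rfl, rfl⟩ := hf.exists_common hh
  obtain ⟨S, hS⟩ := exists_coeff_vectors μ hκ
  have hκτ : Continuous (κ.comp τ) := hκ.comp hτ
  obtain ⟨h1, h2⟩ := hS v w v' w'
  -- `S` serves all vectors at once, so this instance computes the norm of β.
  obtain ⟨-, h3⟩ := hS v' w' v' w'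
  set α : EuclideanSpace ℂ (Fin n × Fin n) := WithLp.toLp 2 (S.mulVec fun q => star (w q.1) * v q.2)
  set β : EuclideanSpace ℂ (Fin n × Fin n) :=
    WithLp.toLp 2 (S.mulVec fun q => star (w' q.1) * v' q.2)
  refine ⟨∑ p, ∑ q, (star (β p) * α q) • (entryMatrix hT (continuous_conjUnitary hκτ) p.1 q.1 ⊗ₜ
    entryMatrix hT hκτ p.2 q.2), fun s t => ?_, fun a ha => ?_⟩
  · rw [← h1 (τ s) (τ t)]
    simp only [map_sum, map_smul, Finset.sum_apply, Pi.smul_apply, evalTensor_tmul, smul_eq_mul]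
    rfl
  · rw [← h2, ← h3, Real.sqrt_sq (norm_nonneg _), Real.sqrt_sq (norm_nonneg _)]
    exact norm_actTensor_coeff_le hT E D hC₁ hC₂ hE hDC hκτ α β ha

/-- With y = s⁻¹xt one has s = x t y*. Expanding this product and subtracting t = 1·t·1 leaves terms
that each contain an entry of y* - 1 or of x - 1. -/
theorem unitary_entry_identity {N : ℕ} (s t x : Matrix.unitaryGroup (Fin N) ℂ) (i j : Fin N) :
    ∑ k, ∑ l, (t : Matrix (Fin N) (Fin N) ℂ) k l *
      ((star (((s⁻¹ * x * t : Matrix.unitaryGroup (Fin N) ℂ) : Matrix (Fin N) (Fin N) ℂ) j l) -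
        (1 : Matrix (Fin N) (Fin N) ℂ) j l) * (x : Matrix (Fin N) (Fin N) ℂ) i k +
      (1 : Matrix (Fin N) (Fin N) ℂ) j l * ((x : Matrix (Fin N) (Fin N) ℂ) i k -
        (1 : Matrix (Fin N) (Fin N) ℂ) i k)) =
      (s : Matrix (Fin N) (Fin N) ℂ) i j - (t : Matrix (Fin N) (Fin N) ℂ) i j := by
  set y := s⁻¹ * x * t with hy
  have h1 : x * t * y⁻¹ = s := by rw [hy]; group
  have h2 : (s : Matrix (Fin N) (Fin N) ℂ) i j = ∑ l, ∑ k,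
      (x : Matrix (Fin N) (Fin N) ℂ) i k * (t : Matrix (Fin N) (Fin N) ℂ) k l *
        star ((y : Matrix (Fin N) (Fin N) ℂ) j l) := by
    conv_lhs => rw [← h1]
    change ((x : Matrix (Fin N) (Fin N) ℂ) * (t : Matrix (Fin N) (Fin N) ℂ) *
      star (y : Matrix (Fin N) (Fin N) ℂ)) i j = _
    simp only [Matrix.mul_apply, Finset.sum_mul]
    rfl
  have h3 : (t : Matrix (Fin N) (Fin N) ℂ) i j = ∑ k, ∑ l, (t : Matrix (Fin N) (Fin N) ℂ) k l *
      ((1 : Matrix (Fin N) (Fin N) ℂ) j l * (1 : Matrix (Fin N) (Fin N) ℂ) i k) := by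
    simp [Matrix.one_apply]
  rw [Finset.sum_comm] at h2
  rw [h2, h3, ← Finset.sum_sub_distrib]
  refine Finset.sum_congr rfl fun k _ => ?_
  rw [← Finset.sum_sub_distrib]
  refine Finset.sum_congr rfl fun l _ => ?_
  ring

/-- The previous identity integrated against f(s⁻¹xt) conj f(x). Each small factor is attached to
the copy of f with the same argument, so every integral is again of the form in
`exists_tensor_of_trig`; the entries of t stay outside as multipliers of the second variable. -/
theorem integral_translate_identity {N : ℕ} [MeasurableSpace (Matrix.unitaryGroup (Fin N) ℂ)]
    [BorelSpace (Matrix.unitaryGroup (Fin N) ℂ)] (μ : Measure (Matrix.unitaryGroup (Fin N) ℂ))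
    [IsFiniteMeasure μ] {f : Matrix.unitaryGroup (Fin N) ℂ → ℂ} (hf : Continuous f)
    (s t : Matrix.unitaryGroup (Fin N) ℂ) (i j : Fin N) :
    (s : Matrix (Fin N) (Fin N) ℂ) i j * ∫ x, f (s⁻¹ * x * t) * star (f x) ∂μ =
      (t : Matrix (Fin N) (Fin N) ℂ) i j * ∫ x, f (s⁻¹ * x * t) * star (f x) ∂μ +
      ∑ k, ∑ l, ((t : Matrix (Fin N) (Fin N) ℂ) k l *
        ∫ x, ((star (((s⁻¹ * x * t : Matrix.unitaryGroup (Fin N) ℂ) :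
            Matrix (Fin N) (Fin N) ℂ) j l) - (1 : Matrix (Fin N) (Fin N) ℂ) j l) *
          f (s⁻¹ * x * t)) * star (star ((x : Matrix (Fin N) (Fin N) ℂ) i k) * f x) ∂μ +
        (1 : Matrix (Fin N) (Fin N) ℂ) j l * ((t : Matrix (Fin N) (Fin N) ℂ) k l *
          ∫ x, f (s⁻¹ * x * t) * star ((star ((x : Matrix (Fin N) (Fin N) ℂ) i k) -
            (1 : Matrix (Fin N) (Fin N) ℂ) i k) * f x) ∂μ)) := by
  have hentryc : ∀ i j, Continuous fun x : Matrix.unitaryGroup (Fin N) ℂ =>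
      (x : Matrix (Fin N) (Fin N) ℂ) i j := fun i j =>
    continuous_unitary_entry (κ := MonoidHom.id _) continuous_id i j
  have hy : Continuous fun x => s⁻¹ * x * t := by fun_prop
  have hfy : Continuous fun x => f (s⁻¹ * x * t) := hf.comp hy
  let p : Fin N → Fin N → Matrix.unitaryGroup (Fin N) ℂ → ℂ := fun k l x =>
    ((star (((s⁻¹ * x * t : Matrix.unitaryGroup (Fin N) ℂ) : Matrix (Fin N) (Fin N) ℂ) j l) -
      (1 : Matrix (Fin N) (Fin N) ℂ) j l) * f (s⁻¹ * x * t)) *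
      star (star ((x : Matrix (Fin N) (Fin N) ℂ) i k) * f x)
  let q : Fin N → Matrix.unitaryGroup (Fin N) ℂ → ℂ := fun k x =>
    f (s⁻¹ * x * t) * star ((star ((x : Matrix (Fin N) (Fin N) ℂ) i k) -
      (1 : Matrix (Fin N) (Fin N) ℂ) i k) * f x)
  have hp : ∀ k l, Integrable (p k l) μ := fun k l => continuous_integrable μ
    ((((((hentryc j l).comp hy).star.sub continuous_const)).mul hfy).mul
      ((hentryc i k).star.mul hf).star)
  have hq : ∀ k, Integrable (q k) μ := fun k => continuous_integrable μ
    (hfy.mul (((hentryc i k).star.sub continuous_const).mul hf).star)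
  have hterm : ∀ k l, (t : Matrix (Fin N) (Fin N) ℂ) k l * ∫ x, p k l x ∂μ +
      (1 : Matrix (Fin N) (Fin N) ℂ) j l * ((t : Matrix (Fin N) (Fin N) ℂ) k l * ∫ x, q k x ∂μ) =
      ∫ x, (t : Matrix (Fin N) (Fin N) ℂ) k l *
        (p k l x + (1 : Matrix (Fin N) (Fin N) ℂ) j l * q k x) ∂μ := by
    intro k l
    rw [integral_const_mul, integral_add (hp k l) ((hq k).const_mul _), integral_const_mul]
    ring
  have hint : ∀ k l, Integrable (fun x => (t : Matrix (Fin N) (Fin N) ℂ) k l *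
      (p k l x + (1 : Matrix (Fin N) (Fin N) ℂ) j l * q k x)) μ := fun k l =>
    ((hp k l).add ((hq k).const_mul _)).const_mul _
  rw [Finset.sum_congr rfl fun k _ => Finset.sum_congr rfl fun l _ => hterm k l,
    Finset.sum_congr rfl fun k _ => (integral_finsetSum _ fun l _ => hint k l).symm,
    ← integral_finsetSum _ fun k _ => integrable_finsetSum _ fun l _ => hint k l,
    ← sub_eq_iff_eq_add', ← sub_mul, ← integral_const_mul]
  congr 1
  funext x
  rw [← unitary_entry_identity s t x i j, Finset.sum_mul]
  refine Finset.sum_congr rfl fun k _ => ?_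
  rw [Finset.sum_mul]
  refine Finset.sum_congr rfl fun l _ => ?_
  have hone : star ((1 : Matrix (Fin N) (Fin N) ℂ) i k) = (1 : Matrix (Fin N) (Fin N) ℂ) i k := by
    simp [Matrix.one_apply, apply_ite (starRingEnd ℂ)]
  simp only [p, q, star_mul', star_sub, star_star, hone]
  ring

theorem mulSnd_one {S : Type*} (B : Subalgebra ℂ (S → ℂ)) (z : B ⊗[ℂ] B) : mulSnd B 1 z = z := by
  refine evalTensor_injective B (funext fun s => funext fun t => ?_)
  rw [evalTensor_mulSnd]
  simp

/-- Approximate solutions of the equation `a · x - x · a = 1 · D(a)`, bounded independently of the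
representation and of the error. -/
theorem exists_approx_inner (hT : trigAlgebra G ≤ B)
    (E : NormalDualBimodule (subalgebraToDual B hB) X) (D : B →ₗ[ℂ] StrongDual ℂ X) {C₁ C₂ : ℝ}
    (hC₁ : 0 ≤ C₁) (hC₂ : 0 ≤ C₂)
    (hE : ∀ (m n : ℕ) (a : Matrix (Fin m) (Fin m) B) (x : Matrix (Fin n) (Fin n) (StrongDual ℂ X)),
      dualMNorm (Matrix.of fun p q : Fin m × Fin n => E.left (a p.1 q.1) (x p.2 q.2)) ≤
        C₁ * dualMNorm (a.map (subalgebraToDual B hB)) * dualMNorm x)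
    (hDC : ∀ (n : ℕ) (a : Matrix (Fin n) (Fin n) B),
      dualMNorm (a.map D) ≤ C₂ * dualMNorm (a.map (subalgebraToDual B hB)))
    (hD : ∀ a b, D (a * b) = E.left a (D b) + E.right b (D a))
    {N : ℕ} {τ : G →* Matrix.unitaryGroup (Fin N) ℂ} (hτ : Continuous τ) {ε : ℝ} (hε : 0 < ε) :
    ∃ x : StrongDual ℂ X, ‖x‖ ≤ C₁ * C₂ ∧ ∀ i j,
      ‖E.left (entryMatrix hT hτ i j) x - E.right (entryMatrix hT hτ i j) x -
        E.left 1 (D (entryMatrix hT hτ i j))‖ ≤ ε := by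
  let _ : MeasurableSpace (Matrix.unitaryGroup (Fin N) ℂ) := borel _
  have _ : BorelSpace (Matrix.unitaryGroup (Fin N) ℂ) := ⟨rfl⟩
  obtain ⟨μ, _, _, _, _⟩ := exists_biinvariant_probability (Matrix.unitaryGroup (Fin N) ℂ)
  -- The error is a sum of N² terms, each at most 2C₁C₂δ.
  set δ : ℝ := ε / (N * N * (2 * (C₁ * C₂)) + 1) with hδdef
  have hδ : 0 < δ := by positivity
  obtain ⟨f, hf, hfcl, hf1, hfε⟩ := exists_concentrated_class_function μ
    (by positivity : 0 < δ ^ 2)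
  have hfc := hf.continuous
  have hentry : ∀ i j, IsTrig fun x : Matrix.unitaryGroup (Fin N) ℂ =>
      (x : Matrix (Fin N) (Fin N) ℂ) i j := fun i j =>
    isTrig_entry (κ := MonoidHom.id _) continuous_id i j
  have hentryc : ∀ i j, Continuous fun x : Matrix.unitaryGroup (Fin N) ℂ =>
      (x : Matrix (Fin N) (Fin N) ℂ) i j := fun i j => (hentry i j).continuous
  let g : Fin N → Fin N → Matrix.unitaryGroup (Fin N) ℂ → ℂ := fun j l x =>
    (star ((x : Matrix (Fin N) (Fin N) ℂ) j l) - (1 : Matrix (Fin N) (Fin N) ℂ) j l) * f x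
  let h : Fin N → Fin N → Matrix.unitaryGroup (Fin N) ℂ → ℂ := fun i k x =>
    star ((x : Matrix (Fin N) (Fin N) ℂ) i k) * f x
  have hh : ∀ i k, IsTrig (h i k) := fun i k => (hentry i k).star.mul hf
  have hg : ∀ j l, IsTrig (g j l) := by
    intro j l
    have h1 := (hh j l).add (hf.smul (-(1 : Matrix (Fin N) (Fin N) ℂ) j l))
    convert h1 using 1
    funext x
    simp only [g, h, Pi.add_apply, Pi.smul_apply, smul_eq_mul]
    ring
  have hg2 : ∀ j l, √(∫ x, ‖g j l x‖ ^ 2 ∂μ) ≤ δ := fun j l =>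
    Real.sqrt_le_iff.2 ⟨hδ.le, hfε j l⟩
  have hf2 : √(∫ x, ‖f x‖ ^ 2 ∂μ) = 1 := by rw [hf1, Real.sqrt_one]
  have hh2 : ∀ i k, √(∫ x, ‖h i k x‖ ^ 2 ∂μ) ≤ 1 := by
    intro i k
    refine Real.sqrt_le_iff.2 ⟨zero_le_one, ?_⟩
    rw [one_pow, ← hf1]
    refine integral_mono (continuous_integrable μ ((hh i k).continuous.norm.pow 2))
      (continuous_integrable μ (hfc.norm.pow 2)) fun x => ?_
    simp only [h, norm_mul, norm_star]
    refine pow_le_pow_left₀ (by positivity) ?_ 2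
    exact mul_le_of_le_one_left (norm_nonneg _) (entry_norm_bound_of_unitary x.2 i k)
  obtain ⟨z, hz, hzb⟩ := exists_tensor_of_trig hT E D hC₁ hC₂ hE hDC μ hτ hf hf
  choose z' hz' hzb' using fun i j k l =>
    exists_tensor_of_trig hT E D hC₁ hC₂ hE hDC μ hτ (hg j l) (hh i k)
  choose z'' hz'' hzb'' using fun i k =>
    exists_tensor_of_trig hT E D hC₁ hC₂ hE hDC μ hτ hf (hg i k)
  -- At t = s the translation is a conjugation, which f ignores, leaving ∫|f|² = 1.
  have hmul : LinearMap.mul' ℂ B z = 1 := by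
    refine Subtype.ext (funext fun s => ?_)
    rw [mul'_apply_eq_evalTensor, hz]
    simp only [hfcl]
    have : ∀ x, f x * star (f x) = ((‖f x‖ ^ 2 : ℝ) : ℂ) := fun x => by
      rw [RCLike.star_def, RCLike.mul_conj]; simp
    simp only [this]
    rw [integral_complex_ofReal, hf1]
    simp
  refine ⟨actTensor E D z, ?_, fun i j => ?_⟩
  · have h1 := hzb 1 isUnitaryEntry_one
    rwa [mulSnd_one, hf2, mul_one, mul_one] at h1
  · set a := entryMatrix hT hτ i j with ha
    have hid : mulFst B a z = mulSnd B a z + ∑ k, ∑ l, mulSnd B (entryMatrix hT hτ k l)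
        (z' i j k l + (1 : Matrix (Fin N) (Fin N) ℂ) j l • z'' i k) := by
      refine evalTensor_injective B (funext fun s => funext fun t => ?_)
      simp only [map_sum, map_add, map_smul, Pi.add_apply, Pi.smul_apply,
        Finset.sum_apply, evalTensor_mulFst, evalTensor_mulSnd, hz, hz', hz'', smul_eq_mul]
      exact integral_translate_identity μ hfc (τ s) (τ t) i j
    have hval : E.left a (actTensor E D z) - E.right a (actTensor E D z) - E.left 1 (D a) =
        actTensor E D (∑ k, ∑ l, mulSnd B (entryMatrix hT hτ k l)
          (z' i j k l + (1 : Matrix (Fin N) (Fin N) ℂ) j l • z'' i k)) := by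
      rw [← actTensor_mulFst, hid, map_add, actTensor_mulSnd E D hD, hmul]
      abel
    rw [hval]
    have hC : 0 ≤ C₁ * C₂ := by positivity
    have hb : ∀ k l, ‖actTensor E D (mulSnd B (entryMatrix hT hτ k l)
        (z' i j k l + (1 : Matrix (Fin N) (Fin N) ℂ) j l • z'' i k))‖ ≤ 2 * (C₁ * C₂) * δ := by
      intro k l
      have hent : IsUnitaryEntry (entryMatrix hT hτ k l : G → ℂ) := ⟨N, τ, k, l, hτ, rfl⟩
      rw [map_add, map_add, map_smul, map_smul]
      refine (norm_add_le _ _).trans ?_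
      have h1 : ‖actTensor E D (mulSnd B (entryMatrix hT hτ k l) (z' i j k l))‖ ≤
          C₁ * C₂ * δ := by
        refine (hzb' i j k l _ hent).trans (mul_le_mul_of_nonneg_left ?_ hC)
        calc _ ≤ δ * 1 := mul_le_mul (hg2 j l) (hh2 i k) (Real.sqrt_nonneg _) hδ.le
          _ = δ := mul_one δ
      have h2 : ‖actTensor E D (mulSnd B (entryMatrix hT hτ k l) (z'' i k))‖ ≤ C₁ * C₂ * δ := by
        refine (hzb'' i k _ hent).trans (mul_le_mul_of_nonneg_left ?_ hC)
        rw [hf2, one_mul]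
        exact hg2 i k
      have h3 : ‖(1 : Matrix (Fin N) (Fin N) ℂ) j l‖ ≤ 1 :=
        entry_norm_bound_of_unitary (one_mem _) j l
      rw [norm_smul]
      have h4 := mul_le_of_le_one_left (norm_nonneg
        (actTensor E D (mulSnd B (entryMatrix hT hτ k l) (z'' i k)))) h3
      linarith
    rw [map_sum]
    simp only [map_sum]
    refine (norm_sum_le _ _).trans ((Finset.sum_le_sum fun k _ => (norm_sum_le _ _).trans
      (Finset.sum_le_sum fun l _ => hb k l)).trans ?_)
    simp only [Finset.sum_const, Finset.card_univ, Fintype.card_fin, nsmul_eq_mul]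
    have h5 : δ * (N * N * (2 * (C₁ * C₂)) + 1) = ε := by
      rw [hδdef]; field_simp
    nlinarith

end amenability

/-! ### From approximate solutions to inner derivations. -/

section connes

variable {G : Type u} [Group G] [TopologicalSpace G] [IsTopologicalGroup G]
  [LocallyCompactSpace G] [MeasurableSpace G] [BorelSpace G]
  {B : Subalgebra ℂ (G → ℂ)} {hB : ∀ u ∈ B, u ∈ FourierStieltjes G}
  {X : Type w} [NormedAddCommGroup X] [NormedSpace ℂ X] [CompleteSpace X] [OperatorSpace X]

theorem matCoeff_eq_sum_entryMatrix (hT : trigAlgebra G ≤ B) {n : ℕ}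
    {κ : G →* Matrix.unitaryGroup (Fin n) ℂ} (hκ : Continuous κ) (v w : Fin n → ℂ) (a : B)
    (ha : (a : G → ℂ) = matCoeff κ v w) :
    a = ∑ i, ∑ j, (star (w i) * v j) • entryMatrix hT hκ i j := by
  refine Subtype.ext (ha.trans (funext fun s => ?_))
  simp only [matCoeff, AddSubmonoidClass.coe_finsetSum, SetLike.val_smul, Finset.sum_apply,
    Pi.smul_apply, entryMatrix, smul_eq_mul]
  exact Finset.sum_congr rfl fun i _ => Finset.sum_congr rfl fun j _ => by ring

/-- The equation `a · x - x · a = 1 · D(a)` has a solution `x` that is common to all the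
trigonometric polynomials `a`. -/
theorem exists_inner_on_trig (hT : trigAlgebra G ≤ B)
    (E : NormalDualBimodule (subalgebraToDual B hB) X) (D : B →ₗ[ℂ] StrongDual ℂ X) {C₁ C₂ : ℝ}
    (hC₁ : 0 ≤ C₁) (hC₂ : 0 ≤ C₂)
    (hE : ∀ (m n : ℕ) (a : Matrix (Fin m) (Fin m) B) (x : Matrix (Fin n) (Fin n) (StrongDual ℂ X)),
      dualMNorm (Matrix.of fun p q : Fin m × Fin n => E.left (a p.1 q.1) (x p.2 q.2)) ≤
        C₁ * dualMNorm (a.map (subalgebraToDual B hB)) * dualMNorm x)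
    (hDC : ∀ (n : ℕ) (a : Matrix (Fin n) (Fin n) B),
      dualMNorm (a.map D) ≤ C₂ * dualMNorm (a.map (subalgebraToDual B hB)))
    (hD : ∀ a b, D (a * b) = E.left a (D b) + E.right b (D a)) :
    ∃ x : StrongDual ℂ X, ∀ a : B, IsTrig (a : G → ℂ) →
      E.left a x - E.right a x = E.left 1 (D a) := by
  classical
  let Z : {a : B // IsTrig (a : G → ℂ)} × ℕ → Set (WeakDual ℂ X) := fun p =>
    {x | ‖E.left p.1 (WeakDual.toStrongDual x) - E.right p.1 (WeakDual.toStrongDual x) -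
      E.left 1 (D p.1)‖ ≤ 1 / ((p.2 : ℝ) + 1)}
  have hZ : ∀ p, IsClosed (Z p) := by
    intro p
    have hc := (E.left_dual p.1.1).sub (E.right_dual p.1.1)
    have := (WeakDual.isClosed_closedBall (𝕜 := ℂ) (E.left 1 (D p.1)) (1 / ((p.2 : ℝ) + 1))).preimage hc
    convert this using 1
    ext x
    simp only [Z, Set.mem_preimage, mem_closedBall_iff_norm]
    rfl
  -- Finite intersection property in the ball of radius C₁C₂. Finitely many trigonometric
  -- polynomials are coefficients of a single τ, so `exists_approx_inner` meets finitely many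
  -- conditions at once.
  have hne := (WeakDual.isCompact_closedBall (𝕜 := ℂ) (0 : StrongDual ℂ X)
    (C₁ * C₂)).inter_iInter_nonempty Z hZ fun F => by
      obtain ⟨n, τ, hτ, hspan⟩ := exists_rep_span (F.image fun p => ((p.1 : B) : G → ℂ)) (by
        intro f hf
        obtain ⟨p, -, rfl⟩ := Finset.mem_image.1 hf
        exact p.1.2)
      choose! v w hvw using hspan
      let M : {a : B // IsTrig (a : G → ℂ)} × ℕ → ℝ := fun p =>
        ∑ i, ∑ j, ‖star (w (p.1 : B) i) * v (p.1 : B) j‖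
      have hM : ∀ p, 0 ≤ M p := fun p => by positivity
      -- An error 1/R on the entries of τ, multiplied by the size M p of the coefficients, is within
      -- the tolerance for each p in F.
      set R := ∑ p ∈ F, M p * ((p.2 : ℝ) + 1) + 1 with hR
      have hR0 : 0 < R := by
        have : 0 ≤ ∑ p ∈ F, M p * ((p.2 : ℝ) + 1) :=
          Finset.sum_nonneg fun p _ => mul_nonneg (hM p) (by positivity)
        linarith
      obtain ⟨x, hx, hxa⟩ := exists_approx_inner hT E D hC₁ hC₂ hE hDC hD hτ
        (one_div_pos.2 hR0)
      refine ⟨StrongDual.toWeakDual x, ?_, Set.mem_iInter₂.2 fun p hp => ?_⟩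
      · simpa using hx
      · have hp1 := matCoeff_eq_sum_entryMatrix hT hτ _ _ (p.1 : B)
          (hvw _ (Finset.mem_image_of_mem _ hp))
        have hdec : E.left p.1 x - E.right p.1 x - E.left 1 (D p.1) =
            ∑ i, ∑ j, (star (w (p.1 : B) i) * v (p.1 : B) j) •
              (E.left (entryMatrix hT hτ i j) x - E.right (entryMatrix hT hτ i j) x -
                E.left 1 (D (entryMatrix hT hτ i j))) := by
          conv_lhs => rw [hp1]
          simp only [map_sum, map_smul, LinearMap.sum_apply, LinearMap.smul_apply, smul_sub,
            Finset.sum_sub_distrib]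
        change ‖E.left p.1 x - E.right p.1 x - E.left 1 (D p.1)‖ ≤ _
        rw [hdec]
        have hle : M p * ((p.2 : ℝ) + 1) ≤ R := by
          have := Finset.single_le_sum (f := fun p => M p * ((p.2 : ℝ) + 1))
            (fun p _ => mul_nonneg (hM p) (by positivity)) hp
          linarith
        calc _ ≤ ∑ i, ∑ j, ‖star (w (p.1 : B) i) * v (p.1 : B) j‖ * (1 / R) := by
              refine (norm_sum_le _ _).trans (Finset.sum_le_sum fun i _ =>
                (norm_sum_le _ _).trans (Finset.sum_le_sum fun j _ => ?_))
              rw [norm_smul]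
              exact mul_le_mul_of_nonneg_left (hxa i j) (norm_nonneg _)
          _ = M p * (1 / R) := by simp only [M, Finset.sum_mul]
          _ ≤ 1 / ((p.2 : ℝ) + 1) := by
              rw [mul_one_div, div_le_div_iff₀ hR0 (by positivity), one_mul]
              exact hle
  obtain ⟨x, -, hx⟩ := hne
  refine ⟨WeakDual.toStrongDual x, fun a ha => ?_⟩
  rw [← sub_eq_zero, ← norm_le_zero_iff]
  refine ge_of_tendsto' tendsto_one_div_add_atTop_nhds_zero_nat fun k => ?_
  exact Set.mem_iInter.1 hx (⟨a, ha⟩, k)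

/-- An algebra in which the trigonometric polynomials are weak*-dense is operator
Connes-amenable. -/
theorem operatorConnesAmenable_of_dense_trig (hT : trigAlgebra G ≤ B)
    (hdense : ∀ u ∈ B, ∀ hu : u ∈ FourierStieltjes G, ∀ a : groupCStar G,
      (∀ t : FourierStieltjes G, IsTrig (t : G → ℂ) → fsToDual G t a = 0) →
        fsToDual G ⟨u, hu⟩ a = 0) :
    OperatorConnesAmenable.{u, u + 1, w} (subalgebraToDual B hB) := by
  intro X _ _ _ _ E D hDc hDcb hD
  obtain ⟨C₁, hC₁⟩ := E.left_cb
  obtain ⟨C₂, hC₂⟩ := hDcb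
  obtain ⟨x, hx⟩ := exists_inner_on_trig hT E D (le_max_right C₁ 0) (le_max_right C₂ 0)
    (fun m n a x => (hC₁ m n a x).trans (mul_le_mul_of_nonneg_right
      (mul_le_mul_of_nonneg_right (le_max_left _ _) (dualMNorm_nonneg _)) (dualMNorm_nonneg _)))
    (fun n a => (hC₂ n a).trans (mul_le_mul_of_nonneg_right (le_max_left _ _)
      (dualMNorm_nonneg _))) hD
  set d := D 1
  -- Since D(a) = 1·D(a) + d·a with d = D(1), the part d·a must still be produced. Subtracting d·1
  -- does so, because 1·d·1 = 0 (`hd`) removes its left action.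
  set y := x - E.right 1 d
  have hd : E.left 1 (E.right 1 d) = 0 := by
    have h1 : d = E.left 1 d + E.right 1 d := by
      have := hD 1 1
      rwa [one_mul] at this
    have h2 := congrArg (E.left 1) h1
    rw [map_add, ← E.left_mul, one_mul] at h2
    exact left_eq_add.1 h2
  have htrig : ∀ a : B, IsTrig (a : G → ℂ) → D a = E.left a y - E.right a y := by
    intro a ha
    have h1 : D a = E.left 1 (D a) + E.right a d := by
      have := hD 1 a
      rwa [one_mul] at this
    have h2 : E.left a (E.right 1 d) = 0 := by
      have := E.left_mul a 1 (E.right 1 d)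
      rw [mul_one, hd, map_zero] at this
      exact this
    have h3 : E.right a (E.right 1 d) = E.right a d := by
      rw [← E.right_mul, one_mul]
    rw [map_sub, map_sub, h2, h3, h1, ← hx a ha]
    abel
  refine ⟨y, fun a => ?_⟩
  let _ : TopologicalSpace B := weakStar (subalgebraToDual B hB)
  let T : Submodule ℂ B := (Subalgebra.toSubmodule (trigAlgebra G)).comap B.val.toLinearMap
  -- Normality of the bimodule makes both sides weak*-continuous in a.
  have hcl : IsClosed {a : B | StrongDual.toWeakDual (D a) =
      StrongDual.toWeakDual (E.left a y) - StrongDual.toWeakDual (E.right a y)} :=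
    isClosed_eq hDc ((E.left_normal y).sub (E.right_normal y))
  have hmem : a ∈ closure (T : Set B) := by
    refine (mem_closure_weakStar_iff (subalgebraToDual B hB) T a).2 fun p hp => ?_
    exact hdense a a.2 (hB a a.2) p fun t ht => hp ⟨t, hT ht⟩ ht
  have := closure_minimal (fun t ht => by
    change StrongDual.toWeakDual (D t) = _
    rw [htrig t ht]
    rfl) hcl hmem
  exact this

end connes

/-! ### The weak*-closed algebra generated by finite-dimensional representations. -/

theorem proposition4p5 {G : Type u} [Group G] [TopologicalSpace G] [IsTopologicalGroup G]
    [LocallyCompactSpace G] [T2Space G] [MeasurableSpace G] [BorelSpace G]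
    (hG : IsMaximallyAlmostPeriodic G) :
    ∃ (B : Subalgebra ℂ (G → ℂ)) (hB : ∀ u ∈ B, u ∈ FourierStieltjes G),
      {u : FourierStieltjes G | (u : G → ℂ) ∈ B} = fourierStieltjesSpace (finDimSum G) ∧
      IsClosed[weakStar (fsToDual G)] {u : FourierStieltjes G | (u : G → ℂ) ∈ B} ∧
      fourierAlgebra G ⊆ {u : FourierStieltjes G | (u : G → ℂ) ∈ B} ∧
      OperatorConnesAmenable.{u, u + 1, w} (subalgebraToDual B hB) := by
  let P : FourierStieltjes G → Prop := fun u => ∀ a : groupCStar G,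
    (∀ t : FourierStieltjes G, IsTrig (t : G → ℂ) → fsToDual G t a = 0) → fsToDual G u a = 0
  have hPt : ∀ t : FourierStieltjes G, IsTrig (t : G → ℂ) → P t := fun t ht a ha => ha t ht
  -- Weak* continuity of multiplication by v reduces the first factor to trigonometric polynomials.
  -- Using this first with v arbitrary and then with v trigonometric reduces both factors.
  have hmul : ∀ v : FourierStieltjes G, (∀ t vt : FourierStieltjes G, IsTrig (t : G → ℂ) →
      (vt : G → ℂ) = t * v → P vt) → ∀ u uv : FourierStieltjes G, P u →
      (uv : G → ℂ) = u * v → P uv := by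
    intro v hv u uv hu huv a ha
    obtain ⟨b, hb⟩ := exists_module_action v a
    rw [← hb u uv huv]
    refine hu b fun t ht => ?_
    have hmem := mul_mem_fourierStieltjes t.2 v.2
    rw [hb t ⟨_, hmem⟩ rfl]
    exact hv t ⟨_, hmem⟩ ht rfl a ha
  have hPmul : ∀ u v uv : FourierStieltjes G, P u → P v → (uv : G → ℂ) = u * v → P uv := by
    intro u v uv hu hv huv
    refine hmul v (fun t vt ht hvt => ?_) u uv hu huv
    refine hmul t (fun r rt hr hrt => hPt rt ?_) v vt hv (hvt.trans (mul_comm _ _))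
    rw [hrt]
    exact hr.mul ht
  let B : Subalgebra ℂ (G → ℂ) :=
    { carrier := {u | ∃ hu : u ∈ FourierStieltjes G, P ⟨u, hu⟩}
      mul_mem' := by
        rintro u v ⟨hu, hPu⟩ ⟨hv, hPv⟩
        exact ⟨mul_mem_fourierStieltjes hu hv, hPmul ⟨u, hu⟩ ⟨v, hv⟩ _ hPu hPv rfl⟩
      add_mem' := by
        rintro u v ⟨hu, hPu⟩ ⟨hv, hPv⟩
        refine ⟨Submodule.add_mem _ hu hv, fun a ha => ?_⟩
        have h := map_add (fsToDual G) ⟨u, hu⟩ ⟨v, hv⟩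
        exact (congrArg (fun F => F a) h).trans (by
          rw [add_apply, hPu a ha, hPv a ha, add_zero])
      algebraMap_mem' := by
        intro c
        have hc : IsTrig (algebraMap ℂ (G → ℂ) c) :=
          mem_trigAlgebra.1 ((trigAlgebra G).algebraMap_mem c)
        exact ⟨hc.mem_fourierStieltjes, hPt _ hc⟩ }
  have hBmem : ∀ u : FourierStieltjes G, (u : G → ℂ) ∈ B ↔ P u :=
    fun u => ⟨fun h => h.2, fun h => ⟨u.2, h⟩⟩
  have hBeq : {u : FourierStieltjes G | (u : G → ℂ) ∈ B} = fourierStieltjesSpace (finDimSum G) := by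
    ext u
    rw [mem_fourierStieltjesSpace_finDimSum]
    exact hBmem u
  refine ⟨B, fun u hu => hu.1, hBeq, ?_, ?_, ?_⟩
  · rw [hBeq]
    exact @isClosed_closure _ (weakStar (fsToDual G)) _
  · rw [hBeq]
    exact fourierAlgebra_subset hG
  · exact operatorConnesAmenable_of_dense_trig
      (fun t ht => ⟨IsTrig.mem_fourierStieltjes ht, hPt _ ht⟩) fun u hu _ => hu.2
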